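/- **Setting.** Let $-\infty\le k_{\min}<k_{\max}\le\infty$, and write $[k_{\min},k_{\max}]$ for the set of real $k$ between them. Let the dispersion relation $g\ge 0$ be differentiable and injective on $[k_{\min},k_{\max}]$, and let the coupling $h$ be real-valued and in $L^2([k_{\min},k_{\max}])$. Put $\omega_{\min}=\inf g$ and $\omega_{\max}=\sup g$. Let $\mathcal S\neq 0$ be a complex Hilbert space, and let $H_S$ and $A$ be linear operators in $\mathcal S$ with a dense common domain. On $\mathcal S\otimes\Gamma(L^2([k_{\min},k_{\max}]))$, with bosonic modes $[a_k,a_{k'}^*]=\delta(k-k')$, consider $$H=H_S\otimes 1+1\otimes\int g(k)\,a_k^*a_k\,dk+A\otimes\int h(k)(a_k^*+a_k)\,dk .$$ Hamiltonians are taken on the dense space of finite linear combinations of products of a vector in the common domain of $H_S$ and $A$ with a finite-particle vector built from one-particle vectors in the domain of multiplication by $g$. The spectral density is $$J_0(\omega)=J(\omega)=\pi h^2(g^{-1}(\omega))\left|\frac{dg^{-1}(\omega)}{d\omega}\right| .$$ Assume that $J$ has finite moments and is gapless, that is, $dg^{-1}/d\omega$ exists and $J(\omega)>0$ at every point of $(\omega_{\min},\omega_{\max})$.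 **Orthogonal polynomials.** Let $d\lambda^0(\omega)=\frac{J(\omega)}{\pi}d\omega$ on $(\omega_{\min},\omega_{\max})$. Let $\pi_n$ be its monic orthogonal polynomials, and let $P_n(\lambda^0;\cdot)=\pi_n/\langle\pi_n,\pi_n\rangle^{1/2}$ be the orthonormal ones. Put $\alpha_n=\langle x\pi_n,\pi_n\rangle/\langle \pi_n,\pi_n\rangle$, $\beta_0=\langle\pi_0,\pi_0\rangle$ and $\beta_n=\langle\pi_n,\pi_n\rangle/\langle\pi_{n-1},\pi_{n-1}\rangle$ for $n\ge1$. Further let $$Q_n(\lambda^0;x)=\int\frac{P_n(\lambda^0;t)-P_n(\lambda^0;x)}{t-x}\,d\lambda^0(t),\qquad S(z)=\int\frac{d\lambda^0(x)}{z-x},$$ $$\varphi(\lambda^0;\omega)=\lim_{\epsilon\to0^+}\left[S(\omega-i\epsilon)+S(\omega+i\epsilon)\right].$$ **Particle mapping ($q=0$) and residual spectral densities.** The chain operators are $b_n^*=\int U_n(k)a_k^*\,dk$ and $b_n=\int U_n(k)a_k\,dk$, where $U_n(k)=P_n(\lambda^0;g(k))\,h(k)$. For $m\ge1$, the $m$-th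 embedded system consists of the system and the first $m$ chain sites: $$H_{S_m}=H_S\otimes1+\sqrt{\beta_0}\,A\otimes(b_0^*+b_0)+\sum_{n=0}^{m-2}\sqrt{\beta_{n+1}}\,(b_n^*b_{n+1}+b_nb_{n+1}^*)+\sum_{n=0}^{m-1}\alpha_n b_n^*b_n .$$ A function $J_m$ on $(\omega_{\min},\omega_{\max})$ is an $m$-th residual spectral density if there are a real-valued $h_m\in L^2([k_{\min},k_{\max}])$ and bosonic modes $a_{k,m}$ with the following properties. The modes are given by $\int f(k)\,a_{k,m}^*\,dk=a^*(Wf)$, where $W$ is an isometry of $L^2([k_{\min},k_{\max}])$ onto the orthogonal complement of $U_0,\dots,U_{m-1}$ such that a vector $u$ lies in the domain of multiplication by $g$ if and only if $W^*u$ does. Moreover $$H=H_{S_m}+\int g(k)\,a_{k,m}^*a_{k,m}\,dk+\int h_m(k)\,(a_{k,m}^*b_{m-1}+a_{k,m}b_{m-1}^*)\,dk$$ and $J_m(\omega)=\pi h_m^2(g^{-1}(\omega))\left|\frac{dg^{-1}(\omega)}{d\omega}\right|$. **Theorem.** (i) If $J$ is continuous on $(\omega_{\min},\omega_{\max})$,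 then an $n$-th residual spectral density exists for every $n\ge1$. (ii) With or without continuity of $J$: for every $n\ge 1$ and every $n$-th residual spectral density $J_n$, for almost every $\omega\in(\omega_{\min},\omega_{\max})$ the limit $\varphi(\lambda^0;\omega)$ exists in $\mathbb R$ and $$J_n(\omega)=\frac{J_0(\omega)}{\left(P_{n-1}(\lambda^0;\omega)\frac{\varphi(\lambda^0;\omega)}{2}-Q_{n-1}(\lambda^0;\omega)\right)^2+J_0(\omega)^2P_{n-1}(\lambda^0;\omega)^2}.$$ -/

import Mathlib

open MeasureTheory Filter Topology Polynomial
open scoped TensorProduct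

noncomputable section

/-! ## Orthogonal polynomials of a measure, secondary polynomials, Stieltjes transform, reducer -/

namespace OP

/-- The inner product `⟨u, v⟩ = ∫ u v dμ` of two real polynomials. -/
def polyInner (μ : Measure ℝ) (u v : ℝ[X]) : ℝ := ∫ x, u.eval x * v.eval x ∂μ

/-- The monic orthogonal polynomials `π_n(dμ; ·)` (Gram-Schmidt applied to the monomials). -/
def monicPoly (μ : Measure ℝ) : ℕ → ℝ[X]
  | n => X ^ n - ∑ j : Fin n,
      C (polyInner μ (X ^ n) (monicPoly μ j) / polyInner μ (monicPoly μ j) (monicPoly μ j)) *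
        monicPoly μ j
termination_by n => n
decreasing_by all_goals exact j.2

/-- The squared norm `⟨π_n, π_n⟩`. -/
def normSq (μ : Measure ℝ) (n : ℕ) : ℝ := polyInner μ (monicPoly μ n) (monicPoly μ n)

/-- The orthonormal polynomials `P_n(dμ; ·)`, with positive leading coefficient. -/
def orthonormalPoly (μ : Measure ℝ) (n : ℕ) : ℝ[X] := C (1 / √(normSq μ n)) * monicPoly μ n

/-- `α_n(dμ) = ⟨x π_n, π_n⟩ / ⟨π_n, π_n⟩`. -/
def alpha (μ : Measure ℝ) (n : ℕ) : ℝ :=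
  polyInner μ (X * monicPoly μ n) (monicPoly μ n) / normSq μ n

/-- `β_0(dμ) = ⟨π_0, π_0⟩` and `β_{n+1}(dμ) = ⟨π_{n+1}, π_{n+1}⟩ / ⟨π_n, π_n⟩`. -/
def beta (μ : Measure ℝ) : ℕ → ℝ
  | 0 => normSq μ 0
  | n + 1 => normSq μ (n + 1) / normSq μ n

/-- The secondary polynomial `Q_n(dμ; x) = ∫ (P_n(t) - P_n(x)) / (t - x) dμ(t)`. -/
def secondaryPoly (μ : Measure ℝ) (n : ℕ) (x : ℝ) : ℝ :=
  ∫ t, ((orthonormalPoly μ n).eval t - (orthonormalPoly μ n).eval x) / (t - x) ∂μ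

/-- The Stieltjes transform `S_μ(z) = ∫ dμ(x) / (z - x)`. -/
def stieltjes (μ : Measure ℝ) (z : ℂ) : ℂ := ∫ x : ℝ, 1 / (z - (x : ℂ)) ∂μ

/-- The reducer `φ(dμ; x) = lim_{ε → 0⁺} [S_μ(x - iε) + S_μ(x + iε)]` exists at `x` and has the
(real) value `φ`. -/
def HasReducer (μ : Measure ℝ) (x φ : ℝ) : Prop :=
  Tendsto (fun ε : ℝ => stieltjes μ ((x : ℂ) - Complex.I * (ε : ℂ)) +
      stieltjes μ ((x : ℂ) + Complex.I * (ε : ℂ)))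
    (𝓝[>] 0) (𝓝 (φ : ℂ))

end OP

/-! ## Bosonic Fock space (finite-particle vectors)

The finite-particle vectors over a one-particle space `V` are the symmetric tensors over `V`, that
is, the elements of the symmetric algebra of `V`; the unit of the algebra is the vacuum.  Creation
operators multiply by a one-particle vector, annihilation operators and second quantisations are
determined by the Leibniz rule, so that `[a(f), a*(f')] = ⟨f, f'⟩` and
`[dΓ(T), a*(f)] = a*(T f)`. -/

namespace Fock

variable {M V : Type*} [AddCommGroup M] [Module ℂ M]

section
variable [AddCommGroup V] [Module ℂ V]

/-- The map `Sym(M) → Sym(V)` induced by a linear map `i : M → V`. -/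
def symMap (i : M →ₗ[ℂ] V) : SymmetricAlgebra ℂ M →ₐ[ℂ] SymmetricAlgebra ℂ V :=
  SymmetricAlgebra.lift (SymmetricAlgebra.ι ℂ V ∘ₗ i)

/-- The linear map `D : Sym(M) → Sym(V)` with `D 1 = 0`, `D u = T u` for `u ∈ M`, and the Leibniz
rule `D (x y) = D x · i(y) + i(x) · D y`.  It is read off as the `ε`-part of the algebra
homomorphism into the dual numbers of `Sym(V)` that sends `u ∈ M` to `i u + ε T u`. -/
def leibniz (i : M →ₗ[ℂ] V) (T : M →ₗ[ℂ] SymmetricAlgebra ℂ V) :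
    SymmetricAlgebra ℂ M →ₗ[ℂ] SymmetricAlgebra ℂ V :=
  (TrivSqZeroExt.sndHom (SymmetricAlgebra ℂ V) (SymmetricAlgebra ℂ V)).restrictScalars ℂ ∘ₗ
    (SymmetricAlgebra.lift
      ((TrivSqZeroExt.inlAlgHom ℂ (SymmetricAlgebra ℂ V) (SymmetricAlgebra ℂ V)).toLinearMap ∘ₗ
          SymmetricAlgebra.ι ℂ V ∘ₗ i +
        (TrivSqZeroExt.inrHom (SymmetricAlgebra ℂ V)
          (SymmetricAlgebra ℂ V)).restrictScalars ℂ ∘ₗ T)).toLinearMap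

/-- The creation operator `a*(f)`. -/
def create (f : V) : SymmetricAlgebra ℂ V →ₗ[ℂ] SymmetricAlgebra ℂ V :=
  LinearMap.mulLeft ℂ (SymmetricAlgebra.ι ℂ V f)

/-- The second quantisation `dΓ(T)` of a one-particle operator `T` with domain `D ⊆ V`, on the
finite-particle vectors over `D`. -/
def dGamma (D : Submodule ℂ V) (T : D →ₗ[ℂ] V) :
    SymmetricAlgebra ℂ D →ₗ[ℂ] SymmetricAlgebra ℂ V :=
  leibniz D.subtype (SymmetricAlgebra.ι ℂ V ∘ₗ T)

end

/-- The annihilation operator `a(f)`. -/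
def annihilate [NormedAddCommGroup V] [InnerProductSpace ℂ V] (f : V) :
    SymmetricAlgebra ℂ V →ₗ[ℂ] SymmetricAlgebra ℂ V :=
  leibniz LinearMap.id (Algebra.linearMap ℂ (SymmetricAlgebra ℂ V) ∘ₗ (innerSL ℂ f).toLinearMap)

end Fock

/-! ## The bath and its spectral density -/

/-- The data of a bosonic bath with a linear coupling: the momentum interval `[k_min, k_max]`
(possibly unbounded), the dispersion relation `g` and the coupling function `h`. -/
structure Bath where
  kMin : EReal
  kMax : EReal
  g : ℝ → ℝ
  h : ℝ → ℝ

namespace Bath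

variable (B : Bath)

/-- The momenta `k_min ≤ k ≤ k_max`. -/
def K : Set ℝ := {k | B.kMin ≤ (k : EReal) ∧ (k : EReal) ≤ B.kMax}

/-- `ω_min = inf g`. -/
def ωMin : EReal := ⨅ k ∈ B.K, (B.g k : EReal)

/-- `ω_max = sup g`. -/
def ωMax : EReal := ⨆ k ∈ B.K, (B.g k : EReal)

/-- The open frequency interval `(ω_min, ω_max)`. -/
def freq : Set ℝ := {ω | B.ωMin < (ω : EReal) ∧ (ω : EReal) < B.ωMax}

/-- The inverse of the dispersion relation `g : [k_min, k_max] → ℝ`. -/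
def gInv : ℝ → ℝ := Function.invFunOn B.g B.K

/-- The spectral density `J(ω) = π h²(g⁻¹(ω)) |dg⁻¹(ω)/dω|`. -/
def J (ω : ℝ) : ℝ := Real.pi * B.h (B.gInv ω) ^ 2 * |deriv B.gInv ω|

/-- The spectral density is gapless: its support is all of `(ω_min, ω_max)`. -/
def Gapless : Prop := ∀ ω ∈ B.freq, 0 < B.J ω

/-- The spectral density has finite moments. -/
def FiniteMoments : Prop := ∀ n : ℕ, IntegrableOn (fun ω => ω ^ n * B.J ω) B.freq

/-- The measure `dλ⁰(ω) = (J(ω) / π) dω` on `[ω_min, ω_max]` of the particle mapping. -/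
def lam : Measure ℝ :=
  (volume.restrict B.freq).withDensity fun ω => ENNReal.ofReal (B.J ω / Real.pi)

/-- The one-particle space `L²([k_min, k_max], dk)`. -/
abbrev H1 : Type := Lp ℂ 2 (volume.restrict B.K)

open Classical in
/-- The one-particle vector given by a real function (`0` if it is not square integrable). -/
def vec (f : ℝ → ℝ) : B.H1 :=
  if hf : MemLp (fun k => (f k : ℂ)) 2 (volume.restrict B.K) then hf.toLp else 0

/-- The domain of the multiplication operator by `g`: the `f ∈ L²` with `g f ∈ L²`. -/
def domG : Submodule ℂ B.H1 where
  carrier := {f | MemLp (fun k => (B.g k : ℂ) * f k) 2 (volume.restrict B.K)}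
  zero_mem' := by
    refine (MemLp.zero (ε := ℂ)).ae_eq ?_
    filter_upwards [Lp.coeFn_zero ℂ 2 (volume.restrict B.K)] with k hk
    rw [hk, Pi.zero_apply, mul_zero]
  add_mem' := by
    intro u v hu hv
    refine (MemLp.add hu hv).ae_eq ?_
    filter_upwards [Lp.coeFn_add u v] with k hk
    rw [hk, Pi.add_apply, Pi.add_apply, mul_add]
  smul_mem' := by
    intro c u hu
    refine (MemLp.const_smul hu c).ae_eq ?_
    filter_upwards [Lp.coeFn_smul c u] with k hk
    rw [hk, Pi.smul_apply, Pi.smul_apply, smul_eq_mul, smul_eq_mul, mul_left_comm]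

theorem mem_domG {f : B.H1} (hf : f ∈ B.domG) :
    MemLp (fun k => (B.g k : ℂ) * f k) 2 (volume.restrict B.K) := hf

/-- The multiplication operator by `g`, the one-particle energy, on its domain. -/
def mulG : B.domG →ₗ[ℂ] B.H1 where
  toFun f := (B.mem_domG f.2).toLp
  map_add' := by
    intro u v
    refine Eq.trans ?_ (MemLp.toLp_add (B.mem_domG u.2) (B.mem_domG v.2))
    apply (MemLp.toLp_eq_toLp_iff _ _).2
    filter_upwards [Lp.coeFn_add (u : B.H1) v] with k hk
    rw [Submodule.coe_add, hk, Pi.add_apply, Pi.add_apply, mul_add]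
  map_smul' := by
    intro c u
    refine Eq.trans ?_ (MemLp.toLp_const_smul c (B.mem_domG u.2))
    apply (MemLp.toLp_eq_toLp_iff _ _).2
    filter_upwards [Lp.coeFn_smul c (u : B.H1)] with k hk
    rw [Submodule.coe_smul, hk, Pi.smul_apply, Pi.smul_apply, smul_eq_mul, smul_eq_mul,
      mul_left_comm]

/-- The one-particle functions
`U_n(k) = π_n(dλ⁰; g(k)) h(k) / √⟨π_n, π_n⟩` of the particle mapping; the chain operators are
`b_n* = ∫ U_n(k) a_k* dk` and `b_n = ∫ U_n(k) a_k dk`. -/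
def chainMode (n : ℕ) : B.H1 :=
  B.vec fun k =>
    (OP.monicPoly B.lam n).eval (B.g k) * B.h k / √(OP.normSq B.lam n)

/-- The chain creation operator `b_n*`. -/
def bStar (n : ℕ) : SymmetricAlgebra ℂ B.H1 →ₗ[ℂ] SymmetricAlgebra ℂ B.H1 :=
  Fock.create (B.chainMode n)

/-- The chain annihilation operator `b_n`. -/
def b (n : ℕ) : SymmetricAlgebra ℂ B.H1 →ₗ[ℂ] SymmetricAlgebra ℂ B.H1 :=
  Fock.annihilate (B.chainMode n)

/-! ### Hamiltonians

A Hamiltonian is given by its action on the dense space `D_S ⊗ Sym(D(g))`, where `D_S` is the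
common domain of the system operators `H_S` and `A`, and `Sym(D(g))` is the space of
finite-particle vectors over the domain of the one-particle energy. -/

variable {S : Type*} [NormedAddCommGroup S] [InnerProductSpace ℂ S]

/-- The common domain of two system operators. -/
abbrev sysDom (HS A : S →ₗ.[ℂ] S) : Submodule ℂ S := HS.domain ⊓ A.domain

/-- The operators `D_S ⊗ Sym(D(g)) → S ⊗ Sym(L²)`. -/
abbrev Op (HS A : S →ₗ.[ℂ] S) : Type _ :=
  (sysDom HS A ⊗[ℂ] SymmetricAlgebra ℂ B.domG) →ₗ[ℂ] (S ⊗[ℂ] SymmetricAlgebra ℂ B.H1)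

/-- The operator `H_S` on the common domain. -/
def sysH (HS A : S →ₗ.[ℂ] S) : sysDom HS A →ₗ[ℂ] S :=
  HS.toFun ∘ₗ Submodule.inclusion inf_le_left

/-- The operator `A` on the common domain. -/
def sysA (HS A : S →ₗ.[ℂ] S) : sysDom HS A →ₗ[ℂ] S :=
  A.toFun ∘ₗ Submodule.inclusion inf_le_right

/-- The inclusion `Sym(D(g)) → Sym(L²)`. -/
def coreIncl : SymmetricAlgebra ℂ B.domG →ₗ[ℂ] SymmetricAlgebra ℂ B.H1 :=
  (Fock.symMap B.domG.subtype).toLinearMap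

/-- `X ⊗ F` for a system operator `X` and a Fock space operator `F` defined on all
finite-particle vectors. -/
def tensorOp {HS A : S →ₗ.[ℂ] S} (X : sysDom HS A →ₗ[ℂ] S)
    (F : SymmetricAlgebra ℂ B.H1 →ₗ[ℂ] SymmetricAlgebra ℂ B.H1) : B.Op HS A :=
  TensorProduct.map X (F ∘ₗ B.coreIncl)

/-- `1 ⊗ F`. -/
def envOp (HS A : S →ₗ.[ℂ] S)
    (F : SymmetricAlgebra ℂ B.H1 →ₗ[ℂ] SymmetricAlgebra ℂ B.H1) : B.Op HS A :=
  B.tensorOp (sysDom HS A).subtype F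

/-- The Hamiltonian
`H = H_S ⊗ 1 + 1 ⊗ ∫ g(k) a_k* a_k dk + A ⊗ ∫ h(k) (a_k* + a_k) dk`. -/
def hamiltonian (HS A : S →ₗ.[ℂ] S) : B.Op HS A :=
  B.tensorOp (sysH HS A) LinearMap.id +
    TensorProduct.map (sysDom HS A).subtype (Fock.dGamma B.domG B.mulG) +
    B.tensorOp (sysA HS A) (Fock.create (B.vec B.h) + Fock.annihilate (B.vec B.h))

/-- The Hamiltonian of the `m`th embedded system for the particle mapping, i.e. of the system
together with the first `m` sites of the chain:
`H_S ⊗ 1 + √β_0 A ⊗ (b_0* + b_0) + ∑_{n ≤ m-2} √β_{n+1} (b_n* b_{n+1} + b_n b_{n+1}*)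
  + ∑_{n ≤ m-1} α_n b_n* b_n`. -/
def embeddedSystem (HS A : S →ₗ.[ℂ] S) (m : ℕ) : B.Op HS A :=
  B.tensorOp (sysH HS A) LinearMap.id +
    ((√(OP.beta B.lam 0) : ℝ) : ℂ) • B.tensorOp (sysA HS A) (B.bStar 0 + B.b 0) +
    (∑ n ∈ Finset.range (m - 1), ((√(OP.beta B.lam (n + 1)) : ℝ) : ℂ) •
      B.envOp HS A (B.bStar n ∘ₗ B.b (n + 1) + B.b n ∘ₗ B.bStar (n + 1))) +
    ∑ n ∈ Finset.range m, (OP.alpha B.lam n : ℂ) • B.envOp HS A (B.bStar n ∘ₗ B.b n)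

/-- For an isometry `W` of the one-particle space whose adjoint preserves the domain of `g`, the
operator `W g W*`.  For the modes `a_{k,m}` with `∫ f(k) a_{k,m}* dk = a*(W f)`, its second
quantisation is `∫ g(k) a_{k,m}* a_{k,m} dk`. -/
def transported (W : B.H1 →ₗᵢ[ℂ] B.H1)
    (hW : ∀ u, u ∈ B.domG → W.toContinuousLinearMap.adjoint u ∈ B.domG) :
    B.domG →ₗ[ℂ] B.H1 :=
  W.toLinearMap ∘ₗ B.mulG ∘ₗ W.toContinuousLinearMap.adjoint.toLinearMap.restrict hW

/-- `Jm` is the spectral density of the interaction of the `m`th embedded system with the remaining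
environment.  For `m ≥ 1` this means: there are a coupling function `hm` and bosonic modes
`a_{k,m}`, `k_min ≤ k ≤ k_max`, which span exactly the part of the environment orthogonal to the
chain sites `0, …, m - 1`, such that
`H = H_{S_m} + 1 ⊗ ∫ g(k) a_{k,m}* a_{k,m} dk + 1 ⊗ ∫ hm(k) (a_{k,m}* b_{m-1} + a_{k,m} b_{m-1}*) dk`
and `Jm(ω) = π hm²(g⁻¹(ω)) |dg⁻¹(ω)/dω|`.  The modes are given by the isometry `W`, through
`∫ f(k) a_{k,m}* dk = a*(W f)`.  For `m = 0` it is the initial spectral density. -/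
def IsResidualSpectralDensity (HS A : S →ₗ.[ℂ] S) : ℕ → (ℝ → ℝ) → Prop
  | 0, Jm => ∀ ω ∈ B.freq, Jm ω = B.J ω
  | m + 1, Jm =>
    ∃ (hm : ℝ → ℝ) (W : B.H1 →ₗᵢ[ℂ] B.H1)
      (hW : ∀ u, u ∈ B.domG ↔ W.toContinuousLinearMap.adjoint u ∈ B.domG),
      MemLp hm 2 (volume.restrict B.K) ∧
      W.toLinearMap.range =
        (Submodule.span ℂ (B.chainMode '' {n | n < m + 1}))ᗮ ∧
      B.hamiltonian HS A =
        B.embeddedSystem HS A (m + 1) +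
        TensorProduct.map (sysDom HS A).subtype
          (Fock.dGamma B.domG (B.transported W fun u => (hW u).1)) +
        B.envOp HS A (Fock.create (W (B.vec hm)) ∘ₗ B.b m +
          Fock.annihilate (W (B.vec hm)) ∘ₗ B.bStar m) ∧
      ∀ ω ∈ B.freq, Jm ω = ({ B with h := hm } : Bath).J ω

end Bath

end

/-! Both parts reduce to one-particle statements. Applied to a product of a system vector and a
one-particle vector, the identity of Hamiltonians says exactly that multiplication by `g` has a
Jacobi block on `U_0, …, U_n` (with `m = n + 1`), a copy `W g W*` of itself on the orthogonal
complement, and a rank-two link between `U_n` and `W h_m`. This is `hamiltonian_eq_iff`; it uses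
that `h = √β_0 U_0`.

Formula. Applying `W*` gives `W* g u = g W* u + ⟨U_n, u⟩ h_m`. For `u = (z - g)⁻¹ h` this becomes
`W* (z - g)⁻¹ h = R_n(z) (z - g)⁻¹ h_m`, where `R_n = P_n S - Q_n` is the function of the second
kind (`adjoint_res_vec`). By Parseval, `‖(z - g)⁻¹ h‖²` is the sum of `|R_j|²` over `j ≤ n` plus
`|R_n|² ‖(z - g)⁻¹ h_m‖²`. Multiplied by `Im z`, the two resolvent norms are Poisson integrals of
the spectral densities. Almost everywhere `S` has a finite vertical limit `φ/2 - i J_0`, so as `Im z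
→ 0` the finite sum disappears and `J_0 = |P_n (φ/2 - i J_0) - Q_n|² J_m` remains. The imaginary
part of the limit of `S` is Lebesgue differentiation; the real part comes from Fatou's theorem for
the bounded function `exp(-i S)`. No continuity of `J` enters.

Existence. Let `v = √β_{n+1} P_{n+1}` and let `F = R_v / R_n` be the quotient of the functions of
the second kind of `v` and `P_n`. It is `⟨v, (z - T)⁻¹ v⟩` for the compression `T` of multiplication
by the variable to the complement of the polynomials of degree at most `n`, and `f_z = (v - F(z)
P_n) / (z - t)` is the resolvent vector. So `F` is a Herglotz function with `‖F‖ ≤ C / Im z`.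
Continuity of `J` excludes a singular part: `F` is locally bounded where the density is positive and
`P_n ≠ 0`, has no atoms at the zeros of `P_n` or at the endpoints, and is real outside the support.
Hence `F` is a real constant plus the Cauchy transform of an integrable density, positive almost
everywhere on the frequency interval (`herglotz_representation`, `exists_residual_density`), and
this density defines `h_m`.

The vectors `f_z` and `(z - g)⁻¹ h_m` then have equal Gram matrices, and the latter are total, so an
isometry `W` carries them to the former (`exists_isometry_of_gram`). Its range is the whole
complement of the chain sites because each `1 / (z - t)` is a combination of `f_z` and a polynomial
of degree at most `n`. Comparing resolvents at `i` shows that `W` intertwines multiplication by `g`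
with itself up to the rank-one link, that domains are respected, and that the real constant is zero.
-/

/-! ## The Poisson kernel of the half-plane -/

/-- The Poisson kernel of the upper half-plane at height `y`. -/
noncomputable def poissonHP (y x : ℝ) : ℝ := y / (Real.pi * (x ^ 2 + y ^ 2))

/-- The negative derivative of the Poisson kernel at height one. -/
noncomputable def poissonHPSlope (r : ℝ) : ℝ := 2 * r / (Real.pi * (1 + r ^ 2) ^ 2)

theorem poissonHP_pos {y : ℝ} (hy : 0 < y) (x : ℝ) : 0 < poissonHP y x := by
  unfold poissonHP; positivity

theorem continuous_poissonHP {y : ℝ} (hy : 0 < y) : Continuous (poissonHP y) := by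
  unfold poissonHP
  refine continuous_const.div (by fun_prop) fun x => ?_
  positivity

theorem poissonHP_scale {y : ℝ} (hy : 0 < y) (r : ℝ) :
    poissonHP y (y * r) = y⁻¹ * (Real.pi⁻¹ * (1 + r ^ 2)⁻¹) := by
  unfold poissonHP
  have := Real.pi_pos
  have h1 : (1 + r ^ 2) ≠ 0 := by positivity
  have h2 : (y * r) ^ 2 + y ^ 2 = y ^ 2 * (1 + r ^ 2) := by ring
  rw [h2]
  field_simp

theorem poissonHP_eq_scale {y : ℝ} (hy : 0 < y) (x : ℝ) :
    poissonHP y x = y⁻¹ * (Real.pi⁻¹ * (1 + (y⁻¹ * x) ^ 2)⁻¹) := by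
  rw [← poissonHP_scale hy, mul_inv_cancel_left₀ hy.ne']

theorem integrable_poissonHP {y : ℝ} (hy : 0 < y) : Integrable (poissonHP y) := by
  have h := ((integrable_inv_one_add_sq.comp_mul_left' (inv_ne_zero hy.ne')).const_mul
    Real.pi⁻¹).const_mul y⁻¹
  exact h.congr (ae_of_all _ fun x => (poissonHP_eq_scale hy x).symm)

theorem integral_poissonHP {y : ℝ} (hy : 0 < y) : ∫ x, poissonHP y x = 1 := by
  simp_rw [poissonHP_eq_scale hy]
  rw [integral_const_mul, integral_const_mul,
    Measure.integral_comp_mul_left (fun x : ℝ => (1 + x ^ 2)⁻¹), integral_univ_inv_one_add_sq]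
  rw [inv_inv, abs_of_pos hy, smul_eq_mul]
  have := Real.pi_pos
  field_simp

theorem integrable_poissonHP_sub {y : ℝ} (hy : 0 < y) (x : ℝ) :
    Integrable fun t => poissonHP y (x - t) :=
  (integrable_poissonHP hy).comp_sub_left x

theorem integral_poissonHP_sub {y : ℝ} (hy : 0 < y) (x : ℝ) :
    ∫ t, poissonHP y (x - t) = 1 := by
  rw [integral_sub_left_eq_self (poissonHP y) volume x, integral_poissonHP hy]

theorem poissonHP_le {y : ℝ} (hy : 0 < y) (x : ℝ) : poissonHP y x ≤ 1 / (Real.pi * y) := by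
  unfold poissonHP
  have := Real.pi_pos
  rw [div_le_div_iff₀ (by positivity) (by positivity)]
  nlinarith [sq_nonneg x, mul_nonneg this.le (sq_nonneg x)]

theorem continuous_poissonHPSlope : Continuous poissonHPSlope := by
  unfold poissonHPSlope
  refine Continuous.div (by fun_prop) (by fun_prop) fun x => ?_
  have := Real.pi_pos
  positivity

theorem abs_poissonHPSlope_le (r : ℝ) : |poissonHPSlope r| ≤ Real.pi⁻¹ * (1 + r ^ 2)⁻¹ := by
  unfold poissonHPSlope
  have := Real.pi_pos
  have h1 : (0:ℝ) < 1 + r ^ 2 := by positivity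
  rw [abs_div, abs_of_pos (show 0 < Real.pi * (1 + r ^ 2) ^ 2 by positivity), ← mul_inv,
    inv_eq_one_div, div_le_div_iff₀ (by positivity) (by positivity)]
  have h2 : |2 * r| ≤ 1 + r ^ 2 := by
    rw [abs_mul, abs_two, ← sq_abs r]; nlinarith [sq_nonneg (|r| - 1)]
  have : Real.pi * (1 + r ^ 2) ^ 2 = (1 + r ^ 2) * (Real.pi * (1 + r ^ 2)) := by ring
  rw [this, one_mul]
  gcongr

theorem integrable_poissonHPSlope : Integrable poissonHPSlope :=
  (integrable_inv_one_add_sq.const_mul Real.pi⁻¹).mono'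
    continuous_poissonHPSlope.aestronglyMeasurable
    (ae_of_all _ fun r => by rw [Real.norm_eq_abs]; exact abs_poissonHPSlope_le r)

theorem mul_poissonHPSlope_bounds (r : ℝ) :
    0 ≤ r * poissonHPSlope r ∧ r * poissonHPSlope r ≤ 2 * (Real.pi⁻¹ * (1 + r ^ 2)⁻¹) := by
  have h : r * poissonHPSlope r = 2 * r ^ 2 / (Real.pi * (1 + r ^ 2) ^ 2) := by
    unfold poissonHPSlope; ring
  have := Real.pi_pos
  rw [h]
  refine ⟨by positivity, ?_⟩
  rw [← mul_inv, ← div_eq_mul_inv, div_le_div_iff₀ (by positivity) (by positivity)]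
  have h3 : 2 * (Real.pi * (1 + r ^ 2) ^ 2) = 2 * (1 + r^2) * (Real.pi * (1 + r ^ 2)) := by ring
  rw [h3]
  gcongr
  linarith

theorem integrable_mul_poissonHPSlope : Integrable fun r => r * poissonHPSlope r :=
  ((integrable_inv_one_add_sq.const_mul Real.pi⁻¹).const_mul 2).mono'
    (continuous_id.mul continuous_poissonHPSlope).aestronglyMeasurable
    (ae_of_all _ fun r => by
      rw [Real.norm_eq_abs, abs_of_nonneg (mul_poissonHPSlope_bounds r).1]
      exact (mul_poissonHPSlope_bounds r).2)

theorem tendsto_div_one_add_sq_cocompact :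
    Tendsto (fun r : ℝ => r / (1 + r ^ 2)) (cocompact ℝ) (𝓝 0) := by
  refine squeeze_zero_norm (a := fun r : ℝ => ‖r‖⁻¹) (fun r => ?_)
    (tendsto_inv_atTop_zero.comp tendsto_norm_cocompact_atTop)
  rcases eq_or_ne r 0 with rfl | hr
  · simp
  rw [norm_div, Real.norm_eq_abs, Real.norm_eq_abs,
    abs_of_pos (show 0 < 1 + r ^ 2 by positivity), inv_eq_one_div,
    div_le_div_iff₀ (by positivity) (by positivity)]
  nlinarith [abs_mul_abs_self r]

/-- The function `r / (1 + r ^ 2)` vanishes at both infinities and its derivative is `(1 + r ^ 2)⁻¹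
- π r poissonHPSlope r`, so the two terms have the same integral `π`. -/
theorem integral_mul_poissonHPSlope : ∫ r, r * poissonHPSlope r = 1 := by
  have hπ := Real.pi_pos
  have hd : ∀ r : ℝ, HasDerivAt (fun r : ℝ => r / (1 + r ^ 2))
      ((1 + r ^ 2)⁻¹ - Real.pi * (r * poissonHPSlope r)) r := by
    intro r
    have h1 : (1 + r ^ 2) ≠ 0 := by positivity
    refine HasDerivAt.congr_deriv (f' := _)
      ((hasDerivAt_id r).div (((hasDerivAt_id r).pow 2).const_add 1) h1) ?_
    simp only [poissonHPSlope, id]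
    field_simp
    push_cast
    ring
  have h := integral_of_hasDerivAt_of_tendsto hd
    (integrable_inv_one_add_sq.sub (integrable_mul_poissonHPSlope.const_mul _))
    (tendsto_div_one_add_sq_cocompact.mono_left atBot_le_cocompact)
    (tendsto_div_one_add_sq_cocompact.mono_left atTop_le_cocompact)
  rw [integral_sub integrable_inv_one_add_sq (integrable_mul_poissonHPSlope.const_mul _),
    integral_univ_inv_one_add_sq, integral_const_mul] at h
  have : Real.pi * ∫ r, r * poissonHPSlope r = Real.pi * 1 := by linarith
  exact mul_left_cancel₀ hπ.ne' this

theorem integral_poissonHPSlope : ∫ r, poissonHPSlope r = 0 := by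
  have h : ∫ r, poissonHPSlope (-r) = ∫ r, poissonHPSlope r := integral_neg_eq_self _ _
  have h2 : ∀ r, poissonHPSlope (-r) = -poissonHPSlope r := fun r => by
    unfold poissonHPSlope; ring
  simp_rw [h2] at h
  rw [integral_neg] at h
  linarith

theorem integral_Ioi_poissonHPSlope (a : ℝ) :
    ∫ r in Set.Ioi a, poissonHPSlope r = Real.pi⁻¹ * (1 + a ^ 2)⁻¹ := by
  have hd : ∀ r : ℝ, HasDerivAt (fun r : ℝ => -(Real.pi⁻¹ * (1 + r ^ 2)⁻¹))
      (poissonHPSlope r) r := by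
    intro r
    have h1 : (1 + r ^ 2) ≠ 0 := by positivity
    have hπ := Real.pi_pos
    refine HasDerivAt.congr_deriv (f' := _)
      (((((hasDerivAt_id r).pow 2).const_add 1).inv h1).const_mul Real.pi⁻¹).neg ?_
    simp only [poissonHPSlope, Pi.pow_apply, id]
    field_simp
    push_cast
    ring
  have ht : Tendsto (fun r : ℝ => -(Real.pi⁻¹ * (1 + r ^ 2)⁻¹)) atTop (𝓝 0) := by
    have : Tendsto (fun r : ℝ => 1 + r ^ 2) atTop atTop :=
      tendsto_atTop_add_const_left _ _ (tendsto_pow_atTop two_ne_zero)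
    simpa using ((tendsto_inv_atTop_zero.comp this).const_mul Real.pi⁻¹).neg
  have h := integral_Ioi_of_hasDerivAt_of_tendsto (a := a)
    (hd a).continuousAt.continuousWithinAt (fun x _ => hd x)
    integrable_poissonHPSlope.integrableOn ht
  rw [h]; ring

/-! ### Vertical limits of Poisson integrals -/

section
variable {E : Type*} [NormedAddCommGroup E] [NormedSpace ℝ E] [CompleteSpace E]

/-- The Poisson kernel is a tail integral of its slope, so Fubini rewrites the convolution as an
average of the cumulative integrals of `v`. Differentiability of a primitive at the single point `x`
then suffices for the limit. -/
theorem poissonHP_convolution_eq {v : ℝ → E} (hv : Integrable v) (x : ℝ) {y : ℝ} (hy : 0 < y) :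
    ∫ t, poissonHP y (x - t) • v t =
      ∫ r, poissonHPSlope r • y⁻¹ • ∫ t in Set.Iio (x + y * r), v t := by
  have hprod : Integrable (fun p : ℝ × ℝ => (v p.1, poissonHPSlope p.2).2 • v p.1)
      (volume.prod volume) := by
    exact (integrable_poissonHPSlope.smul_prod hv).swap
  set s : Set (ℝ × ℝ) := {p | p.1 < x + y * p.2} with hs
  have hsm : MeasurableSet s := measurableSet_lt measurable_fst (by fun_prop)
  have hint := (hprod.indicator hsm)
  have hsw := integral_integral_swap (f := fun t r => s.indicator
    (fun p : ℝ × ℝ => (v p.1, poissonHPSlope p.2).2 • v p.1) (t, r)) hint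
  have hL : ∀ t, ∫ r, s.indicator
      (fun p : ℝ × ℝ => (v p.1, poissonHPSlope p.2).2 • v p.1) (t, r) =
        y • poissonHP y (x - t) • v t := by
    intro t
    have h1 : (fun r => s.indicator
      (fun p : ℝ × ℝ => (v p.1, poissonHPSlope p.2).2 • v p.1) (t, r)) =
        (Set.Ioi (y⁻¹ * (t - x))).indicator fun r => poissonHPSlope r • v t := by
      funext r
      have : (t, r) ∈ s ↔ r ∈ Set.Ioi (y⁻¹ * (t - x)) := by
        simp only [hs, Set.mem_ofPred_eq, Set.mem_Ioi]
        rw [inv_mul_lt_iff₀ hy]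
        constructor <;> intro h <;> linarith
      by_cases hr : (t, r) ∈ s
      · rw [Set.indicator_of_mem hr, Set.indicator_of_mem (this.1 hr)]
      · rw [Set.indicator_of_notMem hr, Set.indicator_of_notMem (fun h => hr (this.2 h))]
    rw [h1, integral_indicator measurableSet_Ioi, integral_smul_const,
      integral_Ioi_poissonHPSlope, smul_smul]
    congr 1
    rw [poissonHP_eq_scale hy, ← mul_assoc y, mul_inv_cancel₀ hy.ne', one_mul]
    congr 3
    ring
  have hR : ∀ r, ∫ t, s.indicator
      (fun p : ℝ × ℝ => (v p.1, poissonHPSlope p.2).2 • v p.1) (t, r) =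
        poissonHPSlope r • ∫ t in Set.Iio (x + y * r), v t := by
    intro r
    have h1 : (fun t => s.indicator
      (fun p : ℝ × ℝ => (v p.1, poissonHPSlope p.2).2 • v p.1) (t, r)) =
        (Set.Iio (x + y * r)).indicator fun t => poissonHPSlope r • v t := by
      funext t
      by_cases hr : t < x + y * r
      · rw [Set.indicator_of_mem (show (t, r) ∈ s from hr), Set.indicator_of_mem (by exact hr)]
      · rw [Set.indicator_of_notMem (show (t, r) ∉ s from hr),
          Set.indicator_of_notMem (by exact hr)]
    rw [h1, integral_indicator measurableSet_Iio, integral_smul]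
  simp_rw [hL, hR] at hsw
  rw [integral_smul] at hsw
  have h2 : ∫ t, poissonHP y (x - t) • v t =
      y⁻¹ • y • ∫ t, poissonHP y (x - t) • v t := by
    rw [smul_smul, inv_mul_cancel₀ hy.ne', one_smul]
  rw [h2, hsw, ← integral_smul]
  congr 1
  funext r
  rw [smul_comm]

/-- Since the slope has mean zero, a constant may be subtracted and the average becomes one of
difference quotients of the primitive `Γ`. They converge to `r • e` and are dominated by `C |r|`;
the limit is `e` because `r * poissonHPSlope r` has integral one. -/
theorem tendsto_poissonHP_convolution_of_hasDerivAt {v : ℝ → E} (hv : Integrable v) {x : ℝ}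
    {e : E} (hx : HasDerivAt (fun u => ∫ t in (0:ℝ)..u, v t) e x) :
    Tendsto (fun y => ∫ t, poissonHP y (x - t) • v t) (𝓝[>] 0) (𝓝 e) := by
  set Γ : ℝ → E := fun u => ∫ t in (0:ℝ)..u, v t with hΓ
  have hΓc : Continuous Γ := intervalIntegral.continuous_primitive
    (fun a b => hv.intervalIntegrable) 0
  have hIio : ∀ u, ∫ t in Set.Iio u, v t = Γ u + ∫ t in Set.Iio 0, v t := by
    intro u
    have := intervalIntegral.integral_Iic_sub_Iic (f := v) (μ := volume) (a := 0) (b := u)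
      hv.integrableOn hv.integrableOn
    rw [hΓ, ← integral_Iic_eq_integral_Iio, ← integral_Iic_eq_integral_Iio]
    simp only
    rw [← this, sub_add_cancel]
  -- For small `s` the bound is differentiability at `x`; for `|s| ≥ δ` the increment is at most the
  -- total mass of `v`, hence at most `(mass / δ) |s|`.
  have hbd : ∃ C, ∀ s, ‖Γ (x + s) - Γ x‖ ≤ C * |s| := by
    obtain ⟨c, hc⟩ := hx.isBigO_sub.bound
    have hc' := (tendsto_const_nhds (x := x)).add (tendsto_id (x := 𝓝 (0:ℝ)))
    rw [add_zero] at hc'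
    obtain ⟨δ, hδ, hδc⟩ := Metric.eventually_nhds_iff.1 (hc'.eventually hc)
    set Iv := ∫ t, ‖v t‖ with hIv
    have hI0 : 0 ≤ Iv := integral_nonneg fun _ => norm_nonneg _
    have hb : ∀ s, ‖Γ (x + s) - Γ x‖ ≤ Iv := by
      intro s
      have : Γ (x + s) - Γ x = ∫ t in x..(x+s), v t :=
        intervalIntegral.integral_interval_sub_left hv.intervalIntegrable hv.intervalIntegrable
      rw [this]
      refine (intervalIntegral.norm_integral_le_integral_norm_uIoc).trans ?_
      exact setIntegral_le_integral hv.norm (ae_of_all _ fun _ => norm_nonneg _)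
    refine ⟨|c| + Iv / δ, fun s => ?_⟩
    rcases lt_or_ge |s| δ with h | h
    · have := hδc (y := s) (by rwa [Real.dist_eq, sub_zero])
      simp only [id, add_sub_cancel_left, Real.norm_eq_abs] at this
      refine this.trans ?_
      have h3 : c * |s| ≤ |c| * |s| := by gcongr; exact le_abs_self c
      have : 0 ≤ Iv / δ * |s| := by positivity
      nlinarith
    · refine (hb s).trans ?_
      have h3 : Iv = Iv / δ * δ := by field_simp
      have : Iv / δ * δ ≤ Iv / δ * |s| := by gcongr
      have : 0 ≤ |c| * |s| := by positivity
      nlinarith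
  obtain ⟨C, hC⟩ := hbd
  have key : ∀ y : ℝ, 0 < y → ∫ t, poissonHP y (x - t) • v t =
      ∫ r, poissonHPSlope r • y⁻¹ • (Γ (x + y * r) - Γ x) := by
    intro y hy
    rw [poissonHP_convolution_eq hv x hy]
    have hIio' : ∀ r, ∫ t in Set.Iio (x + y * r), v t = Γ (x + y * r) + ∫ t in Set.Iio 0, v t :=
      fun r => hIio _
    simp_rw [hIio']
    have hdec : (fun r => poissonHPSlope r • y⁻¹ • (Γ (x + y * r) - Γ x)) = fun r =>
        poissonHPSlope r • y⁻¹ • (Γ (x + y * r) + ∫ t in Set.Iio 0, v t) -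
          poissonHPSlope r • y⁻¹ • (Γ x + ∫ t in Set.Iio 0, v t) := by
      funext r; rw [← smul_sub, ← smul_sub]; congr 2; abel
    rw [hdec, integral_sub, integral_smul_const, integral_poissonHPSlope, zero_smul, sub_zero]
    · simp_rw [← hIio']
      set Iv := ∫ t, ‖v t‖ with hIv
      refine (integrable_poissonHPSlope.norm.mul_const (y⁻¹ * Iv)).mono' ?_ ?_
      · simp_rw [hIio']
        exact (continuous_poissonHPSlope.smul (by fun_prop)).aestronglyMeasurable
      · refine ae_of_all _ fun r => ?_
        rw [norm_smul, norm_smul, Real.norm_eq_abs y⁻¹, abs_of_pos (inv_pos.2 hy)]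
        gcongr
        exact (norm_integral_le_integral_norm _).trans
          (setIntegral_le_integral hv.norm (ae_of_all _ fun _ => norm_nonneg _))
    · exact integrable_poissonHPSlope.smul_const _
  have hlim : Tendsto (fun y : ℝ => ∫ r, poissonHPSlope r • y⁻¹ • (Γ (x + y * r) - Γ x))
      (𝓝[>] 0) (𝓝 (∫ r, (r * poissonHPSlope r) • e)) := by
    refine tendsto_integral_filter_of_dominated_convergence
      (fun r => C * (r * poissonHPSlope r)) ?_ ?_ (integrable_mul_poissonHPSlope.const_mul C) ?_
    · exact Eventually.of_forall fun y =>
        (continuous_poissonHPSlope.smul (by fun_prop)).aestronglyMeasurable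
    · filter_upwards [self_mem_nhdsWithin] with y hy
      have hy : 0 < y := hy
      refine ae_of_all _ fun r => ?_
      rw [norm_smul, norm_smul, Real.norm_eq_abs y⁻¹, abs_of_pos (inv_pos.2 hy)]
      calc _ ≤ ‖poissonHPSlope r‖ * (y⁻¹ * (C * |y * r|)) := by gcongr; exact hC _
        _ = C * |r * poissonHPSlope r| := by
          rw [abs_mul, abs_mul, abs_of_pos hy, Real.norm_eq_abs]; field_simp
        _ = _ := by rw [abs_of_nonneg (mul_poissonHPSlope_bounds r).1]
    · refine ae_of_all _ fun r => ?_
      have h1 : HasDerivAt (fun y : ℝ => Γ (x + y * r)) (r • e) 0 := by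
        have hx' : HasDerivAt Γ e (x + 0 * r) := by simpa using hx
        have := hx'.scomp (0:ℝ) (((hasDerivAt_id (0:ℝ)).mul_const r).const_add x)
        simpa [Function.comp_def] using this
      have h2 := (hasDerivAt_iff_tendsto_slope_zero.1 h1).mono_left
        (nhdsWithin_mono _ (fun y (hy : 0 < y) => hy.ne') : 𝓝[>] (0:ℝ) ≤ 𝓝[≠] 0)
      simp only [zero_add, zero_mul, add_zero] at h2
      have h3 := h2.const_smul (poissonHPSlope r)
      rwa [smul_smul, mul_comm] at h3
  rw [integral_smul_const, integral_mul_poissonHPSlope, one_smul] at hlim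
  refine hlim.congr' ?_
  filter_upwards [self_mem_nhdsWithin] with y hy
  rw [key y hy]

/-- Vertical limits of Poisson integrals of integrable functions. -/
theorem ae_tendsto_poissonHP_of_integrable {v : ℝ → E} (hv : Integrable v) :
    ∀ᵐ x, Tendsto (fun y => ∫ t, poissonHP y (x - t) • v t) (𝓝[>] 0) (𝓝 (v x)) := by
  filter_upwards [LocallyIntegrable.ae_hasDerivAt_integral hv.locallyIntegrable] with x hx
  exact tendsto_poissonHP_convolution_of_hasDerivAt hv (hx 0)

/-- Vertical limits of Poisson integrals. -/
theorem ae_tendsto_poissonHP {v : ℝ → E} (hv : Integrable fun t => (1 + t ^ 2)⁻¹ • v t) :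
    ∀ᵐ x, Tendsto (fun y => ∫ t, poissonHP y (x - t) • v t) (𝓝[>] 0) (𝓝 (v x)) := by
  have hvm : AEStronglyMeasurable v volume := by
    have h1 : v = fun t => (1 + t ^ 2) • (1 + t ^ 2)⁻¹ • v t := by
      funext t
      rw [smul_smul, mul_inv_cancel₀ (by positivity), one_smul]
    rw [h1]
    exact (Continuous.aestronglyMeasurable (by fun_prop)).smul hv.aestronglyMeasurable
  have hin : ∀ N : ℕ, Integrable ((Set.Icc (-N : ℝ) N).indicator v) := by
    intro N
    refine (hv.norm.const_mul (1 + (N:ℝ) ^ 2)).mono' (hvm.indicator measurableSet_Icc)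
      (ae_of_all _ fun t => ?_)
    have hp : (0:ℝ) < 1 + t ^ 2 := by positivity
    by_cases ht : t ∈ Set.Icc (-N : ℝ) N
    · rw [Set.indicator_of_mem ht, norm_smul, norm_inv, Real.norm_of_nonneg hp.le, ← mul_assoc]
      refine le_mul_of_one_le_left (norm_nonneg _) ?_
      rw [← div_eq_mul_inv, one_le_div hp]
      have := sq_le_sq' ht.1 ht.2
      linarith
    · rw [Set.indicator_of_notMem ht, norm_zero]; positivity
  filter_upwards [ae_all_iff.2 fun N : ℕ => ae_tendsto_poissonHP_of_integrable (hin N)] with x hx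
  obtain ⟨N, hN⟩ := exists_nat_ge (|x| + 1)
  have h1 := hx N
  have hxN : x ∈ Set.Icc (-N : ℝ) N := abs_le.1 (by linarith)
  rw [Set.indicator_of_mem hxN] at h1
  set B := ∫ t, ‖(1 + t ^ 2)⁻¹ • v t‖ with hB
  -- Outside the window `|x - t| ≥ 1`, so `1 + t² ≤ 1 + 2 (x - t)² + 2 x² ≤ (3 + 2 x²) (x - t)²`.
  -- This produces the constant and shows that the far part is of order `y`.
  have hker : ∀ y : ℝ, 0 < y → ∀ t, t ∉ Set.Icc (-N : ℝ) N →
      ‖poissonHP y (x - t) • v t‖ ≤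
        y * Real.pi⁻¹ * (3 + 2 * x ^ 2) * ‖(1 + t ^ 2)⁻¹ • v t‖ := by
    intro y hy t ht
    rw [norm_smul, norm_smul, Real.norm_of_nonneg (poissonHP_pos hy _).le, norm_inv,
      Real.norm_of_nonneg (show (0:ℝ) ≤ 1 + t ^ 2 by positivity), ← mul_assoc]
    gcongr
    unfold poissonHP
    have hπ := Real.pi_pos
    have hd : 1 ≤ |x - t| := by
      have : (N:ℝ) < |t| := by
        by_contra h
        exact ht (abs_le.1 (not_lt.1 h))
      have := abs_sub_abs_le_abs_sub t x
      rw [abs_sub_comm]; linarith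
    have hd2 : 1 ≤ (x - t) ^ 2 := by rw [← sq_abs]; nlinarith
    rw [div_le_iff₀ (by positivity)]
    have h4 : y * Real.pi⁻¹ * (3 + 2 * x ^ 2) * (1 + t ^ 2)⁻¹ * (Real.pi * ((x - t) ^ 2 + y ^ 2))
        = y * ((3 + 2 * x ^ 2) * ((x - t) ^ 2 + y ^ 2) / (1 + t ^ 2)) := by field_simp
    rw [h4]
    refine le_mul_of_one_le_right hy.le ?_
    rw [one_le_div (by positivity)]
    nlinarith [sq_nonneg (t - 2 * x), mul_nonneg (sq_nonneg x) (sub_nonneg.2 hd2), sq_nonneg y,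
      mul_nonneg (sq_nonneg x) (sq_nonneg y)]
  have hout : Tendsto (fun y => ∫ t, poissonHP y (x - t) • (Set.Icc (-N : ℝ) N)ᶜ.indicator v t)
      (𝓝[>] 0) (𝓝 0) := by
    refine squeeze_zero_norm' (a := fun y : ℝ => y * Real.pi⁻¹ * (3 + 2 * x ^ 2) * B) ?_ ?_
    · filter_upwards [self_mem_nhdsWithin] with y hy
      have hy : 0 < y := hy
      rw [hB, ← integral_const_mul]
      refine norm_integral_le_of_norm_le (hv.norm.const_mul _) (ae_of_all _ fun t => ?_)
      by_cases ht : t ∈ Set.Icc (-N : ℝ) N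
      · rw [Set.indicator_of_notMem (by simpa using ht), smul_zero, norm_zero]
        have := Real.pi_pos
        positivity
      · rw [Set.indicator_of_mem ht]
        exact hker y hy t ht
    · refine tendsto_nhdsWithin_of_tendsto_nhds ?_
      have : Continuous fun y : ℝ => y * Real.pi⁻¹ * (3 + 2 * x ^ 2) * B := by fun_prop
      simpa using this.tendsto 0
  have hsum := h1.add hout
  rw [add_zero] at hsum
  refine hsum.congr' ?_
  filter_upwards [self_mem_nhdsWithin] with y hy
  have hy : 0 < y := hy
  have hbm : ∀ S : Set ℝ, MeasurableSet S → AEStronglyMeasurable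
      (fun t => poissonHP y (x - t) • S.indicator v t) volume := fun S hS =>
    ((continuous_poissonHP hy).comp (by fun_prop)).aestronglyMeasurable.smul (hvm.indicator hS)
  rw [← integral_add]
  · congr 1
    funext t
    rw [← smul_add]
    congr 1
    exact congrFun (Set.indicator_self_add_compl _ v) t
  · refine ((hin N).norm.const_mul (1 / (Real.pi * y))).mono' (hbm _ measurableSet_Icc)
      (ae_of_all _ fun t => ?_)
    rw [norm_smul, Real.norm_of_nonneg (poissonHP_pos hy _).le]
    gcongr
    exact poissonHP_le hy _
  · refine (hv.norm.const_mul (y * Real.pi⁻¹ * (3 + 2 * x ^ 2))).mono'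
      (hbm _ measurableSet_Icc.compl) (ae_of_all _ fun t => ?_)
    by_cases ht : t ∈ Set.Icc (-N : ℝ) N
    · rw [Set.indicator_of_notMem (by simpa using ht), smul_zero, norm_zero]
      have := Real.pi_pos
      positivity
    · rw [Set.indicator_of_mem ht]
      exact hker y hy t ht

end

/-! ## Bounded holomorphic functions on the upper half-plane -/

theorem isOpen_im_pos : IsOpen {z : ℂ | 0 < z.im} := isOpen_lt continuous_const Complex.continuous_im

theorem norm_dslope_le {F : ℂ → ℂ} {M : ℝ} {a b : ℂ} (ha : ‖F a‖ ≤ M) (hb : ‖F b‖ ≤ M)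
    {r : ℝ} (hr : 0 < r) (hab : r ≤ ‖b - a‖) : ‖dslope F a b‖ ≤ 2 * M / r := by
  have hne : b ≠ a := by
    rintro rfl
    simp at hab
    linarith
  rw [dslope_of_ne _ hne, slope_def_field, norm_div]
  have : ‖F b - F a‖ ≤ 2 * M := (norm_sub_le _ _).trans (by linarith)
  gcongr
  exact (norm_nonneg _).trans this

/-- The Poisson formula for a function that is holomorphic in the upper half-plane and bounded above
the height `ε`. -/
theorem integral_poissonHP_eq {F : ℂ → ℂ} (hF : DifferentiableOn ℂ F {z | 0 < z.im}) {ε M : ℝ}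
    (hε : 0 < ε) (hM : ∀ z : ℂ, ε ≤ z.im → ‖F z‖ ≤ M) {z : ℂ} (hz : 0 < z.im) :
    ∫ x : ℝ, poissonHP z.im (z.re - x) • F (x + ε * Complex.I) = F (z + ε * Complex.I) := by
  set z₀ : ℂ := z + ε * Complex.I with hz₀
  set w : ℂ := (starRingEnd ℂ) z + ε * Complex.I with hw
  have hz₀im : z₀.im = z.im + ε := by simp [hz₀]
  have hz₀re : z₀.re = z.re := by simp [hz₀]
  have hwim : w.im = -z.im + ε := by simp [hw]
  have hwre : w.re = z.re := by simp [hw]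
  -- The point `w` is the reflection of `z₀` in the line `Im ζ = ε`. On that line `(ζ - z₀) (ζ - w)`
  -- is real, so `q` is a multiple of the Poisson kernel times `F - F z₀`. The divided difference
  -- removes the pole at `z₀`, and `q` decays quadratically.
  set q : ℂ → ℂ := fun ζ => dslope F z₀ ζ / (ζ - w) with hq
  have hM0 : 0 ≤ M := (norm_nonneg _).trans (hM z₀ (by rw [hz₀im]; linarith))
  have hds : DifferentiableOn ℂ (dslope F z₀) {z | 0 < z.im} := by
    refine (Complex.differentiableOn_dslope (isOpen_im_pos.mem_nhds ?_)).2 hF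
    show 0 < z₀.im
    rw [hz₀im]; linarith
  have hqd : DifferentiableOn ℂ q {ζ | ε ≤ ζ.im} := by
    refine (hds.mono fun ζ (hζ : ε ≤ ζ.im) => show 0 < ζ.im by linarith).div
      (differentiableOn_id.sub_const w) fun ζ hζ h => ?_
    have hζ : ε ≤ ζ.im := hζ
    have : ζ.im = w.im := by rw [← sub_eq_zero, ← Complex.sub_im]; simpa using congrArg Complex.im h
    linarith
  have hqb : ∀ r : ℝ, 0 < r → ∀ ζ : ℂ, ε ≤ ζ.im → r ≤ ‖ζ - z₀‖ → r ≤ ‖ζ - w‖ →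
      ‖q ζ‖ ≤ 2 * M / r / r := by
    intro r hr ζ hζ h1 h2
    rw [hq, norm_div]
    have := norm_dslope_le (hM z₀ (by rw [hz₀im]; linarith)) (hM ζ hζ) hr h1
    gcongr
  have hqx : ∀ x : ℝ, q (x + ε * Complex.I) =
      (Real.pi / z.im) • poissonHP z.im (z.re - x) • (F (x + ε * Complex.I) - F z₀) := by
    intro x
    have hne : (x + ε * Complex.I : ℂ) ≠ z₀ := by
      intro h
      have := congrArg Complex.im h
      rw [hz₀im] at this
      simp at this
      linarith
    have h1 : ((x + ε * Complex.I : ℂ) - z₀) * ((x + ε * Complex.I) - w) =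
        (((z.re - x) ^ 2 + z.im ^ 2 : ℝ) : ℂ) := by
      apply Complex.ext
      · rw [Complex.ofReal_re]; simp [hz₀, hw]; ring
      · rw [Complex.ofReal_im]; simp [hz₀, hw]; ring
    have h2 : (0:ℝ) < (z.re - x) ^ 2 + z.im ^ 2 := by positivity
    rw [hq]
    simp only
    rw [dslope_of_ne _ hne, slope_def_field, div_div, h1, smul_smul, Complex.real_smul,
      div_eq_inv_mul]
    congr 1
    rw [← Complex.ofReal_inv]
    congr 1
    unfold poissonHP
    have := Real.pi_pos
    field_simp
  have hFc : Continuous fun x : ℝ => F (x + ε * Complex.I) := by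
    refine hF.continuousOn.comp_continuous (by fun_prop) fun x => ?_
    simpa using hε
  have hPm : AEStronglyMeasurable (fun x : ℝ => poissonHP z.im (z.re - x)) volume :=
    (integrable_poissonHP_sub hz z.re).aestronglyMeasurable
  have hint1 : Integrable fun x : ℝ => poissonHP z.im (z.re - x) • F (x + ε * Complex.I) := by
    refine ((integrable_poissonHP_sub hz z.re).mul_const M).mono'
      (hPm.smul hFc.aestronglyMeasurable) (ae_of_all _ fun x => ?_)
    rw [norm_smul, Real.norm_of_nonneg (poissonHP_pos hz _).le]
    have := (poissonHP_pos hz (z.re - x)).le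
    gcongr
    exact hM _ (by simp)
  have hint2 : Integrable fun x : ℝ => poissonHP z.im (z.re - x) • F z₀ :=
    (integrable_poissonHP_sub hz z.re).smul_const _
  have hqint : Integrable fun x : ℝ => q (x + ε * Complex.I) := by
    simp_rw [hqx, smul_sub]
    exact (hint1.smul (Real.pi / z.im)).sub (hint2.smul (Real.pi / z.im))
  have hlim := intervalIntegral_tendsto_integral hqint tendsto_neg_atTop_atBot tendsto_id
  have hlim0 : Tendsto (fun R : ℝ => ∫ x in (-R)..R, q (x + ε * Complex.I)) atTop (𝓝 0) := by
    -- Cauchy's theorem on the rectangle `[-R, R] × [ε, ε + R]`. On the other three sides both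
    -- denominators are at least `R / 2`, so `‖q‖ ≤ 8 M / R²`; the top contributes `16 M / R` and
    -- each vertical side `8 M / R`.
    refine squeeze_zero_norm' (a := fun R : ℝ => 32 * M / R) ?_ ?_
    · filter_upwards [eventually_ge_atTop (2 * (|z.re| + z.im + 1))] with R hR
      have hre0 := abs_nonneg z.re
      have hRp : 0 < R := by linarith
      have hr : 0 < R / 2 := by linarith
      have h := Complex.integral_boundary_rect_eq_zero_of_differentiableOn q
        (-R + ε * Complex.I) (R + (ε + R : ℝ) * Complex.I) (hqd.mono ?_)
      · simp only [Complex.add_re, Complex.neg_re, Complex.ofReal_re, Complex.mul_re, Complex.I_re,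
          mul_zero, Complex.ofReal_im, Complex.I_im, mul_one, sub_self, add_zero, Complex.add_im,
          Complex.neg_im, Complex.mul_im, zero_add, neg_zero] at h
        have hT : ‖∫ x in (-R)..R, q (x + (ε + R : ℝ) * Complex.I)‖ ≤
            2 * M / (R / 2) / (R / 2) * |R - -R| := by
          refine intervalIntegral.norm_integral_le_of_norm_le_const fun x _ => ?_
          refine hqb _ hr _ (by simp; linarith) ?_ ?_
          · refine le_trans ?_ (Complex.abs_im_le_norm _)
            refine le_trans ?_ (le_abs_self _)
            rw [Complex.sub_im, hz₀im]; simp; linarith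
          · refine le_trans ?_ (Complex.abs_im_le_norm _)
            refine le_trans ?_ (le_abs_self _)
            rw [Complex.sub_im, hwim]; simp; linarith
        have hside : ∀ σ : ℝ, |σ| = R → ‖∫ y in ε..(ε + R), q (σ + y * Complex.I)‖ ≤
            2 * M / (R / 2) / (R / 2) * |ε + R - ε| := by
          intro σ hσ
          refine intervalIntegral.norm_integral_le_of_norm_le_const fun y hy => ?_
          have h3 : R / 2 ≤ |σ - z.re| := by
            have := abs_sub_abs_le_abs_sub σ z.re
            linarith
          refine hqb _ hr _ ?_ ?_ ?_
          · rw [Set.uIoc_of_le (by linarith)] at hy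
            simpa using hy.1.le
          · refine le_trans ?_ (Complex.abs_re_le_norm _)
            rw [Complex.sub_re, hz₀re]; simpa using h3
          · refine le_trans ?_ (Complex.abs_re_le_norm _)
            rw [Complex.sub_re, hwre]; simpa using h3
        have hs1 := hside R (abs_of_pos hRp)
        have hs2 := hside (-R) (by rw [abs_neg, abs_of_pos hRp])
        have e : ∫ x in (-R)..R, q (x + ε * Complex.I) =
            (∫ x in (-R)..R, q (x + (ε + R : ℝ) * Complex.I)) -
            Complex.I • (∫ y in ε..(ε + R), q (R + y * Complex.I)) +
            Complex.I • (∫ y in ε..(ε + R), q ((-R : ℝ) + y * Complex.I)) := by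
          push_cast at h ⊢
          linear_combination h
        rw [e]
        have n1 : ∀ u : ℂ, ‖Complex.I • u‖ = ‖u‖ := fun u => by simp
        refine (norm_add_le _ _).trans ?_
        refine (add_le_add_left (norm_sub_le _ _) _).trans ?_
        rw [n1, n1]
        have e1 : |R - -R| = 2 * R := by rw [sub_neg_eq_add, ← two_mul, abs_of_pos (by linarith)]
        have e2 : |ε + R - ε| = R := by rw [add_sub_cancel_left, abs_of_pos hRp]
        rw [e1] at hT
        rw [e2] at hs1 hs2
        have e3 : 2 * M / (R / 2) / (R / 2) * (2 * R) = 16 * M / R := by field_simp; ring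
        have e4 : 2 * M / (R / 2) / (R / 2) * R = 8 * M / R := by field_simp; ring
        rw [e3] at hT
        rw [e4] at hs1 hs2
        have e5 : 32 * M / R = 16 * M / R + 8 * M / R + 8 * M / R := by ring
        linarith
      · intro ζ hζ
        have := hζ.2
        simp only [Complex.add_im, Complex.neg_im, Complex.ofReal_im, Complex.mul_im,
          Complex.ofReal_re, Complex.I_im, mul_one, Complex.I_re, mul_zero, add_zero, neg_zero,
          zero_add, Set.mem_preimage] at this
        rw [Set.uIcc_of_le (by linarith)] at this
        exact this.1
    · exact tendsto_const_nhds.div_atTop tendsto_id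
  have h0 := tendsto_nhds_unique hlim hlim0
  simp_rw [hqx] at h0
  rw [integral_smul, smul_eq_zero] at h0
  have h1 := h0.resolve_left (div_pos Real.pi_pos hz).ne'
  simp_rw [smul_sub] at h1
  rw [integral_sub hint1 hint2, integral_smul_const, integral_poissonHP_sub hz, one_smul,
    sub_eq_zero] at h1
  exact h1

/-! ### Square integrable boundary values and Fatou's theorem -/

theorem sq_add_sq_le_normSq_add_I {x ε : ℝ} (hε : 0 < ε) :
    1 + x ^ 2 ≤ ‖(x + ε * Complex.I + Complex.I : ℂ)‖ ^ 2 := by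
  rw [← Complex.normSq_eq_norm_sq, Complex.normSq_apply]
  simp
  nlinarith

theorem memLp_two_of_sq_le {f : ℝ → ℂ} (hf : AEStronglyMeasurable f volume) {M : ℝ}
    (hM : ∀ x, ‖f x‖ ^ 2 ≤ M * (1 + x ^ 2)⁻¹) : MemLp f 2 volume := by
  rw [memLp_two_iff_integrable_sq_norm hf]
  refine (integrable_inv_one_add_sq.const_mul M).mono' (hf.norm.pow 2) (ae_of_all _ fun x => ?_)
  rw [Real.norm_of_nonneg (by positivity)]
  exact hM x

theorem norm_toLp_two_sq {μ : Measure ℝ} {f : ℝ → ℂ} (hf : MemLp f 2 μ) :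
    ‖hf.toLp f‖ ^ 2 = ∫ x, ‖f x‖ ^ 2 ∂μ := by
  have h := inner_self_eq_norm_sq (𝕜 := ℂ) (hf.toLp f)
  rw [← h, L2.inner_def]
  have h2 : ∫ a, inner ℂ (hf.toLp f a) (hf.toLp f a) ∂μ = ∫ x, ((‖f x‖ ^ 2 : ℝ) : ℂ) ∂μ := by
    refine integral_congr_ae ?_
    filter_upwards [hf.coeFn_toLp] with x hx
    rw [hx, inner_self_eq_norm_sq_to_K]
    norm_cast
  rw [h2, integral_complex_ofReal]
  simp

theorem inner_toLp {μ : Measure ℝ} {f g : ℝ → ℂ} (hf : MemLp f 2 μ) (hg : MemLp g 2 μ) :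
    inner ℂ (hf.toLp f) (hg.toLp g) = ∫ x, (starRingEnd ℂ) (f x) * g x ∂μ := by
  rw [L2.inner_def]
  refine integral_congr_ae ?_
  filter_upwards [hf.coeFn_toLp, hg.coeFn_toLp] with x hx hy
  rw [hx, hy, RCLike.inner_apply']

/-- A function that is holomorphic in the upper half-plane and uniformly square integrable on
horizontal lines is the Poisson integral of a square integrable function. -/
theorem exists_L2_boundary {D : ℂ → ℂ} (hD : DifferentiableOn ℂ D {z | 0 < z.im}) {M : ℝ}
    (hM : ∀ (x ε : ℝ), 0 < ε → ‖D (x + ε * Complex.I)‖ ^ 2 ≤ M * (1 + x ^ 2)⁻¹) :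
    ∃ c : ℝ → ℂ, MemLp c 2 volume ∧ ∀ x y : ℝ, 0 < y →
      ∫ t, poissonHP y (x - t) • c t = D (x + y * Complex.I) := by
  have hM0 : 0 ≤ M := by
    have := (sq_nonneg _).trans (hM 0 1 one_pos)
    simpa using this
  have hbd : ∀ z : ℂ, 0 < z.im → ‖D z‖ ≤ M + 1 := by
    intro z hz
    have h := hM z.re z.im hz
    rw [Complex.re_add_im] at h
    have h2 : M * (1 + z.re ^ 2)⁻¹ ≤ M :=
      mul_le_of_le_one_right hM0 (inv_le_one_of_one_le₀ (by nlinarith [sq_nonneg z.re]))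
    nlinarith [norm_nonneg (D z), sq_nonneg (‖D z‖ - 1)]
  have hcont : ∀ ε : ℝ, 0 < ε → Continuous fun x : ℝ => D (x + ε * Complex.I) := fun ε hε =>
    hD.continuousOn.comp_continuous (by fun_prop) fun x => by simpa using hε
  have hmem : ∀ ε : ℝ, 0 < ε → MemLp (fun x : ℝ => D (x + ε * Complex.I)) 2 volume :=
    fun ε hε => memLp_two_of_sq_le (hcont ε hε).aestronglyMeasurable fun x => hM x ε hε
  classical
  -- The restrictions of `D` to horizontal lines, regarded as functionals, stay in a fixed ball of
  -- the dual of `L²`. By Banach–Alaoglu they converge weakly along an ultrafilter finer than `ε →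
  -- 0⁺`, and the limit is the boundary function.
  set Λ : ℝ → WeakDual ℂ (Lp ℂ 2 (volume : Measure ℝ)) := fun ε =>
    if hε : 0 < ε then StrongDual.toWeakDual
      (InnerProductSpace.toDual ℂ _ ((hmem ε hε).toLp _)) else 0 with hΛ
  have hball : ∀ ε, 0 < ε → Λ ε ∈ WeakDual.toStrongDual ⁻¹' Metric.closedBall
      (0 : StrongDual ℂ (Lp ℂ 2 (volume : Measure ℝ))) (√(M * Real.pi)) := by
    intro ε hε
    simp only [hΛ, dif_pos hε, Set.mem_preimage, mem_closedBall_zero_iff]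
    have : ‖(hmem ε hε).toLp _‖ ≤ √(M * Real.pi) := by
      apply Real.le_sqrt_of_sq_le
      rw [norm_toLp_two_sq, ← integral_univ_inv_one_add_sq, ← integral_const_mul]
      exact integral_mono_of_nonneg (ae_of_all _ fun x => by positivity)
        (integrable_inv_one_add_sq.const_mul M) (ae_of_all _ fun x => hM x ε hε)
    refine le_trans (le_of_eq ?_) this
    exact (InnerProductSpace.toDual ℂ _).norm_map _
  set U : Ultrafilter ℝ := Ultrafilter.of (𝓝[>] 0) with hU
  have hUle : (U : Filter ℝ) ≤ 𝓝[>] 0 := Ultrafilter.of_le _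
  obtain ⟨ℓ, -, hℓ⟩ := (WeakDual.isCompact_closedBall
      (0 : StrongDual ℂ (Lp ℂ 2 (volume : Measure ℝ))) (√(M * Real.pi))).ultrafilter_le_nhds
      (U.map Λ) (by
        rw [le_principal_iff]
        exact hUle (by filter_upwards [self_mem_nhdsWithin] with ε hε using hball ε hε))
  set cL : Lp ℂ 2 (volume : Measure ℝ) :=
    (InnerProductSpace.toDual ℂ _).symm (WeakDual.toStrongDual ℓ) with hcL
  refine ⟨cL, Lp.memLp cL, fun x y hy => ?_⟩
  have hp : MemLp (fun t : ℝ => ((poissonHP y (x - t) : ℝ) : ℂ)) 2 volume := by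
    have hc : Continuous fun t : ℝ => ((poissonHP y (x - t) : ℝ) : ℂ) :=
      Complex.continuous_ofReal.comp ((continuous_poissonHP hy).comp (by fun_prop))
    rw [memLp_two_iff_integrable_sq_norm hc.aestronglyMeasurable]
    refine ((integrable_poissonHP_sub hy x).const_mul (1 / (Real.pi * y))).mono'
      (hc.norm.pow 2).aestronglyMeasurable (ae_of_all _ fun t => ?_)
    have h0 := (poissonHP_pos hy (x - t)).le
    rw [Complex.norm_real, Real.norm_of_nonneg (by positivity), Real.norm_of_nonneg h0, sq]
    gcongr
    exact poissonHP_le hy _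
  have hlim1 : Tendsto (fun ε => Λ ε (hp.toLp _)) U (𝓝 (ℓ (hp.toLp _))) :=
    ((WeakDual.eval_continuous _).tendsto ℓ).comp hℓ
  -- Tested on a Poisson kernel, the functional is evaluated by the Poisson formula at height `ε`.
  -- The conjugate arises because the inner product is conjugate linear in its first argument.
  have hval : ∀ ε, 0 < ε → Λ ε (hp.toLp _) =
      (starRingEnd ℂ) (D (x + y * Complex.I + ε * Complex.I)) := by
    intro ε hε
    have h1 : Λ ε (hp.toLp _) = inner ℂ ((hmem ε hε).toLp _) (hp.toLp _) := by
      simp only [hΛ, dif_pos hε]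
      exact InnerProductSpace.toDual_apply_apply
    have hz : 0 < ((x + y * Complex.I : ℂ)).im := by simpa using hy
    rw [h1, inner_toLp, ← integral_poissonHP_eq hD hε
      (fun z hz => hbd z (hε.trans_le hz)) hz, ← integral_conj]
    congr 1
    funext t
    simp [Complex.real_smul, mul_comm]
  have hlim2 : Tendsto (fun ε => Λ ε (hp.toLp _)) U
      (𝓝 ((starRingEnd ℂ) (D (x + y * Complex.I)))) := by
    refine Tendsto.mono_left ?_ hUle
    have hz : {z : ℂ | 0 < z.im} ∈ 𝓝 (x + y * Complex.I : ℂ) :=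
      isOpen_im_pos.mem_nhds (by simpa using hy)
    have h1 : Tendsto (fun ε : ℝ => (x + y * Complex.I + ε * Complex.I : ℂ)) (𝓝[>] 0)
        (𝓝 (x + y * Complex.I)) := by
      refine tendsto_nhdsWithin_of_tendsto_nhds ?_
      have : Continuous fun ε : ℝ => (x + y * Complex.I + ε * Complex.I : ℂ) := by fun_prop
      simpa using this.tendsto 0
    have h2 := (Complex.continuous_conj.tendsto _).comp
      ((hD.differentiableAt hz).continuousAt.tendsto.comp h1)
    refine h2.congr' ?_
    filter_upwards [self_mem_nhdsWithin] with ε hε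
    exact (hval ε hε).symm
  have heq := tendsto_nhds_unique hlim1 hlim2
  have h3 : ℓ (hp.toLp _) = inner ℂ cL (hp.toLp _) := by
    rw [hcL, InnerProductSpace.toDual_symm_apply]; rfl
  rw [h3, L2.inner_def] at heq
  have h4 := congrArg (starRingEnd ℂ) heq
  rw [Complex.conj_conj, ← integral_conj] at h4
  rw [← h4]
  refine integral_congr_ae ?_
  filter_upwards [hp.coeFn_toLp] with t ht
  rw [ht, RCLike.inner_apply']
  simp [Complex.real_smul, mul_comm]

theorem integrable_inv_one_add_sq_smul {c : ℝ → ℂ} (hc : MemLp c 2 volume) :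
    Integrable fun t : ℝ => (1 + t ^ 2)⁻¹ • c t := by
  have h1 : MemLp (fun t : ℝ => (1 + t ^ 2)⁻¹) 2 volume := by
    have hcont : Continuous fun t : ℝ => (1 + t ^ 2)⁻¹ :=
      Continuous.inv₀ (by fun_prop) fun t => by positivity
    rw [memLp_two_iff_integrable_sq hcont.aestronglyMeasurable]
    refine integrable_inv_one_add_sq.mono' (hcont.pow 2).aestronglyMeasurable
      (ae_of_all _ fun t => ?_)
    rw [Real.norm_of_nonneg (by positivity), sq]
    exact mul_le_of_le_one_right (by positivity)
      (inv_le_one_of_one_le₀ (by nlinarith [sq_nonneg t]))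
  exact memLp_one_iff_integrable.1 (hc.smul h1)

/-- Fatou's theorem for bounded holomorphic functions on the upper half-plane. -/
theorem ae_exists_boundary_limit {b : ℂ → ℂ} (hb : DifferentiableOn ℂ b {z | 0 < z.im}) {M : ℝ}
    (hM : ∀ z : ℂ, 0 < z.im → ‖b z‖ ≤ M) :
    ∀ᵐ x : ℝ, ∃ l : ℂ, Tendsto (fun y : ℝ => b (x + y * Complex.I)) (𝓝[>] 0) (𝓝 l) := by
  have hne : ∀ z : ℂ, 0 < z.im → z + Complex.I ≠ 0 := by
    intro z hz h
    have := congrArg Complex.im h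
    simp at this
    linarith
  -- Division by `z + i`, whose zero lies in the lower half-plane, makes the bounded function
  -- uniformly square integrable on horizontal lines.
  obtain ⟨c, hc, hcD⟩ := exists_L2_boundary (D := fun z => b z / (z + Complex.I)) (M := M ^ 2)
    (hb.div (by fun_prop) hne) (by
      intro x ε hε
      have h1 : 0 < ((x + ε * Complex.I : ℂ)).im := by simpa using hε
      rw [norm_div, div_pow, div_eq_mul_inv]
      have h2 := hM _ h1
      have h3 := sq_add_sq_le_normSq_add_I (x := x) hε
      gcongr)
  filter_upwards [ae_tendsto_poissonHP (integrable_inv_one_add_sq_smul hc)] with x hx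
  refine ⟨c x * (x + Complex.I), ?_⟩
  have h1 : Tendsto (fun y : ℝ => (x + y * Complex.I + Complex.I : ℂ)) (𝓝[>] 0)
      (𝓝 (x + Complex.I)) := by
    refine tendsto_nhdsWithin_of_tendsto_nhds ?_
    have : Continuous fun y : ℝ => (x + y * Complex.I + Complex.I : ℂ) := by fun_prop
    simpa using this.tendsto 0
  refine (hx.mul h1).congr' ?_
  filter_upwards [self_mem_nhdsWithin] with y hy
  have hy : 0 < y := hy
  rw [hcD x y hy, div_mul_cancel₀ _ (hne _ (by simpa using hy))]

/-- A continuous angle whose exponential converges is itself convergent. -/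
theorem exists_tendsto_of_tendsto_exp {θ : ℝ → ℝ} (hθ : ContinuousOn θ (Set.Ioi 0)) {u : ℂ}
    (hu : Tendsto (fun y => Complex.exp (θ y * Complex.I)) (𝓝[>] 0) (𝓝 u)) :
    ∃ l, Tendsto θ (𝓝[>] 0) (𝓝 l) := by
  have hnu : ‖u‖ = 1 := by
    have h1 := hu.norm
    simp only [Complex.norm_exp_ofReal_mul_I] at h1
    exact (tendsto_nhds_unique h1 tendsto_const_nhds)
  have hu0 : u ≠ 0 := by rintro rfl; simp at hnu
  set e : ℝ → ℂ := fun y => Complex.exp (θ y * Complex.I) / u with he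
  have hnorm : ∀ y, ‖e y‖ = 1 := fun y => by
    rw [he, norm_div, Complex.norm_exp_ofReal_mul_I, hnu, div_one]
  have hlim : Tendsto e (𝓝[>] 0) (𝓝 1) := by
    have := hu.div_const u
    rwa [div_self hu0] at this
  have hcont : ContinuousOn e (Set.Ioi 0) := by
    refine ContinuousOn.div_const (Complex.continuous_exp.comp_continuousOn ?_) u
    exact (Complex.continuous_ofReal.comp_continuousOn hθ).mul continuousOn_const
  have hsl : ∀ᶠ y in 𝓝[>] (0:ℝ), e y ∈ Complex.slitPlane :=
    hlim (Complex.isOpen_slitPlane.mem_nhds (by simp))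
  obtain ⟨δ, hδ, hδs⟩ := mem_nhdsGT_iff_exists_Ioo_subset.1 hsl
  have hδ : 0 < δ := hδ
  -- `N` counts full turns. It is continuous near zero because there `e` avoids the cut of the
  -- argument, and integer valued, hence constant; so `θ` converges together with the principal
  -- argument of `e`.
  set N : ℝ → ℝ := fun y => (θ y - u.arg - (e y).arg) / (2 * Real.pi) with hN
  have hNc : ContinuousOn N (Set.Ioo 0 δ) := by
    have hsub : Set.Ioo 0 δ ⊆ Set.Ioi 0 := fun y hy => hy.1
    refine ContinuousOn.div_const (((hθ.mono hsub).sub continuousOn_const).sub ?_) _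
    intro y hy
    exact (Complex.continuousAt_arg (hδs hy)).comp_continuousWithinAt ((hcont.mono hsub) y hy)
  have hNm : Set.MapsTo N (Set.Ioo 0 δ) (Set.range ((↑) : ℤ → ℝ)) := by
    intro y hy
    have h1 : Complex.exp ((θ y - u.arg - (e y).arg : ℝ) * Complex.I) = 1 := by
      have e1 := Complex.norm_mul_exp_arg_mul_I u
      have e2 := Complex.norm_mul_exp_arg_mul_I (e y)
      rw [hnu] at e1
      rw [hnorm] at e2
      simp only [Complex.ofReal_one, one_mul] at e1 e2
      push_cast
      rw [sub_mul, sub_mul, Complex.exp_sub, Complex.exp_sub, e1, e2]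
      exact div_self (by rw [← norm_ne_zero_iff, hnorm]; exact one_ne_zero)
    obtain ⟨n, hn⟩ := Complex.exp_eq_one_iff.1 h1
    refine ⟨n, ?_⟩
    have h2 : (((θ y - u.arg - (e y).arg : ℝ)) : ℂ) = ((n * (2 * Real.pi) : ℝ) : ℂ) := by
      apply mul_right_cancel₀ Complex.I_ne_zero
      rw [hn]; push_cast; ring
    have h3 := Complex.ofReal_injective h2
    rw [hN]
    simp only
    rw [h3]
    have := Real.pi_pos
    field_simp
  have hdisc : IsDiscrete (Set.range ((↑) : ℤ → ℝ)) := ⟨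
    Int.isClosedEmbedding_coe_real.isEmbedding.toHomeomorph.symm.isEmbedding.discreteTopology⟩
  have hconst : ∀ y ∈ Set.Ioo 0 δ, N y = N (δ / 2) := fun y hy =>
    isPreconnected_Ioo.constant_of_mapsTo hdisc hNc hNm hy
      ⟨half_pos hδ, half_lt_self hδ⟩
  refine ⟨0 + u.arg + N (δ / 2) * (2 * Real.pi), ?_⟩
  have harg : Tendsto (fun y => (e y).arg) (𝓝[>] 0) (𝓝 0) := by
    have := (Complex.continuousAt_arg (x := 1) (by simp)).tendsto.comp hlim
    simpa [Function.comp_def] using this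
  refine ((harg.add_const _).add_const _).congr' ?_
  filter_upwards [Ioo_mem_nhdsGT hδ] with y hy
  rw [← hconst y hy, hN]
  have := Real.pi_pos
  field_simp
  ring

/-! ## Cauchy transforms -/

/-- The Cauchy transform `∫ f(t) / (z - t) dμ(t)`. -/
noncomputable def cauchyTransform (μ : Measure ℝ) (f : ℝ → ℂ) (z : ℂ) : ℂ := ∫ t : ℝ, f t / (z - t) ∂μ

section
variable {μ : Measure ℝ} {f : ℝ → ℂ}

theorem abs_im_le_norm_sub_ofReal (z : ℂ) (t : ℝ) : |z.im| ≤ ‖z - t‖ := by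
  simpa using Complex.abs_im_le_norm (z - t)

theorem sub_ofReal_ne_zero {z : ℂ} (hz : z.im ≠ 0) (t : ℝ) : z - t ≠ 0 :=
  norm_pos_iff.1 ((abs_pos.2 hz).trans_le (abs_im_le_norm_sub_ofReal z t))

theorem aestronglyMeasurable_div_sub (hf : AEStronglyMeasurable f μ) (z : ℂ) :
    AEStronglyMeasurable (fun t : ℝ => f t / (z - t)) μ := by
  simp_rw [div_eq_mul_inv]
  exact hf.mul (Measurable.aestronglyMeasurable (by fun_prop))

theorem integrable_div_sub_of_le (hf : Integrable f μ) {z : ℂ} {δ : ℝ} (hδ : 0 < δ)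
    (hz : ∀ᵐ t : ℝ ∂μ, δ ≤ ‖z - t‖) : Integrable (fun t : ℝ => f t / (z - t)) μ := by
  refine (hf.norm.div_const δ).mono' (aestronglyMeasurable_div_sub hf.1 z) ?_
  filter_upwards [hz] with t ht
  rw [norm_div]
  gcongr

theorem integrable_div_sub (hf : Integrable f μ) {z : ℂ} (hz : z.im ≠ 0) :
    Integrable (fun t : ℝ => f t / (z - t)) μ :=
  integrable_div_sub_of_le hf (abs_pos.2 hz) (ae_of_all _ fun t => abs_im_le_norm_sub_ofReal z t)

theorem differentiableAt_cauchyTransform (hf : Integrable f μ) {z₀ : ℂ} {δ : ℝ} (hδ : 0 < δ)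
    (hz : ∀ᵐ t : ℝ ∂μ, δ ≤ ‖z₀ - t‖) : DifferentiableAt ℂ (cauchyTransform μ f) z₀ := by
  have hball : ∀ t : ℝ, δ ≤ ‖z₀ - t‖ → ∀ z ∈ Metric.ball z₀ (δ / 2), δ / 2 ≤ ‖z - t‖ := by
    intro t ht z hz
    have h1 : ‖z₀ - t‖ ≤ ‖z₀ - z‖ + ‖z - t‖ := norm_sub_le_norm_sub_add_norm_sub _ _ _
    rw [mem_ball_iff_norm'] at hz
    linarith
  refine (hasDerivAt_integral_of_dominated_loc_of_deriv_le (μ := μ) (𝕜 := ℂ)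
    (F := fun z t => f t / (z - t)) (F' := fun z t => -f t / (z - t) ^ 2)
    (bound := fun t => ‖f t‖ / (δ / 2) ^ 2)
    (Metric.ball_mem_nhds z₀ (half_pos hδ)) ?_ (integrable_div_sub_of_le hf hδ hz) ?_ ?_ ?_ ?_
    ).2.differentiableAt
  · exact Eventually.of_forall fun z => aestronglyMeasurable_div_sub hf.1 z
  · simp_rw [div_eq_mul_inv]
    exact hf.1.neg.mul (Measurable.aestronglyMeasurable (by fun_prop))
  · filter_upwards [hz] with t ht z hzb
    rw [norm_div, norm_neg, norm_pow]
    have := hball t ht z hzb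
    gcongr
  · exact hf.norm.div_const _
  · filter_upwards [hz] with t ht z hzb
    have h0 : z - t ≠ 0 := norm_pos_iff.1 ((half_pos hδ).trans_le (hball t ht z hzb))
    have := (hasDerivAt_const z (f t)).div ((hasDerivAt_id z).sub_const (t : ℂ)) h0
    refine HasDerivAt.congr_deriv (f' := _) this ?_
    simp

theorem differentiableAt_cauchyTransform_of_im (hf : Integrable f μ) {z : ℂ} (hz : z.im ≠ 0) :
    DifferentiableAt ℂ (cauchyTransform μ f) z :=
  differentiableAt_cauchyTransform hf (abs_pos.2 hz)
    (ae_of_all _ fun t => abs_im_le_norm_sub_ofReal z t)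

theorem differentiableOn_cauchyTransform (hf : Integrable f μ) :
    DifferentiableOn ℂ (cauchyTransform μ f) {z | 0 < z.im} := fun _ hz =>
  (differentiableAt_cauchyTransform_of_im hf (ne_of_gt hz)).differentiableWithinAt

theorem cauchyTransform_conj (f : ℝ → ℂ) (z : ℂ) :
    cauchyTransform μ (fun t => (starRingEnd ℂ) (f t)) ((starRingEnd ℂ) z) =
      (starRingEnd ℂ) (cauchyTransform μ f z) := by
  unfold cauchyTransform
  rw [← integral_conj]
  simp

/-- Dominated convergence: `ε / |x + iε - t|` is at most one and tends to zero for `t ≠ x`, so only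
an atom at `x` could survive. -/
theorem tendsto_mul_cauchyTransform (hf : Integrable f μ) {x : ℝ} (hx : μ {x} = 0) :
    Tendsto (fun ε : ℝ => (ε : ℂ) * cauchyTransform μ f (x + ε * Complex.I)) (𝓝[>] 0) (𝓝 0) := by
  have h : Tendsto (fun ε : ℝ => ∫ t : ℝ, (ε : ℂ) * (f t / (x + ε * Complex.I - t)) ∂μ) (𝓝[>] 0)
      (𝓝 (∫ _ : ℝ, (0 : ℂ) ∂μ)) := by
    refine tendsto_integral_filter_of_dominated_convergence (fun t => ‖f t‖) ?_ ?_ hf.norm ?_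
    · exact Eventually.of_forall fun ε => (aestronglyMeasurable_div_sub hf.1 _).const_mul _
    · filter_upwards [self_mem_nhdsWithin] with ε hε
      have hε : 0 < ε := hε
      refine ae_of_all _ fun t => ?_
      have h1 : ε ≤ ‖(x + ε * Complex.I - t : ℂ)‖ := by
        have := abs_im_le_norm_sub_ofReal (x + ε * Complex.I) t
        simp only [Complex.add_im, Complex.ofReal_im, Complex.mul_im, Complex.ofReal_re,
          Complex.I_im, mul_one, Complex.I_re, mul_zero, add_zero, zero_add] at this
        rwa [abs_of_pos hε] at this
      rw [norm_mul, norm_div, Complex.norm_real, Real.norm_of_nonneg hε.le, ← mul_div_assoc,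
        div_le_iff₀ (hε.trans_le h1), mul_comm]
      gcongr
    · have : ∀ᵐ t ∂μ, t ≠ x := by
        rw [ae_iff]; simpa using hx
      filter_upwards [this] with t ht
      have hne : (x + (0:ℝ) * Complex.I - t : ℂ) ≠ 0 := by
        simp only [Complex.ofReal_zero, zero_mul, add_zero]
        exact_mod_cast sub_ne_zero.2 ht.symm
      have hc : ContinuousAt (fun ε : ℝ => (ε : ℂ) * (f t / (x + ε * Complex.I - t))) 0 :=
        ContinuousAt.mul (by fun_prop) (ContinuousAt.div (by fun_prop) (by fun_prop) hne)
      have := hc.tendsto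
      simp only [Complex.ofReal_zero, zero_mul] at this
      exact tendsto_nhdsWithin_of_tendsto_nhds this
  simpa [integral_const_mul, cauchyTransform] using h

end

theorem inv_sub_ofReal_im {x y : ℝ} (hy : 0 < y) (t : ℝ) :
    (1 / (x + y * Complex.I - t : ℂ)).im = -Real.pi * poissonHP y (x - t) := by
  have hπ := Real.pi_pos
  have h2 : (0:ℝ) < (x - t) ^ 2 + y ^ 2 := by positivity
  rw [one_div, Complex.inv_im, Complex.normSq_apply]
  simp only [Complex.sub_im, Complex.add_im, Complex.ofReal_im, Complex.mul_im, Complex.ofReal_re,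
    Complex.I_im, mul_one, Complex.I_re, mul_zero, add_zero, zero_add, sub_zero, Complex.sub_re,
    Complex.add_re, Complex.mul_re, sub_self]
  unfold poissonHP
  rw [← sq, ← sq]
  field_simp

theorem poissonHP_mul_integrable {w : ℝ → ℝ} (hw : Integrable w) {y : ℝ} (hy : 0 < y) (x : ℝ) :
    Integrable fun t => poissonHP y (x - t) * w t := by
  refine hw.bdd_mul (c := 1 / (Real.pi * y)) (integrable_poissonHP_sub hy x).1
    (ae_of_all _ fun t => ?_)
  rw [Real.norm_of_nonneg (poissonHP_pos hy _).le]
  exact poissonHP_le hy _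

theorem cauchyTransform_im {w : ℝ → ℝ} (hw : Integrable w) (x : ℝ) {y : ℝ} (hy : 0 < y) :
    (cauchyTransform volume (fun t => (w t : ℂ)) (x + y * Complex.I)).im =
      -Real.pi * ∫ t, poissonHP y (x - t) * w t := by
  unfold cauchyTransform
  have hi := integrable_div_sub (z := x + y * Complex.I) hw.ofReal (by simpa using hy.ne')
  have h1 := integral_im hi
  simp only [RCLike.im_to_complex] at h1
  have h2 : ∀ t, ((w t : ℂ) / (x + y * Complex.I - t)).im =
      -Real.pi * (poissonHP y (x - t) * w t) := by
    intro t
    rw [div_eq_mul_one_div, Complex.im_ofReal_mul, inv_sub_ofReal_im hy]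
    ring
  rw [← integral_const_mul, ← integral_congr_ae (ae_of_all _ h2)]
  exact h1.symm

/-- The Cauchy kernels at conjugate points are conjugate, so their difference is a multiple of the
Poisson kernel. This recovers a density from its Cauchy transform. -/
theorem cauchyTransform_jump {v : ℝ → ℂ} (hv : Integrable v) (x : ℝ) {y : ℝ} (hy : 0 < y) :
    cauchyTransform volume v (x - y * Complex.I) - cauchyTransform volume v (x + y * Complex.I) =
      2 * Real.pi * Complex.I * ∫ t, poissonHP y (x - t) • v t := by
  unfold cauchyTransform
  rw [← integral_sub (integrable_div_sub hv (by simpa using hy.ne'))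
    (integrable_div_sub hv (by simpa using hy.ne')), ← integral_const_mul]
  congr 1
  funext t
  have h1 := inv_sub_ofReal_im (x := x) hy t
  set q : ℂ := 1 / (x + y * Complex.I - t) with hq
  have h2 : 1 / (x - y * Complex.I - t : ℂ) = (starRingEnd ℂ) q := by
    rw [hq]; simp [sub_eq_add_neg]
  rw [div_eq_mul_one_div, div_eq_mul_one_div (v t), ← hq, h2, Complex.real_smul, ← mul_sub]
  have h3 : (starRingEnd ℂ) q - q = -(2 * q.im * Complex.I) := by
    have := Complex.sub_conj q
    push_cast at this
    linear_combination -this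
  rw [h3, h1]
  push_cast
  ring

/-- The Cauchy transform of a positive integrable density has finite vertical boundary values. -/
theorem ae_exists_tendsto_cauchyTransform {w : ℝ → ℝ} (hw : Integrable w) (hw0 : ∀ t, 0 ≤ w t) :
    ∀ᵐ x : ℝ, ∃ l : ℂ, Tendsto (fun y : ℝ => cauchyTransform volume (fun t => (w t : ℂ))
      (x + y * Complex.I)) (𝓝[>] 0) (𝓝 l) ∧ l.im = -Real.pi * w x := by
  set S := cauchyTransform volume (fun t => (w t : ℂ)) with hS
  have hSd : DifferentiableOn ℂ S {z | 0 < z.im} := differentiableOn_cauchyTransform hw.ofReal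
  have hSim : ∀ z : ℂ, 0 < z.im → (S z).im ≤ 0 := by
    intro z hz
    have := cauchyTransform_im hw z.re hz
    rw [Complex.re_add_im] at this
    rw [hS, this, neg_mul, neg_nonpos]
    exact mul_nonneg Real.pi_pos.le
      (integral_nonneg fun t => mul_nonneg (poissonHP_pos hz _).le (hw0 t))
  -- As `Im S ≤ 0`, the modulus of `exp(-i S)`, which is `exp(Im S)`, is at most one and Fatou's
  -- theorem applies. Multiplying by the limit of `exp(-Im S)` leaves a limit of `exp(-i Re S)`, and
  -- continuity of `Re S` on the vertical line removes the ambiguity of the angle.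
  have hE := ae_exists_boundary_limit (b := fun z => Complex.exp (-Complex.I * S z)) (M := 1)
    (hSd.const_mul _).cexp (fun z hz => by
      rw [Complex.norm_exp, Real.exp_le_one_iff]
      simpa using hSim z hz)
  filter_upwards [hE, ae_tendsto_poissonHP_of_integrable hw] with x ⟨e, he⟩ hx
  have him : Tendsto (fun y : ℝ => (S (x + y * Complex.I)).im) (𝓝[>] 0)
      (𝓝 (-Real.pi * w x)) := by
    refine (hx.const_mul (-Real.pi)).congr' ?_
    filter_upwards [self_mem_nhdsWithin] with y hy
    rw [hS, cauchyTransform_im hw x hy]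
    rfl
  have hre : ∃ l, Tendsto (fun y : ℝ => -(S (x + y * Complex.I)).re) (𝓝[>] 0) (𝓝 l) := by
    have hc : ContinuousOn (fun y : ℝ => -(S (x + y * Complex.I)).re) (Set.Ioi 0) := by
      refine (Complex.continuous_re.comp_continuousOn ?_).neg
      refine hSd.continuousOn.comp (by fun_prop) fun y hy => ?_
      have hy : 0 < y := hy
      simpa using hy
    have hex : Tendsto (fun y : ℝ => Complex.exp (-((S (x + y * Complex.I)).im : ℂ))) (𝓝[>] 0)
        (𝓝 (Complex.exp (-((-Real.pi * w x : ℝ) : ℂ)))) :=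
      (Complex.continuous_exp.tendsto _).comp
        ((Complex.continuous_ofReal.tendsto _).comp him).neg
    refine exists_tendsto_of_tendsto_exp hc ((he.mul hex).congr fun y => ?_)
    rw [← Complex.exp_add]
    congr 1
    have := Complex.re_add_im (S (x + y * Complex.I))
    push_cast
    nth_rewrite 1 [← this]
    linear_combination (-((S (x + y * Complex.I)).im : ℂ)) * Complex.I_mul_I
  obtain ⟨l, hl⟩ := hre
  refine ⟨-l + (-Real.pi * w x : ℝ) * Complex.I, ?_, by simp⟩
  have h1 := ((Complex.continuous_ofReal.tendsto _).comp hl).neg.add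
    (((Complex.continuous_ofReal.tendsto _).comp him).mul_const Complex.I)
  refine h1.congr fun y => ?_
  simp only [Function.comp, Complex.ofReal_neg, neg_neg]
  exact Complex.re_add_im _

/-! ## Herglotz representation with an absolutely continuous measure -/

theorem tendsto_one_div_nhdsGT :
    Tendsto (fun k : ℕ => 1 / ((k : ℝ) + 1)) atTop (𝓝[>] 0) :=
  tendsto_nhdsWithin_iff.2 ⟨tendsto_one_div_add_atTop_nhds_zero_nat,
    Eventually.of_forall fun k => show (0:ℝ) < _ by positivity⟩

section Herglotz

variable {F : ℂ → ℂ} {C : ℝ}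

theorem continuous_herglotz_line (hF : DifferentiableOn ℂ F {z | 0 < z.im}) {ε : ℝ} (hε : 0 < ε) :
    Continuous fun x : ℝ => -(F (x + ε * Complex.I)).im :=
  (Complex.continuous_im.comp (hF.continuousOn.comp_continuous (by fun_prop) fun x => by
    simpa using hε)).neg

theorem norm_herglotz_le (hC : ∀ z : ℂ, 0 < z.im → ‖F z‖ ≤ C / z.im) {ε : ℝ}
    (hε : 0 < ε) : ∀ z : ℂ, ε ≤ z.im → ‖F z‖ ≤ C / ε := by
  have hC0 : 0 ≤ C := by
    have := (norm_nonneg _).trans (hC Complex.I (by simp))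
    simpa using this
  intro z hz
  refine (hC z (hε.trans_le hz)).trans ?_
  gcongr

theorem herglotz_poisson (hF : DifferentiableOn ℂ F {z | 0 < z.im})
    (hC : ∀ z : ℂ, 0 < z.im → ‖F z‖ ≤ C / z.im) {ε : ℝ} (hε : 0 < ε) {z : ℂ} (hz : 0 < z.im) :
    Integrable (fun x : ℝ => poissonHP z.im (z.re - x) * -(F (x + ε * Complex.I)).im) ∧
    ∫ x : ℝ, poissonHP z.im (z.re - x) * -(F (x + ε * Complex.I)).im =
      -(F (z + ε * Complex.I)).im := by
  have hM := norm_herglotz_le hC hε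
  have hFc : Continuous fun x : ℝ => F (x + ε * Complex.I) :=
    hF.continuousOn.comp_continuous (by fun_prop) fun x => by simpa using hε
  have hi : Integrable fun x : ℝ => poissonHP z.im (z.re - x) • F (x + ε * Complex.I) := by
    refine ((integrable_poissonHP_sub hz z.re).mul_const (C / ε)).mono'
      ((integrable_poissonHP_sub hz z.re).1.smul hFc.aestronglyMeasurable)
      (ae_of_all _ fun x => ?_)
    rw [norm_smul, Real.norm_of_nonneg (poissonHP_pos hz _).le]
    have := (poissonHP_pos hz (z.re - x)).le
    gcongr
    exact hM _ (by simp)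
  have e : ∀ x : ℝ, poissonHP z.im (z.re - x) * -(F (x + ε * Complex.I)).im =
      -(poissonHP z.im (z.re - x) • F (x + ε * Complex.I)).im := fun x => by
    rw [Complex.smul_im, smul_eq_mul]; ring
  simp_rw [e]
  refine ⟨hi.im.neg, ?_⟩
  have h := integral_im hi
  simp only [RCLike.im_to_complex] at h
  rw [integral_neg, h, integral_poissonHP_eq hF hε hM hz]

/-- The mass of a horizontal line is seen from far above it: `π (k + 1)` times the Poisson kernel at
height `k + 1` tends to one, while the Poisson integral is at most `C / (k + 1 + ε)`. Fatou's lemma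
then bounds the mass by `π C`, uniformly in `ε`. -/
theorem herglotz_mass (hF : DifferentiableOn ℂ F {z | 0 < z.im})
    (hC : ∀ z : ℂ, 0 < z.im → ‖F z‖ ≤ C / z.im) (hneg : ∀ z : ℂ, 0 < z.im → (F z).im ≤ 0)
    {ε : ℝ} (hε : 0 < ε) :
    ∫⁻ x : ℝ, ENNReal.ofReal (-(F (x + ε * Complex.I)).im) ≤ ENNReal.ofReal (Real.pi * C) := by
  have hπ := Real.pi_pos
  have hC0 : 0 ≤ C := by
    have := (norm_nonneg _).trans (hC Complex.I (by simp))
    simpa using this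
  have hn : ∀ x : ℝ, 0 ≤ -(F (x + ε * Complex.I)).im := fun x =>
    neg_nonneg.2 (hneg _ (by simpa using hε))
  have hcont := continuous_herglotz_line hF hε
  set φ : ℕ → ℝ → ℝ := fun k x => Real.pi * (k + 1) *
    (poissonHP (k + 1) (0 - x) * -(F (x + ε * Complex.I)).im) with hφ
  have hk : ∀ k : ℕ, (0:ℝ) < k + 1 := fun k => by positivity
  have hlim : ∀ x : ℝ, Tendsto (fun k => φ k x) atTop (𝓝 (-(F (x + ε * Complex.I)).im)) := by
    intro x
    have h1 : ∀ k : ℕ, φ k x = (1 / (1 + x ^ 2 * (1 / ((k:ℝ) + 1)) ^ 2)) *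
        -(F (x + ε * Complex.I)).im := by
      intro k
      have := hk k
      simp only [hφ, poissonHP]
      field_simp
      ring
    simp_rw [h1]
    have h2 : Tendsto (fun k : ℕ => 1 + x ^ 2 * (1 / ((k:ℝ) + 1)) ^ 2) atTop (𝓝 (1 + x ^ 2 * 0 ^ 2)) :=
      ((tendsto_one_div_add_atTop_nhds_zero_nat.pow 2).const_mul _).const_add _
    have h3 := ((tendsto_const_nhds (x := (1:ℝ))).div h2 (by simp)).mul_const
      (-(F (x + ε * Complex.I)).im)
    simpa using h3
  calc ∫⁻ x : ℝ, ENNReal.ofReal (-(F (x + ε * Complex.I)).im)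
      = ∫⁻ x : ℝ, liminf (fun k => ENNReal.ofReal (φ k x)) atTop := by
        congr 1
        funext x
        exact ((ENNReal.continuous_ofReal.tendsto _).comp (hlim x)).liminf_eq.symm
    _ ≤ liminf (fun k => ∫⁻ x : ℝ, ENNReal.ofReal (φ k x)) atTop := by
        refine lintegral_liminf_le fun k => ENNReal.measurable_ofReal.comp ?_
        refine Continuous.measurable ?_
        exact continuous_const.mul (((continuous_poissonHP (hk k)).comp (by fun_prop)).mul hcont)
    _ ≤ ENNReal.ofReal (Real.pi * C) := by
        refine liminf_le_of_le (by isBoundedDefault) fun b hb => ?_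
        obtain ⟨k, hbk⟩ := hb.exists
        refine hbk.trans ?_
        have hz : (0:ℝ) < (((k + 1 : ℝ) : ℂ) * Complex.I).im := by simpa using hk k
        have hre : (((k + 1 : ℝ) : ℂ) * Complex.I).re = 0 := by simp
        have him : (((k + 1 : ℝ) : ℂ) * Complex.I).im = k + 1 := by simp
        obtain ⟨i1, i2⟩ := herglotz_poisson hF hC hε hz
        rw [hre, him] at i1 i2
        rw [← ofReal_integral_eq_lintegral_ofReal (i1.const_mul _) (ae_of_all _ fun x => by
          have := poissonHP_pos (hk k) (0 - x); have := hn x; have := hk k; positivity)]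
        refine ENNReal.ofReal_le_ofReal ?_
        rw [integral_const_mul, i2, mul_assoc]
        gcongr
        have h3 := (neg_le_abs _).trans ((Complex.abs_im_le_norm _).trans
          (hC (((k + 1 : ℝ) : ℂ) * Complex.I + ε * Complex.I) (by simp; have := hk k; linarith)))
        refine (mul_le_mul_of_nonneg_left h3 (hk k).le).trans ?_
        have him2 : (((k + 1 : ℝ) : ℂ) * Complex.I + ε * Complex.I).im = k + 1 + ε := by simp
        rw [him2, mul_div_assoc', div_le_iff₀ (by have := hk k; linarith)]
        nlinarith [hk k, mul_nonneg hC0 hε.le]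

theorem herglotz_integrable_line (hF : DifferentiableOn ℂ F {z | 0 < z.im})
    (hC : ∀ z : ℂ, 0 < z.im → ‖F z‖ ≤ C / z.im) (hneg : ∀ z : ℂ, 0 < z.im → (F z).im ≤ 0)
    {ε : ℝ} (hε : 0 < ε) :
    Integrable (fun x : ℝ => -(F (x + ε * Complex.I)).im) ∧
      ∫ x : ℝ, -(F (x + ε * Complex.I)).im ≤ Real.pi * C := by
  have hC0 : 0 ≤ C := by
    have := (norm_nonneg _).trans (hC Complex.I (by simp))
    simpa using this
  have hn : ∀ x : ℝ, 0 ≤ -(F (x + ε * Complex.I)).im := fun x =>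
    neg_nonneg.2 (hneg _ (by simpa using hε))
  have hm := herglotz_mass hF hC hneg hε
  have hmeas := (continuous_herglotz_line hF hε).aestronglyMeasurable (μ := volume)
  have hi : Integrable (fun x : ℝ => -(F (x + ε * Complex.I)).im) := by
    refine ⟨hmeas, ?_⟩
    rw [hasFiniteIntegral_iff_ofReal (ae_of_all _ hn)]
    exact hm.trans_lt ENNReal.ofReal_lt_top
  refine ⟨hi, ?_⟩
  rw [← ofReal_integral_eq_lintegral_ofReal hi (ae_of_all _ hn)] at hm
  exact (ENNReal.ofReal_le_ofReal_iff (by have := Real.pi_pos; positivity)).1 hm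

/-- On the ball of radius `r` the Poisson kernel at height `r` is at least `1 / (2 π r)`. The mass
in the ball is therefore at most `2 π r ‖F(x₀ + i (r + ε))‖`, which the absence of an atom makes
small, uniformly in `ε < r`. -/
theorem herglotz_mass_near (hF : DifferentiableOn ℂ F {z | 0 < z.im})
    (hC : ∀ z : ℂ, 0 < z.im → ‖F z‖ ≤ C / z.im) (hneg : ∀ z : ℂ, 0 < z.im → (F z).im ≤ 0)
    {x₀ : ℝ} (hx₀ : Tendsto (fun ε : ℝ => (ε : ℂ) * F (x₀ + ε * Complex.I)) (𝓝[>] 0) (𝓝 0))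
    {η : ℝ} (hη : 0 < η) :
    ∃ r₀ > 0, ∀ r, 0 < r → r ≤ r₀ → ∀ ε, 0 < ε → ε < r →
      ∫ x : ℝ, (Metric.ball x₀ r).indicator (fun x => -(F (x + ε * Complex.I)).im) x ≤ η := by
  have hπ := Real.pi_pos
  have h1 : ∀ᶠ ε : ℝ in 𝓝[>] 0, ‖(ε : ℂ) * F (x₀ + ε * Complex.I)‖ < η / (2 * Real.pi) := by
    have := hx₀.norm
    rw [norm_zero] at this
    exact this.eventually (gt_mem_nhds (by positivity))
  obtain ⟨δ, hδ, hδs⟩ := mem_nhdsGT_iff_exists_Ioo_subset.1 h1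
  have hδ : 0 < δ := hδ
  refine ⟨δ / 2, half_pos hδ, fun r hr hrδ ε hε hεr => ?_⟩
  have hz : 0 < ((x₀ + r * Complex.I : ℂ)).im := by simpa using hr
  obtain ⟨i1, i2⟩ := herglotz_poisson hF hC hε hz
  have hre : ((x₀ + r * Complex.I : ℂ)).re = x₀ := by simp
  have him : ((x₀ + r * Complex.I : ℂ)).im = r := by simp
  rw [hre, him] at i1 i2
  have hn : ∀ x : ℝ, 0 ≤ -(F (x + ε * Complex.I)).im := fun x =>
    neg_nonneg.2 (hneg _ (by simpa using hε))
  have hle : ∀ x : ℝ, (Metric.ball x₀ r).indicator (fun x => -(F (x + ε * Complex.I)).im) x ≤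
      2 * Real.pi * r * (poissonHP r (x₀ - x) * -(F (x + ε * Complex.I)).im) := by
    intro x
    have hp := poissonHP_pos hr (x₀ - x)
    by_cases hx : x ∈ Metric.ball x₀ r
    · rw [Set.indicator_of_mem hx, ← mul_assoc]
      refine le_mul_of_one_le_left (hn x) ?_
      rw [Metric.mem_ball, Real.dist_eq, abs_sub_comm] at hx
      unfold poissonHP
      have h5 : (x₀ - x) ^ 2 ≤ r ^ 2 := by
        rw [← sq_abs]; gcongr
      rw [mul_div_assoc', le_div_iff₀ (by positivity)]
      nlinarith
    · rw [Set.indicator_of_notMem hx]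
      have := hn x
      positivity
  calc _ ≤ ∫ x : ℝ, 2 * Real.pi * r * (poissonHP r (x₀ - x) * -(F (x + ε * Complex.I)).im) :=
        integral_mono_of_nonneg (ae_of_all _ fun x => Set.indicator_nonneg (fun x _ => hn x) x)
          (i1.const_mul _) (ae_of_all _ hle)
    _ ≤ η := by
        rw [integral_const_mul, i2]
        have h2 := hδs (show r + ε ∈ Set.Ioo 0 δ from ⟨by linarith, by linarith⟩)
        have h2 : ‖((r + ε : ℝ) : ℂ) * F (x₀ + (r + ε : ℝ) * Complex.I)‖ < η / (2 * Real.pi) := h2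
        have e : (x₀ + r * Complex.I + ε * Complex.I : ℂ) = x₀ + (r + ε : ℝ) * Complex.I := by
          push_cast; ring
        rw [norm_mul, Complex.norm_real, Real.norm_of_nonneg (by linarith)] at h2
        rw [e]
        have h3 := (neg_le_abs _).trans (Complex.abs_im_le_norm (F (x₀ + (r + ε : ℝ) * Complex.I)))
        set N := ‖F (x₀ + (r + ε : ℝ) * Complex.I)‖
        have hN : 0 ≤ N := norm_nonneg _
        rw [lt_div_iff₀ (by positivity)] at h2
        have h6 : 2 * Real.pi * r * -(F (x₀ + (r + ε : ℝ) * Complex.I)).im ≤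
          2 * Real.pi * r * N := by gcongr
        have h7 : 0 ≤ 2 * Real.pi * (ε * N) := by positivity
        nlinarith

/-- A Herglotz function (with the sign of a Stieltjes transform) whose boundary behaviour is tame
outside a finite set without atoms is represented by an absolutely continuous measure. -/
theorem herglotz_representation (hF : DifferentiableOn ℂ F {z | 0 < z.im})
    (hC : ∀ z : ℂ, 0 < z.im → ‖F z‖ ≤ C / z.im) (hneg : ∀ z : ℂ, 0 < z.im → (F z).im ≤ 0)
    {j : ℝ → ℝ}
    (hj : ∀ᵐ x : ℝ, Tendsto (fun ε : ℝ => -(F (x + ε * Complex.I)).im) (𝓝[>] 0) (𝓝 (j x)))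
    {s : Set ℝ} (hs : s.Finite)
    (hbad : ∀ x ∈ s, Tendsto (fun ε : ℝ => (ε : ℂ) * F (x + ε * Complex.I)) (𝓝[>] 0) (𝓝 0))
    (hloc : ∀ x ∉ s, ∃ δ > 0, ∃ M, ∀ x' ε : ℝ, |x' - x| < δ → 0 < ε → ε < δ →
      ‖F (x' + ε * Complex.I)‖ ≤ M) :
    Integrable j ∧ (∀ᵐ x, 0 ≤ j x) ∧
      ∀ z : ℂ, 0 < z.im → -(F z).im = ∫ t, poissonHP z.im (z.re - t) * j t := by
  have hπ := Real.pi_pos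
  have hC0 : 0 ≤ C := by
    have := (norm_nonneg _).trans (hC Complex.I (by simp))
    simpa using this
  set e : ℕ → ℝ := fun k => 1 / ((k : ℝ) + 1) with he
  have he0 : ∀ k, 0 < e k := fun k => by simp only [he]; positivity
  set n : ℕ → ℝ → ℝ := fun k x => -(F (x + e k * Complex.I)).im with hn
  have hn0 : ∀ k x, 0 ≤ n k x := fun k x => neg_nonneg.2 (hneg _ (by simpa using he0 k))
  have hnc : ∀ k, Continuous (n k) := fun k => continuous_herglotz_line hF (he0 k)
  have hni : ∀ k, Integrable (n k) := fun k => (herglotz_integrable_line hF hC hneg (he0 k)).1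
  have hnm : ∀ k, ∫ x, n k x ≤ Real.pi * C := fun k =>
    (herglotz_integrable_line hF hC hneg (he0 k)).2
  have hnj : ∀ᵐ x : ℝ, Tendsto (fun k => n k x) atTop (𝓝 (j x)) := by
    filter_upwards [hj] with x hx
    exact hx.comp tendsto_one_div_nhdsGT
  have hjm : AEStronglyMeasurable j volume :=
    aestronglyMeasurable_of_tendsto_ae atTop (fun k => (hnc k).aestronglyMeasurable) hnj
  have hj0 : ∀ᵐ x, 0 ≤ j x := by
    filter_upwards [hnj] with x hx
    exact ge_of_tendsto' hx fun k => hn0 k x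
  have hji : Integrable j := by
    refine ⟨hjm, ?_⟩
    rw [hasFiniteIntegral_iff_ofReal hj0]
    calc ∫⁻ x, ENNReal.ofReal (j x)
        = ∫⁻ x, liminf (fun k => ENNReal.ofReal (n k x)) atTop := by
          refine lintegral_congr_ae ?_
          filter_upwards [hnj] with x hx
          exact ((ENNReal.continuous_ofReal.tendsto _).comp hx).liminf_eq.symm
      _ ≤ liminf (fun k => ∫⁻ x, ENNReal.ofReal (n k x)) atTop :=
          lintegral_liminf_le fun k => ENNReal.measurable_ofReal.comp (hnc k).measurable
      _ ≤ ENNReal.ofReal (Real.pi * C) := by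
          refine liminf_le_of_le (by isBoundedDefault) fun b hb => ?_
          obtain ⟨k, hbk⟩ := hb.exists
          exact hbk.trans (herglotz_mass hF hC hneg (he0 k))
      _ < ⊤ := ENNReal.ofReal_lt_top
  refine ⟨hji, hj0, fun z hz => ?_⟩
  set p : ℝ → ℝ := fun t => poissonHP z.im (z.re - t) with hp
  have hp0 : ∀ t, 0 ≤ p t := fun t => (poissonHP_pos hz _).le
  have hpc : Continuous p := (continuous_poissonHP hz).comp (by fun_prop)
  set B := 1 / (Real.pi * z.im) with hB
  have hB0 : 0 < B := by positivity
  have hpB : ∀ t, p t ≤ B := fun t => poissonHP_le hz _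
  have hpj : Integrable fun t => p t * j t := poissonHP_mul_integrable hji hz z.re
  have hpn : ∀ k, Integrable (fun t => p t * n k t) ∧
      ∫ t, p t * n k t = -(F (z + e k * Complex.I)).im := fun k =>
    herglotz_poisson hF hC (he0 k) hz
  have hFz : Tendsto (fun k => -(F (z + e k * Complex.I)).im) atTop (𝓝 (-(F z).im)) := by
    have h1 : Tendsto (fun ε : ℝ => (z + ε * Complex.I : ℂ)) (𝓝[>] 0) (𝓝 z) := by
      refine tendsto_nhdsWithin_of_tendsto_nhds ?_
      have : Continuous fun ε : ℝ => (z + ε * Complex.I : ℂ) := by fun_prop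
      simpa using this.tendsto 0
    have h2 := (hF.differentiableAt (isOpen_im_pos.mem_nhds hz)).continuousAt.tendsto.comp h1
    exact (((Complex.continuous_im.tendsto _).comp h2).neg).comp tendsto_one_div_nhdsGT
  have hpj0 : ∀ᵐ t, 0 ≤ p t * j t := by
    filter_upwards [hj0] with t ht using mul_nonneg (hp0 t) ht
  -- The second inequality is Fatou's lemma. The first says that no mass is lost in the limit: off
  -- small balls around the exceptional points and off a far tail, `F` is bounded and dominated
  -- convergence applies.
  refine le_antisymm ?_ ?_
  · refine le_of_forall_pos_le_add fun η hη => ?_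
    -- small mass near the exceptional points
    have hcard : (0:ℝ) < (hs.toFinset.card : ℝ) + 1 := by positivity
    -- The balls together then contribute at most `η / 2`; the added one keeps the denominator
    -- positive when `s` is empty.
    set η' := η / (2 * B * ((hs.toFinset.card : ℝ) + 1)) with hη'
    have hη'0 : 0 < η' := by positivity
    choose! r₀ hr₀ hr₀' using fun x (hx : x ∈ s) =>
      herglotz_mass_near hF hC hneg (hbad x hx) hη'0
    obtain ⟨r, hr, hrr⟩ : ∃ r > 0, ∀ x ∈ s, r ≤ r₀ x := by
      rcases s.eq_empty_or_nonempty with h | h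
      · exact ⟨1, one_pos, by simp [h]⟩
      · obtain ⟨x, hx, hmin⟩ := Set.exists_min_image s r₀ hs h
        exact ⟨r₀ x, hr₀ x hx, hmin⟩
    -- small tails
    obtain ⟨T, hT0, hT⟩ : ∃ T > 0, z.im / (Real.pi * T ^ 2) * (Real.pi * C) ≤ η / 2 := by
      have h1 : Tendsto (fun T : ℝ => z.im / (Real.pi * T ^ 2) * (Real.pi * C)) atTop
          (𝓝 (0 * (Real.pi * C))) := by
        refine Tendsto.mul_const _ (tendsto_const_nhds.div_atTop ?_)
        exact (tendsto_pow_atTop two_ne_zero).const_mul_atTop hπ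
      rw [zero_mul] at h1
      obtain ⟨T, hT, hT1⟩ := ((h1.eventually (gt_mem_nhds (half_pos hη))).and
        (eventually_gt_atTop 0)).exists
      exact ⟨T, hT1, hT.le⟩
    set τ := z.im / (Real.pi * T ^ 2) with hτ
    set E : Set ℝ := Metric.closedBall z.re T \ ⋃ x ∈ s, Metric.ball x r with hE
    have hEc : IsCompact E := (isCompact_closedBall _ _).diff
      (isOpen_biUnion fun x _ => Metric.isOpen_ball)
    have hEm : MeasurableSet E := hEc.isClosed.measurableSet
    have hEs : ∀ x ∈ E, x ∉ s := fun x hx hxs => hx.2 (by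
      simp only [Set.mem_iUnion]
      exact ⟨x, hxs, Metric.mem_ball_self hr⟩)
    -- Local bounds are patched together by compactness of `E`, which contains no exceptional point.
    obtain ⟨M, δ, hδ, hM⟩ : ∃ M, ∃ δ > 0, ∀ x ∈ E, ∀ ε : ℝ, 0 < ε → ε < δ →
        ‖F (x + ε * Complex.I)‖ ≤ M := by
      refine hEc.induction_on (p := fun A => ∃ M, ∃ δ > 0, ∀ x ∈ A, ∀ ε : ℝ, 0 < ε → ε < δ →
        ‖F (x + ε * Complex.I)‖ ≤ M) ⟨0, 1, one_pos, by simp⟩ ?_ ?_ ?_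
      · rintro A A' hAA ⟨M, δ, hδ, h⟩
        exact ⟨M, δ, hδ, fun x hx => h x (hAA hx)⟩
      · rintro A A' ⟨M, δ, hδ, h⟩ ⟨M', δ', hδ', h'⟩
        refine ⟨max M M', min δ δ', lt_min hδ hδ', fun x hx ε h0 h1 => ?_⟩
        rcases hx with hx | hx
        · exact (h x hx ε h0 (h1.trans_le (min_le_left _ _))).trans (le_max_left _ _)
        · exact (h' x hx ε h0 (h1.trans_le (min_le_right _ _))).trans (le_max_right _ _)
      · intro x hx
        obtain ⟨δ, hδ, M, h⟩ := hloc x (hEs x hx)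
        exact ⟨Metric.ball x δ, mem_nhdsWithin_of_mem_nhds (Metric.ball_mem_nhds x hδ), M, δ, hδ,
          fun x' hx' ε h0 h1 => h x' ε (by simpa [Real.dist_eq] using hx') h0 h1⟩
    have hdct : Tendsto (fun k => ∫ t in E, p t * n k t) atTop (𝓝 (∫ t in E, p t * j t)) := by
      refine tendsto_integral_filter_of_dominated_convergence (fun t => p t * M) ?_ ?_ ?_ ?_
      · exact Eventually.of_forall fun k => (hpc.mul (hnc k)).aestronglyMeasurable
      · have : ∀ᶠ k in atTop, e k < δ :=
          tendsto_one_div_add_atTop_nhds_zero_nat.eventually (gt_mem_nhds hδ)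
        filter_upwards [this] with k hk
        refine (ae_restrict_iff' hEm).2 (ae_of_all _ fun t ht => ?_)
        rw [Real.norm_of_nonneg (mul_nonneg (hp0 t) (hn0 k t))]
        have h2 : n k t ≤ M := (neg_le_abs _).trans
          ((Complex.abs_im_le_norm _).trans (hM t ht _ (he0 k) hk))
        have := hp0 t
        gcongr
      · exact ((integrable_poissonHP_sub hz z.re).mul_const M).integrableOn
      · refine ae_restrict_of_ae ?_
        filter_upwards [hnj] with t ht using ht.const_mul _
    have hbound : ∀ᶠ k in atTop, -(F (z + e k * Complex.I)).im ≤ (∫ t in E, p t * n k t) + η := by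
      have : ∀ᶠ k in atTop, e k < r :=
        tendsto_one_div_add_atTop_nhds_zero_nat.eventually (gt_mem_nhds hr)
      filter_upwards [this] with k hk
      have hpt : ∀ t, p t * n k t ≤ E.indicator (fun t => p t * n k t) t +
          B * (∑ x ∈ hs.toFinset, (Metric.ball x r).indicator (n k) t) + τ * n k t := by
        intro t
        have h1 : 0 ≤ E.indicator (fun t => p t * n k t) t :=
          Set.indicator_nonneg (fun t _ => mul_nonneg (hp0 t) (hn0 k t)) t
        have h2' : ∀ x ∈ hs.toFinset, 0 ≤ (Metric.ball x r).indicator (n k) t := fun x _ =>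
          Set.indicator_nonneg (fun t _ => hn0 k t) t
        have h2 : 0 ≤ B * (∑ x ∈ hs.toFinset, (Metric.ball x r).indicator (n k) t) :=
          mul_nonneg hB0.le (Finset.sum_nonneg h2')
        have h3 : 0 ≤ τ * n k t := mul_nonneg (by positivity) (hn0 k t)
        by_cases ht : t ∈ E
        · rw [Set.indicator_of_mem ht]; linarith
        · by_cases ht2 : t ∈ ⋃ x ∈ s, Metric.ball x r
          · simp only [Set.mem_iUnion] at ht2
            obtain ⟨x, hx, hxt⟩ := ht2
            have h4 := Finset.single_le_sum h2' (hs.mem_toFinset.2 hx)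
            rw [Set.indicator_of_mem hxt] at h4
            have h5 : p t * n k t ≤ B * n k t := mul_le_mul_of_nonneg_right (hpB t) (hn0 k t)
            have h6 := mul_le_mul_of_nonneg_left h4 hB0.le
            linarith
          · have h7 : t ∉ Metric.closedBall z.re T := fun h => ht ⟨h, ht2⟩
            rw [Metric.mem_closedBall, Real.dist_eq, not_le, abs_sub_comm] at h7
            have h8 : p t ≤ τ := by
              simp only [hp, hτ, poissonHP]
              have : T ^ 2 ≤ (z.re - t) ^ 2 := by
                rw [← sq_abs (z.re - t)]; gcongr
              gcongr
              nlinarith [sq_nonneg z.im]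
            have h9 := mul_le_mul_of_nonneg_right h8 (hn0 k t)
            linarith
      have hi2 : ∀ x, Integrable ((Metric.ball x r).indicator (n k)) := fun x =>
        (hni k).indicator Metric.isOpen_ball.measurableSet
      have hi3 : Integrable fun t => ∑ x ∈ hs.toFinset, (Metric.ball x r).indicator (n k) t :=
        integrable_finsetSum _ fun x _ => hi2 x
      have hint := integral_mono (hpn k).1
        ((((hpn k).1.indicator hEm).add (hi3.const_mul B)).add ((hni k).const_mul τ)) hpt
      rw [(hpn k).2] at hint
      refine hint.trans ?_
      simp only [Pi.add_apply]
      rw [integral_add, integral_add, integral_indicator hEm, integral_const_mul,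
        integral_const_mul, integral_finsetSum _ fun x _ => hi2 x, add_assoc]
      · gcongr
        have h1 : ∑ x ∈ hs.toFinset, ∫ t, (Metric.ball x r).indicator (n k) t ≤
            hs.toFinset.card * η' := by
          rw [← nsmul_eq_mul]
          refine Finset.sum_le_card_nsmul _ _ _ fun x hx => ?_
          have hx := hs.mem_toFinset.1 hx
          exact hr₀' x hx r hr (hrr x hx) _ (he0 k) hk
        have h2 : B * (hs.toFinset.card * η') ≤ η / 2 := by
          rw [hη']
          have e1 : B * (hs.toFinset.card * (η / (2 * B * ((hs.toFinset.card : ℝ) + 1)))) =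
              η / 2 * (hs.toFinset.card / ((hs.toFinset.card : ℝ) + 1)) := by
            field_simp
          rw [e1]
          refine mul_le_of_le_one_right (by positivity) ?_
          rw [div_le_one hcard]; linarith
        have h3 := mul_le_mul_of_nonneg_left h1 hB0.le
        have h4 : τ * ∫ t, n k t ≤ τ * (Real.pi * C) :=
          mul_le_mul_of_nonneg_left (hnm k) (by positivity)
        linarith
      · exact (hpn k).1.indicator hEm
      · exact hi3.const_mul B
      · exact ((hpn k).1.indicator hEm).add (hi3.const_mul B)
      · exact (hni k).const_mul τ
    refine (le_of_tendsto_of_tendsto hFz (hdct.add_const η) hbound).trans ?_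
    exact add_le_add_left (setIntegral_le_integral hpj hpj0) η
  · have h1 : ENNReal.ofReal (∫ t, p t * j t) ≤ ENNReal.ofReal (-(F z).im) := by
      rw [ofReal_integral_eq_lintegral_ofReal hpj hpj0]
      calc ∫⁻ t, ENNReal.ofReal (p t * j t)
          = ∫⁻ t, liminf (fun k => ENNReal.ofReal (p t * n k t)) atTop := by
            refine lintegral_congr_ae ?_
            filter_upwards [hnj] with t ht
            exact ((ENNReal.continuous_ofReal.tendsto _).comp (ht.const_mul _)).liminf_eq.symm
        _ ≤ liminf (fun k => ∫⁻ t, ENNReal.ofReal (p t * n k t)) atTop :=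
            lintegral_liminf_le fun k => ENNReal.measurable_ofReal.comp (hpc.mul (hnc k)).measurable
        _ = ENNReal.ofReal (-(F z).im) := by
            have : ∀ k, ∫⁻ t, ENNReal.ofReal (p t * n k t) =
                ENNReal.ofReal (-(F (z + e k * Complex.I)).im) := fun k => by
              rw [← ofReal_integral_eq_lintegral_ofReal (hpn k).1
                (ae_of_all _ fun t => mul_nonneg (hp0 t) (hn0 k t)), (hpn k).2]
            simp_rw [this]
            exact ((ENNReal.continuous_ofReal.tendsto _).comp hFz).liminf_eq
    exact (ENNReal.ofReal_le_ofReal_iff (neg_nonneg.2 (hneg z hz))).1 h1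

end Herglotz

/-- A holomorphic function on the upper half-plane with vanishing imaginary part is constant. -/
theorem exists_eq_real_of_im_eq_zero {G : ℂ → ℂ} (hG : DifferentiableOn ℂ G {z | 0 < z.im})
    (him : ∀ z : ℂ, 0 < z.im → (G z).im = 0) : ∃ a : ℝ, ∀ z : ℂ, 0 < z.im → G z = a := by
  have hd : Set.EqOn (deriv G) 0 {z | 0 < z.im} := by
    intro z hz
    have hz : 0 < z.im := hz
    have hdz := (hG.differentiableAt (isOpen_im_pos.mem_nhds hz)).hasDerivAt
    -- Differentiation of `Im G = 0` along the direction `v`; the choices `1` and `i` annihilate the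
    -- imaginary and the real part of the derivative.
    have key : ∀ v : ℂ, 0 ≤ v.im → (v * deriv G z).im = 0 := by
      intro v hv
      have h1 : HasDerivAt (fun s : ℝ => z + s * v) v 0 := by
        have := (((hasDerivAt_id (0:ℝ)).ofReal_comp).mul_const v).const_add z
        simpa using this
      have hdz' : HasDerivAt G (deriv G z) (z + (0:ℝ) * v) := by simpa using hdz
      have h2 := hdz'.scomp (0:ℝ) h1
      have h3 : HasDerivAt (fun s : ℝ => (G (z + s * v)).im) (v * deriv G z).im 0 := by
        have := (Complex.imCLM.hasFDerivAt.comp_hasDerivAt (0:ℝ) h2)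
        simpa [Function.comp_def] using this
      have h4 : (fun s : ℝ => (G (z + s * v)).im) =ᶠ[𝓝 0] fun _ => 0 := by
        have hc : ContinuousAt (fun s : ℝ => z + s * v) 0 := h1.continuousAt
        have : {z : ℂ | 0 < z.im} ∈ 𝓝 (z + (0:ℝ) * v) :=
          isOpen_im_pos.mem_nhds (by simpa using hz)
        filter_upwards [hc this] with s hs using him _ hs
      exact (h3.congr_of_eventuallyEq h4.symm).unique (hasDerivAt_const _ _) 
    have k1 := key 1 (by simp)
    have k2 := key Complex.I (by simp)
    rw [one_mul] at k1
    simp at k2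
    exact Complex.ext k2 k1
  have hconv : IsPreconnected {z : ℂ | 0 < z.im} :=
    (convex_halfSpace_im_gt 0).isPreconnected
  obtain ⟨c, hc⟩ := isOpen_im_pos.exists_is_const_of_deriv_eq_zero hconv hG hd
  refine ⟨c.re, fun z hz => ?_⟩
  rw [hc z hz]
  have := him z hz
  rw [hc z hz] at this
  exact Complex.ext (by simp) (by simpa using this)

/-! ## Orthogonal polynomials -/

namespace OP

/-- A measure with finite moments that is positive definite on polynomials. -/
structure Good (μ : Measure ℝ) : Prop where
  integrable_pow : ∀ n : ℕ, Integrable (fun x : ℝ => x ^ n) μ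
  pos : ∀ p : ℝ[X], p ≠ 0 → 0 < ∫ x, p.eval x * p.eval x ∂μ

/-- The moment functional `p ↦ ∫ p dμ`. -/
noncomputable def mom (μ : Measure ℝ) (p : ℝ[X]) : ℝ := ∫ x, p.eval x ∂μ

theorem polyInner_eq (μ : Measure ℝ) (u v : ℝ[X]) : polyInner μ u v = mom μ (u * v) := by
  simp [polyInner, mom]

variable {μ : Measure ℝ}

theorem degree_lt_succ_iff {p : ℝ[X]} {k : ℕ} :
    p.degree < ((k + 1 : ℕ) : WithBot ℕ) ↔ p.natDegree ≤ k := by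
  rcases eq_or_ne p 0 with rfl | hp
  · simp
  rw [degree_eq_natDegree hp, ← Nat.lt_succ_iff]
  exact_mod_cast Iff.rfl

theorem degree_lt_zero_iff {p : ℝ[X]} : p.degree < ((0 : ℕ) : WithBot ℕ) ↔ p = 0 := by
  rw [← degree_eq_bot]
  exact Nat.WithBot.lt_zero_iff

theorem degree_C_mul_le (a : ℝ) (p : ℝ[X]) : (C a * p).degree ≤ p.degree := by
  rw [← smul_eq_C_mul]
  exact degree_smul_le _ _

theorem Good.integrable_eval (hμ : Good μ) (p : ℝ[X]) : Integrable (fun x => p.eval x) μ := by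
  simp_rw [eval_eq_sum_range]
  exact integrable_finsetSum _ fun i _ => (hμ.integrable_pow i).const_mul _

theorem Good.mom_add (hμ : Good μ) (p q : ℝ[X]) : mom μ (p + q) = mom μ p + mom μ q := by
  simp only [mom, eval_add]
  exact integral_add (hμ.integrable_eval p) (hμ.integrable_eval q)

theorem Good.mom_sub (hμ : Good μ) (p q : ℝ[X]) : mom μ (p - q) = mom μ p - mom μ q := by
  simp only [mom, eval_sub]
  exact integral_sub (hμ.integrable_eval p) (hμ.integrable_eval q)

theorem mom_C_mul (a : ℝ) (p : ℝ[X]) : mom μ (C a * p) = a * mom μ p := by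
  simp only [mom, eval_mul, eval_C]
  exact integral_const_mul _ _

theorem Good.mom_sum (hμ : Good μ) {ι : Type*} (s : Finset ι) (p : ι → ℝ[X]) :
    mom μ (∑ i ∈ s, p i) = ∑ i ∈ s, mom μ (p i) := by
  simp only [mom, eval_finsetSum]
  exact integral_finsetSum _ fun i _ => hμ.integrable_eval _

theorem monicPoly_eq (μ : Measure ℝ) (n : ℕ) : monicPoly μ n = X ^ n - ∑ j : Fin n,
    C (polyInner μ (X ^ n) (monicPoly μ j) / polyInner μ (monicPoly μ j) (monicPoly μ j)) *
      monicPoly μ j := by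
  rw [monicPoly]

theorem monicPoly_monic_natDegree (μ : Measure ℝ) (n : ℕ) :
    (monicPoly μ n).Monic ∧ (monicPoly μ n).natDegree = n := by
  induction n using Nat.strong_induction_on with
  | _ n ih =>
    have hd : (∑ j : Fin n, C (polyInner μ (X ^ n) (monicPoly μ j) /
        polyInner μ (monicPoly μ j) (monicPoly μ j)) * monicPoly μ j).degree < (n : WithBot ℕ) := by
      rw [← mem_degreeLT]
      refine Submodule.sum_mem _ fun j _ => ?_
      rw [← smul_eq_C_mul]
      refine Submodule.smul_mem _ _ (mem_degreeLT.2 ?_)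
      rw [degree_eq_natDegree (ih j j.2).1.ne_zero, (ih j j.2).2]
      exact_mod_cast j.2
    rcases n.eq_zero_or_pos with rfl | hn
    · rw [monicPoly_eq]; simp
    rw [monicPoly_eq]
    have hX : (X ^ n : ℝ[X]).degree = n := degree_X_pow n
    refine ⟨(monic_X_pow n).sub_of_left (by rwa [hX]), ?_⟩
    rw [natDegree_sub_eq_left_of_natDegree_lt, natDegree_X_pow]
    rw [natDegree_X_pow]
    obtain ⟨m, rfl⟩ : ∃ m, n = m + 1 := ⟨n - 1, by omega⟩
    exact Nat.lt_succ_of_le (degree_lt_succ_iff.1 hd)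

theorem monicPoly_monic (μ : Measure ℝ) (n : ℕ) : (monicPoly μ n).Monic :=
  (monicPoly_monic_natDegree μ n).1

theorem natDegree_monicPoly (μ : Measure ℝ) (n : ℕ) : (monicPoly μ n).natDegree = n :=
  (monicPoly_monic_natDegree μ n).2

theorem degree_monicPoly (μ : Measure ℝ) (n : ℕ) : (monicPoly μ n).degree = n := by
  rw [degree_eq_natDegree (monicPoly_monic μ n).ne_zero, natDegree_monicPoly]

theorem Good.normSq_pos (hμ : Good μ) (n : ℕ) : 0 < normSq μ n := hμ.pos _ (monicPoly_monic μ n).ne_zero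

theorem mom_monicPoly_sq (n : ℕ) : mom μ (monicPoly μ n * monicPoly μ n) = normSq μ n :=
  (polyInner_eq _ _ _).symm

theorem Good.mom_monicPoly_mul_monicPoly (hμ : Good μ) {n j : ℕ} (hj : j < n) :
    mom μ (monicPoly μ n * monicPoly μ j) = 0 := by
  induction n using Nat.strong_induction_on generalizing j with
  | _ n ih =>
    rw [monicPoly_eq, sub_mul, hμ.mom_sub, Finset.sum_mul, hμ.mom_sum,
      Finset.sum_eq_single (⟨j, hj⟩ : Fin n)]
    · have := (hμ.normSq_pos j).ne'
      simp only [mul_assoc, mom_C_mul, polyInner_eq, mom_monicPoly_sq]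
      rw [div_mul_cancel₀ _ this, sub_self]
    · intro i _ hij
      rw [mul_assoc, mom_C_mul]
      have hne : (i : ℕ) ≠ j := fun h => hij (Fin.ext h)
      rcases lt_or_gt_of_ne hne with h | h
      · rw [mul_comm (monicPoly μ i), ih j hj h, mul_zero]
      · rw [ih i i.2 h, mul_zero]
    · intro h; exact absurd (Finset.mem_univ _) h

theorem Good.mom_monicPoly_mul (hμ : Good μ) {n : ℕ} {p : ℝ[X]} (hp : p.degree < n) :
    mom μ (monicPoly μ n * p) = 0 := by
  have key : ∀ k ≤ n, ∀ p : ℝ[X], p.degree < k → mom μ (monicPoly μ n * p) = 0 := by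
    intro k
    induction k with
    | zero =>
      intro _ p hp
      have : p = 0 := degree_lt_zero_iff.1 hp
      simp [this, mom]
    | succ k ih =>
      intro hk p hp
      have hpm : p.natDegree ≤ k := degree_lt_succ_iff.1 hp
      have h1 : (p - C (p.coeff k) * monicPoly μ k).degree < k := by
        rw [degree_lt_iff_coeff_zero]
        intro m hm
        rw [coeff_sub, coeff_C_mul]
        rcases hm.eq_or_lt with rfl | hm
        · have := (monicPoly_monic μ k).coeff_natDegree
          rw [natDegree_monicPoly] at this
          rw [this, mul_one, sub_self]
        · rw [coeff_eq_zero_of_natDegree_lt (p := p) (hpm.trans_lt hm),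
            coeff_eq_zero_of_natDegree_lt (p := monicPoly μ _) (by rwa [natDegree_monicPoly]), mul_zero, sub_self]
      have h2 := ih (by omega) _ h1
      rw [mul_sub, hμ.mom_sub, mul_left_comm, mom_C_mul,
        hμ.mom_monicPoly_mul_monicPoly (by omega : k < n), mul_zero, sub_zero] at h2
      exact h2
  exact key n le_rfl p hp

/-! ### The orthonormal polynomials -/

theorem orthonormalPoly_def (n : ℕ) :
    orthonormalPoly μ n = C (1 / √(normSq μ n)) * monicPoly μ n := rfl

theorem Good.degree_orthonormalPoly (hμ : Good μ) (n : ℕ) : (orthonormalPoly μ n).degree = n := by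
  have := Real.sqrt_pos.2 (hμ.normSq_pos n)
  rw [orthonormalPoly_def, degree_C_mul (by positivity), degree_monicPoly]

theorem Good.natDegree_orthonormalPoly (hμ : Good μ) (n : ℕ) : (orthonormalPoly μ n).natDegree = n :=
  natDegree_eq_of_degree_eq_some (hμ.degree_orthonormalPoly n)

theorem Good.orthonormalPoly_ne_zero (hμ : Good μ) (n : ℕ) : orthonormalPoly μ n ≠ 0 := by
  intro h
  have := hμ.degree_orthonormalPoly n
  rw [h, degree_zero] at this
  exact absurd this.symm (WithBot.coe_ne_bot)

theorem Good.mom_orthonormalPoly_mul (hμ : Good μ) {n : ℕ} {p : ℝ[X]} (hp : p.degree < n) :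
    mom μ (orthonormalPoly μ n * p) = 0 := by
  rw [orthonormalPoly_def, mul_assoc, mom_C_mul, hμ.mom_monicPoly_mul hp, mul_zero]

theorem Good.mom_orthonormalPoly_sq (hμ : Good μ) (n : ℕ) :
    mom μ (orthonormalPoly μ n * orthonormalPoly μ n) = 1 := by
  rw [orthonormalPoly_def, mul_mul_mul_comm, ← C_mul, mom_C_mul, mom_monicPoly_sq]
  have h := hμ.normSq_pos n
  rw [div_mul_div_comm, one_mul, Real.mul_self_sqrt h.le]
  field_simp

theorem Good.mom_orthonormalPoly_mul_orthonormalPoly (hμ : Good μ) (m n : ℕ) :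
    mom μ (orthonormalPoly μ m * orthonormalPoly μ n) = if m = n then 1 else 0 := by
  split_ifs with h
  · rw [h, hμ.mom_orthonormalPoly_sq]
  · rcases lt_or_gt_of_ne h with h | h
    · rw [mul_comm]
      exact hμ.mom_orthonormalPoly_mul (by rw [hμ.degree_orthonormalPoly]; exact_mod_cast h)
    · exact hμ.mom_orthonormalPoly_mul (by rw [hμ.degree_orthonormalPoly]; exact_mod_cast h)

theorem Good.beta_pos (hμ : Good μ) (n : ℕ) : 0 < beta μ n := by
  cases n with
  | zero => exact hμ.normSq_pos 0
  | succ n => exact div_pos (hμ.normSq_pos _) (hμ.normSq_pos _)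

theorem degree_X_mul_monicPoly_sub_lt (n : ℕ) :
    (X * monicPoly μ n - monicPoly μ (n + 1)).degree < ((n + 1 : ℕ) : WithBot ℕ) := by
  have h1 : (X * monicPoly μ n).Monic := monic_X.mul (monicPoly_monic μ n)
  have h2 : (X * monicPoly μ n).degree = ((n + 1 : ℕ) : WithBot ℕ) := by
    rw [degree_mul, degree_X, degree_monicPoly]
    push_cast
    rw [add_comm]
  have := degree_sub_lt_left (h2.trans (degree_monicPoly μ (n + 1)).symm) h1.ne_zero
    (h1.trans (monicPoly_monic μ (n + 1)).symm)
  rwa [h2] at this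

/-- Testing against `r` itself contradicts positive definiteness. Recurrences follow by applying
this to the difference of their two sides. -/
theorem Good.eq_zero_of_mom_mul_eq_zero (hμ : Good μ) {n : ℕ} {r : ℝ[X]} (hr : r.degree < (n + 1 : ℕ))
    (h : ∀ p : ℝ[X], p.degree < (n + 1 : ℕ) → mom μ (r * p) = 0) : r = 0 := by
  by_contra hne
  have h1 := hμ.pos r hne
  have h2 := h r hr
  simp only [mom, eval_mul] at h2
  linarith

theorem Good.mom_X_mul_monicPoly_mul (hμ : Good μ) (n : ℕ) :
    mom μ (monicPoly μ (n + 1) * (X * monicPoly μ n)) = normSq μ (n + 1) := by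
  have : X * monicPoly μ n = monicPoly μ (n + 1) + (X * monicPoly μ n - monicPoly μ (n + 1)) := by
    ring
  rw [this, mul_add, hμ.mom_add, mom_monicPoly_sq,
    hμ.mom_monicPoly_mul (degree_X_mul_monicPoly_sub_lt n), add_zero]

theorem exists_degree_lt_add_C_mul_monicPoly {n : ℕ} {p : ℝ[X]} (hp : p.degree < (n + 1 : ℕ)) :
    ∃ (a : ℝ) (q : ℝ[X]), q.degree < n ∧ p = C a * monicPoly μ n + q := by
  refine ⟨p.coeff n, p - C (p.coeff n) * monicPoly μ n, ?_, by ring⟩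
  have hpm : p.natDegree ≤ n := degree_lt_succ_iff.1 hp
  rw [degree_lt_iff_coeff_zero]
  intro m hm
  rw [coeff_sub, coeff_C_mul]
  rcases hm.eq_or_lt with rfl | hm
  · have := (monicPoly_monic μ n).coeff_natDegree
    rw [natDegree_monicPoly] at this
    rw [this, mul_one, sub_self]
  · rw [coeff_eq_zero_of_natDegree_lt (p := p) (hpm.trans_lt hm),
      coeff_eq_zero_of_natDegree_lt (p := monicPoly μ _) (by rwa [natDegree_monicPoly]), mul_zero, sub_self]

theorem Good.monic_recurrence_zero (hμ : Good μ) :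
    X * monicPoly μ 0 = monicPoly μ 1 + C (alpha μ 0) * monicPoly μ 0 := by
  rw [← sub_eq_zero]
  refine hμ.eq_zero_of_mom_mul_eq_zero (n := 0) ?_ ?_
  · rw [← sub_sub]
    refine (degree_sub_le _ _).trans_lt (max_lt (degree_X_mul_monicPoly_sub_lt 0) ?_)
    refine (degree_C_mul_le _ _).trans_lt ?_
    rw [degree_monicPoly]; exact_mod_cast zero_lt_one
  · intro p hp
    obtain ⟨a, q, hq, rfl⟩ := exists_degree_lt_add_C_mul_monicPoly (μ := μ) hp
    have hq0 : q = 0 := degree_lt_zero_iff.1 hq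
    rw [hq0, add_zero, mul_left_comm, mom_C_mul, sub_mul, hμ.mom_sub, add_mul, hμ.mom_add,
      hμ.mom_monicPoly_mul_monicPoly zero_lt_one, mul_assoc (C _), mom_C_mul, mom_monicPoly_sq,
      alpha, polyInner_eq]
    have := (hμ.normSq_pos 0).ne'
    field_simp
    ring

/-- The difference of the two sides has degree at most `n + 1` and is tested against `π_{n+1}`,
`π_n` and lower degrees. The first two tests identify `α` and `β`, the latter through `⟨π_{n+1}, x
π_n⟩ = ⟨π_{n+1}, π_{n+1}⟩`; lower degrees give zero because `x` can be moved to the other factor and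
raises the degree only by one. -/
theorem Good.monic_recurrence (hμ : Good μ) (n : ℕ) :
    X * monicPoly μ (n + 1) = monicPoly μ (n + 2) + C (alpha μ (n + 1)) * monicPoly μ (n + 1) +
      C (beta μ (n + 1)) * monicPoly μ n := by
  rw [← sub_eq_zero]
  refine hμ.eq_zero_of_mom_mul_eq_zero (n := n + 1) ?_ ?_
  · rw [← sub_sub, ← sub_sub]
    refine (degree_sub_le _ _).trans_lt (max_lt ((degree_sub_le _ _).trans_lt
      (max_lt (degree_X_mul_monicPoly_sub_lt (n + 1)) ?_)) ?_)
    · refine (degree_C_mul_le _ _).trans_lt ?_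
      rw [degree_monicPoly]; exact_mod_cast Nat.lt_succ_self _
    · refine (degree_C_mul_le _ _).trans_lt ?_
      rw [degree_monicPoly]; exact_mod_cast (by omega : n < n + 1 + 1)
  · intro p hp
    obtain ⟨a, p, hp', rfl⟩ := exists_degree_lt_add_C_mul_monicPoly (μ := μ) hp
    obtain ⟨b, q, hq, rfl⟩ := exists_degree_lt_add_C_mul_monicPoly (μ := μ) hp'
    have hN0 := (hμ.normSq_pos n).ne'
    have hN1 := (hμ.normSq_pos (n + 1)).ne'
    have hq1 : q.degree < (n + 1 : ℕ) := hq.trans (by exact_mod_cast Nat.lt_succ_self n)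
    have hq2 : q.degree < (n + 2 : ℕ) := hq.trans (by exact_mod_cast (by omega : n < n + 2))
    have hXq : (X * q).degree < ((n + 1 : ℕ) : WithBot ℕ) := by
      rcases eq_or_ne q 0 with rfl | hq0
      · simp
      rw [degree_mul, degree_X, degree_eq_natDegree hq0]
      rw [degree_eq_natDegree hq0] at hq
      have : q.natDegree < n := by exact_mod_cast hq
      exact_mod_cast (by omega : 1 + q.natDegree < n + 1)
    have e1 : mom μ ((X * monicPoly μ (n + 1) - (monicPoly μ (n + 2) +
        C (alpha μ (n + 1)) * monicPoly μ (n + 1) + C (beta μ (n + 1)) * monicPoly μ n)) *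
          monicPoly μ (n + 1)) = 0 := by
      simp only [sub_mul, add_mul, hμ.mom_sub, hμ.mom_add, mul_assoc (C _), mom_C_mul]
      rw [hμ.mom_monicPoly_mul_monicPoly (by omega : n + 1 < n + 2), mom_monicPoly_sq,
        mul_comm (monicPoly μ n), hμ.mom_monicPoly_mul_monicPoly (by omega : n < n + 1),
        alpha, polyInner_eq]
      field_simp
      ring
    have e2 : mom μ ((X * monicPoly μ (n + 1) - (monicPoly μ (n + 2) +
        C (alpha μ (n + 1)) * monicPoly μ (n + 1) + C (beta μ (n + 1)) * monicPoly μ n)) *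
          monicPoly μ n) = 0 := by
      simp only [sub_mul, add_mul, hμ.mom_sub, hμ.mom_add, mul_assoc (C _), mom_C_mul]
      rw [hμ.mom_monicPoly_mul_monicPoly (by omega : n < n + 2), mom_monicPoly_sq,
        hμ.mom_monicPoly_mul_monicPoly (by omega : n < n + 1), beta,
        mul_assoc, mul_left_comm, hμ.mom_X_mul_monicPoly_mul]
      field_simp
      ring
    have e3 : mom μ ((X * monicPoly μ (n + 1) - (monicPoly μ (n + 2) +
        C (alpha μ (n + 1)) * monicPoly μ (n + 1) + C (beta μ (n + 1)) * monicPoly μ n)) *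
          q) = 0 := by
      simp only [sub_mul, add_mul, hμ.mom_sub, hμ.mom_add, mul_assoc (C _), mom_C_mul]
      rw [hμ.mom_monicPoly_mul hq2, hμ.mom_monicPoly_mul hq1, hμ.mom_monicPoly_mul hq,
        mul_assoc, mul_left_comm, hμ.mom_monicPoly_mul hXq]
      ring
    rw [mul_add, mul_add, mul_left_comm, mul_left_comm _ (C b), hμ.mom_add, hμ.mom_add,
      mom_C_mul, mom_C_mul, e1, e2, e3]
    ring

theorem Good.sqrt_beta_mul (hμ : Good μ) (n : ℕ) :
    √(beta μ (n + 1)) * (1 / √(normSq μ (n + 1))) = 1 / √(normSq μ n) := by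
  rw [beta, Real.sqrt_div (hμ.normSq_pos _).le]
  have := Real.sqrt_pos.2 (hμ.normSq_pos (n + 1))
  field_simp

theorem Good.recurrence_zero (hμ : Good μ) :
    X * orthonormalPoly μ 0 = C √(beta μ 1) * orthonormalPoly μ 1 +
      C (alpha μ 0) * orthonormalPoly μ 0 := by
  simp only [orthonormalPoly_def]
  rw [← mul_assoc (C √(beta μ 1)), ← C_mul, hμ.sqrt_beta_mul, mul_left_comm,
    hμ.monic_recurrence_zero]
  ring

theorem Good.recurrence (hμ : Good μ) (n : ℕ) :
    X * orthonormalPoly μ (n + 1) = C √(beta μ (n + 2)) * orthonormalPoly μ (n + 2) +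
      C (alpha μ (n + 1)) * orthonormalPoly μ (n + 1) +
        C √(beta μ (n + 1)) * orthonormalPoly μ n := by
  simp only [orthonormalPoly_def]
  have h1 : √(beta μ (n + 1)) * (1 / √(normSq μ n)) =
      1 / √(normSq μ (n + 1)) * beta μ (n + 1) := by
    have h := hμ.sqrt_beta_mul n
    rw [← h]
    nth_rewrite 3 [← Real.mul_self_sqrt (hμ.beta_pos (n + 1)).le]
    ring
  rw [← mul_assoc (C √(beta μ (n + 2))), ← C_mul, hμ.sqrt_beta_mul,
    ← mul_assoc (C √(beta μ (n + 1))), ← C_mul, h1, mul_left_comm, hμ.monic_recurrence, C_mul]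
  ring

/-! ### Secondary polynomials -/

/-- The polynomial `x ↦ ∫ (p(t) - p(x)) / (t - x) dμ(t)`. -/
noncomputable def sec (μ : Measure ℝ) : ℝ[X] →ₗ[ℝ] ℝ[X] :=
  Polynomial.lsum fun k => (LinearMap.toSpanSingleton ℝ ℝ[X]
    (∑ i ∈ Finset.range k, C (mom μ (X ^ i)) * X ^ (k - 1 - i)))

theorem sec_monomial (k : ℕ) (a : ℝ) : sec μ (monomial k a) =
    a • ∑ i ∈ Finset.range k, C (mom μ (X ^ i)) * X ^ (k - 1 - i) := by
  simp [sec, Polynomial.lsum_apply, sum_monomial_index]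

theorem sec_C (a : ℝ) : sec μ (C a) = 0 := by
  rw [← monomial_zero_left, sec_monomial]; simp

/-- Integrated form of `(t p(t) - x p(x)) / (t - x) = p(t) + x (p(t) - p(x)) / (t - x)`. -/
theorem Good.sec_X_mul (hμ : Good μ) (p : ℝ[X]) : sec μ (X * p) = C (mom μ p) + X * sec μ p := by
  induction p using Polynomial.induction_on' with
  | add p q hp hq => rw [mul_add, map_add, hp, hq, map_add, hμ.mom_add, C_add]; ring
  | monomial k a =>
    rw [X_mul_monomial, sec_monomial, sec_monomial, Finset.sum_range_succ, smul_add, add_comm]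
    congr 1
    · rw [← C_mul_X_pow_eq_monomial, mom_C_mul, C_mul]
      simp [smul_eq_C_mul]
    · rw [mul_smul_comm, Finset.mul_sum]
      congr 1
      refine Finset.sum_congr rfl fun i hi => ?_
      have hi := Finset.mem_range.1 hi
      rw [mul_left_comm, ← pow_succ']
      congr 2
      omega

/-- In `p(t) w(t) - p(x) w(x) = p(x) (w(t) - w(x)) + (p(t) - p(x)) w(t)` the last term, divided by
`t - x`, is `w` times a polynomial of degree below `k` in `t`, and integrates to zero. The induction
peels off one factor `X` at a time. -/
theorem Good.sec_mul (hμ : Good μ) {w : ℝ[X]} {k : ℕ} (hw : ∀ q : ℝ[X], q.degree < k → mom μ (q * w) = 0)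
    {p : ℝ[X]} (hp : p.natDegree ≤ k) : sec μ (p * w) = p * sec μ w := by
  have key : ∀ m ≤ k, ∀ p : ℝ[X], p.natDegree ≤ m → sec μ (p * w) = p * sec μ w := by
    intro m
    induction m with
    | zero =>
      intro _ p hp
      rw [eq_C_of_natDegree_le_zero hp, ← smul_eq_C_mul, map_smul, smul_eq_C_mul]
    | succ m ih =>
      intro hm p hp
      have hd : p.divX.natDegree ≤ m := by rw [natDegree_divX_eq_natDegree_tsub_one]; omega
      rw [← p.divX_mul_X_add, add_mul, map_add, ← smul_eq_C_mul, map_smul, smul_eq_C_mul,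
        mul_comm p.divX, mul_assoc, hμ.sec_X_mul, ih (by omega) _ hd, hw p.divX]
      · rw [C_0]; ring
      · refine (degree_le_natDegree).trans_lt ?_
        exact_mod_cast (by omega : p.divX.natDegree < k)
  exact key k le_rfl p hp

/-- The Liouville-Ostrogradsky identity for monic orthogonal polynomials. -/
theorem Good.ostrogradsky_monic (hμ : Good μ) (n : ℕ) :
    monicPoly μ n * sec μ (monicPoly μ (n + 1)) - monicPoly μ (n + 1) * sec μ (monicPoly μ n) =
      C (normSq μ n) := by
  -- The secondary polynomial of `π_n π_{n+1}` is computed twice. Extracting `π_n` is exact;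
  -- extracting `π_{n+1}` from beside `π_n` exceeds the orthogonality by one degree and leaves `⟨q,
  -- π_n⟩`, where `q` is monic of degree `n`, hence `⟨π_n, π_n⟩`.
  have h1 : sec μ (monicPoly μ n * monicPoly μ (n + 1)) =
      monicPoly μ n * sec μ (monicPoly μ (n + 1)) :=
    hμ.sec_mul (k := n + 1) (fun q hq => by rw [mul_comm]; exact hμ.mom_monicPoly_mul hq)
      (by rw [natDegree_monicPoly]; omega)
  set q := (monicPoly μ (n + 1)).divX with hq
  have hqd : q.natDegree = n := by
    rw [hq, natDegree_divX_eq_natDegree_tsub_one, natDegree_monicPoly]; rfl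
  have hqm : q.Monic := by
    rw [Monic, leadingCoeff, hqd, hq, coeff_divX]
    have := (monicPoly_monic μ (n + 1)).coeff_natDegree
    rwa [natDegree_monicPoly] at this
  have hm : mom μ (q * monicPoly μ n) = normSq μ n := by
    have hlt : (q - monicPoly μ n).degree < n := by
      have hdq : q.degree = n := by rw [degree_eq_natDegree hqm.ne_zero, hqd]
      have := degree_sub_lt_left (hdq.trans (degree_monicPoly μ n).symm) hqm.ne_zero
        (hqm.trans (monicPoly_monic μ n).symm)
      rwa [hdq] at this
    have e : q * monicPoly μ n = monicPoly μ n * monicPoly μ n +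
      monicPoly μ n * (q - monicPoly μ n) := by ring
    rw [e, hμ.mom_add, mom_monicPoly_sq, hμ.mom_monicPoly_mul hlt, add_zero]
  have h2 : sec μ (monicPoly μ (n + 1) * monicPoly μ n) =
      monicPoly μ (n + 1) * sec μ (monicPoly μ n) + C (normSq μ n) := by
    conv_lhs => rw [← (monicPoly μ (n + 1)).divX_mul_X_add]
    rw [← hq, add_mul, map_add, ← smul_eq_C_mul, map_smul, smul_eq_C_mul, mul_comm q, mul_assoc,
      hμ.sec_X_mul, hm, hμ.sec_mul (k := n) (fun r hr => by
        rw [mul_comm]; exact hμ.mom_monicPoly_mul hr) hqd.le]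
    conv_rhs => rw [← (monicPoly μ (n + 1)).divX_mul_X_add, ← hq]
    ring
  rw [mul_comm] at h1
  rw [← h1, h2]; ring

/-- The vector `√β_{n+1} P_{n+1}`. -/
noncomputable def nextPoly (μ : Measure ℝ) (n : ℕ) : ℝ[X] :=
  C √(beta μ (n + 1)) * orthonormalPoly μ (n + 1)

theorem Good.ostrogradsky (hμ : Good μ) (n : ℕ) :
    orthonormalPoly μ n * sec μ (nextPoly μ n) - nextPoly μ n * sec μ (orthonormalPoly μ n) = 1 := by
  have h1 : nextPoly μ n = (1 / √(normSq μ n)) • monicPoly μ (n + 1) := by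
    rw [nextPoly, orthonormalPoly_def, ← mul_assoc, ← C_mul, hμ.sqrt_beta_mul, smul_eq_C_mul]
  have h2 : orthonormalPoly μ n = (1 / √(normSq μ n)) • monicPoly μ n := by
    rw [orthonormalPoly_def, smul_eq_C_mul]
  rw [h1, h2, map_smul, map_smul, smul_mul_smul_comm, smul_mul_smul_comm, ← smul_sub,
    hμ.ostrogradsky_monic, smul_C, ← C_1]
  congr 1
  have h := hμ.normSq_pos n
  rw [div_mul_div_comm, one_mul, Real.mul_self_sqrt h.le, smul_eq_mul]
  field_simp

theorem Good.mom_nextPoly_mul (hμ : Good μ) {n : ℕ} {p : ℝ[X]} (hp : p.degree < (n + 1 : ℕ)) :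
    mom μ (nextPoly μ n * p) = 0 := by
  rw [nextPoly, mul_assoc, mom_C_mul, hμ.mom_orthonormalPoly_mul hp, mul_zero]

theorem Good.natDegree_nextPoly_le (hμ : Good μ) (n : ℕ) : (nextPoly μ n).natDegree ≤ n + 1 := by
  rw [nextPoly]
  exact (natDegree_C_mul_le _ _).trans (hμ.natDegree_orthonormalPoly _).le

/-- By the recurrence, `nextPoly μ n` is the part of `x P_n` that leaves the polynomials of degree
at most `n`: the vector through which the first `n + 1` chain sites couple to the rest. -/
theorem Good.natDegree_X_mul_sub_nextPoly_le (hμ : Good μ) (n : ℕ) :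
    (X * orthonormalPoly μ n - nextPoly μ n).natDegree ≤ n := by
  have hd : ∀ (a : ℝ) (k : ℕ), k ≤ n → (C a * orthonormalPoly μ k).natDegree ≤ n := fun a k hk =>
    (natDegree_C_mul_le _ _).trans ((hμ.natDegree_orthonormalPoly k).le.trans hk)
  cases n with
  | zero =>
    rw [hμ.recurrence_zero, nextPoly, add_sub_cancel_left]
    exact hd _ _ le_rfl
  | succ n =>
    rw [hμ.recurrence, nextPoly, add_assoc, add_sub_cancel_left]
    exact natDegree_add_le_of_degree_le (hd _ _ le_rfl) (hd _ _ (Nat.le_succ n))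

theorem mul_div_sub_eq (z : ℂ) {t : ℝ} (ht : (t : ℂ) - z ≠ 0) (p : ℝ[X]) :
    (((X * p).eval t : ℝ) - aeval z (X * p)) / ((t : ℂ) - z) =
      ((p.eval t : ℝ) : ℂ) + z * (((p.eval t : ℝ) - aeval z p) / ((t : ℂ) - z)) := by
  simp only [eval_mul, eval_X, map_mul, aeval_X, Complex.ofReal_mul]
  field_simp
  ring

theorem Good.integral_div_sub (hμ : Good μ) {z : ℂ} (hz : ∀ᵐ t : ℝ ∂μ, (t : ℂ) - z ≠ 0) (p : ℝ[X]) :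
    Integrable (fun t : ℝ => ((p.eval t : ℝ) - aeval z p) / ((t : ℂ) - z)) μ ∧
      ∫ t : ℝ, ((p.eval t : ℝ) - aeval z p) / ((t : ℂ) - z) ∂μ = aeval z (sec μ p) := by
  induction p using Polynomial.induction_on with
  | C a => simp [sec_C]
  | add p q hp hq =>
    have e : ∀ t : ℝ, (((p + q).eval t : ℝ) - aeval z (p + q)) / ((t : ℂ) - z) =
        ((p.eval t : ℝ) - aeval z p) / ((t : ℂ) - z) +
          ((q.eval t : ℝ) - aeval z q) / ((t : ℂ) - z) := fun t => by
      rw [← add_div, eval_add, map_add]; push_cast; ring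
    simp_rw [e]
    refine ⟨hp.1.add hq.1, ?_⟩
    rw [integral_add hp.1 hq.1, hp.2, hq.2, map_add, map_add]
  | monomial k a ih =>
    have e0 : C a * X ^ (k + 1) = X * (C a * X ^ k : ℝ[X]) := by ring
    rw [e0]
    set p : ℝ[X] := C a * X ^ k
    have e : (fun t : ℝ => (((X * p).eval t : ℝ) - aeval z (X * p)) / ((t : ℂ) - z)) =ᵐ[μ]
        fun t : ℝ => ((p.eval t : ℝ) : ℂ) + z * (((p.eval t : ℝ) - aeval z p) / ((t : ℂ) - z)) := by
      filter_upwards [hz] with t ht using mul_div_sub_eq z ht p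
    have hpi : Integrable (fun t : ℝ => ((p.eval t : ℝ) : ℂ)) μ := (hμ.integrable_eval p).ofReal
    refine ⟨(hpi.add (ih.1.const_mul z)).congr e.symm, ?_⟩
    rw [integral_congr_ae e, integral_add hpi (ih.1.const_mul z), integral_const_mul, ih.2,
      integral_complex_ofReal, hμ.sec_X_mul]
    simp [mom]

/-- At `t = x` the integrand of `secondaryPoly` has the value `0 / 0 = 0` instead of the derivative;
the measure does not charge this point. -/
theorem Good.secondaryPoly_eq (hμ : Good μ) [NullSingletonClass μ] (n : ℕ) (x : ℝ) :
    secondaryPoly μ n x = (sec μ (orthonormalPoly μ n)).eval x := by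
  have hz : ∀ᵐ t : ℝ ∂μ, (t : ℂ) - (x : ℂ) ≠ 0 := by
    have : ∀ᵐ t : ℝ ∂μ, t ≠ x := by rw [ae_iff]; simp
    filter_upwards [this] with t ht
    exact_mod_cast sub_ne_zero.2 ht
  have h := (hμ.integral_div_sub hz (orthonormalPoly μ n)).2
  have e : ∀ p : ℝ[X], aeval (x : ℂ) p = ((p.eval x : ℝ) : ℂ) := fun p => by
    rw [← Complex.coe_algebraMap, aeval_algebraMap_apply]; rfl
  simp_rw [e] at h
  apply Complex.ofReal_injective
  rw [← h, secondaryPoly, ← integral_complex_ofReal]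
  congr 1
  funext t
  push_cast
  rfl

/-! ### Functions of the second kind -/

/-- The function of the second kind `∫ w(t) / (z - t) dμ(t)` of a polynomial `w`. -/
noncomputable def secondKind (μ : Measure ℝ) (w : ℝ[X]) (z : ℂ) : ℂ :=
  cauchyTransform μ (fun t => ((w.eval t : ℝ) : ℂ)) z

theorem secondKind_one (μ : Measure ℝ) : secondKind μ 1 = stieltjes μ := by
  funext z; simp [secondKind, cauchyTransform, stieltjes]

theorem Good.integrable_ofReal_eval (hμ : Good μ) (w : ℝ[X]) : Integrable (fun t : ℝ => ((w.eval t : ℝ) : ℂ)) μ :=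
  (hμ.integrable_eval w).ofReal

theorem Good.secondKind_eq (hμ : Good μ) {z : ℂ} {δ : ℝ} (hδ : 0 < δ) (hz : ∀ᵐ t : ℝ ∂μ, δ ≤ ‖z - t‖)
    (w : ℝ[X]) : secondKind μ w z = aeval z w * stieltjes μ z - aeval z (sec μ w) := by
  have hne : ∀ᵐ t : ℝ ∂μ, (t : ℂ) - z ≠ 0 := by
    filter_upwards [hz] with t ht
    rw [← norm_pos_iff, norm_sub_rev]
    exact hδ.trans_le ht
  obtain ⟨h1, h2⟩ := hμ.integral_div_sub hne w
  have h3 : Integrable (fun t : ℝ => (1 : ℂ) / (z - t)) μ := by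
    refine integrable_div_sub_of_le (f := fun _ => (1:ℂ)) ?_ hδ hz
    simpa using hμ.integrable_ofReal_eval 1
  rw [← h2, stieltjes, secondKind, cauchyTransform, ← integral_const_mul,
    ← integral_sub (h3.const_mul _) h1]
  refine integral_congr_ae ?_
  filter_upwards [hne] with t ht
  have ht' : z - t ≠ 0 := by rw [← neg_sub]; exact neg_ne_zero.2 ht
  rw [← neg_sub z t, div_neg]
  field_simp
  ring

theorem Good.secondKind_eq_of_im (hμ : Good μ) {z : ℂ} (hz : z.im ≠ 0) (w : ℝ[X]) :
    secondKind μ w z = aeval z w * stieltjes μ z - aeval z (sec μ w) :=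
  hμ.secondKind_eq (abs_pos.2 hz) (ae_of_all _ fun t => abs_im_le_norm_sub_ofReal z t) w

theorem Good.secondKind_mul (hμ : Good μ) {z : ℂ} {δ : ℝ} (hδ : 0 < δ) (hz : ∀ᵐ t : ℝ ∂μ, δ ≤ ‖z - t‖)
    {w : ℝ[X]} {k : ℕ}
    (hw : ∀ q : ℝ[X], q.degree < k → mom μ (q * w) = 0) {p : ℝ[X]} (hp : p.natDegree ≤ k) :
    secondKind μ (p * w) z = aeval z p * secondKind μ w z := by
  rw [hμ.secondKind_eq hδ hz, hμ.secondKind_eq hδ hz, hμ.sec_mul hw hp, map_mul, map_mul]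
  ring

/-- The right side is the Cauchy transform of the positive measure `P_n² dμ`. Non-vanishing and
lower bounds for the function of the second kind are obtained from it. -/
theorem Good.mul_secondKind_orthonormalPoly (hμ : Good μ) {z : ℂ} {δ : ℝ} (hδ : 0 < δ)
    (hz : ∀ᵐ t : ℝ ∂μ, δ ≤ ‖z - t‖) (n : ℕ) :
    aeval z (orthonormalPoly μ n) * secondKind μ (orthonormalPoly μ n) z =
      secondKind μ (orthonormalPoly μ n * orthonormalPoly μ n) z :=
  (hμ.secondKind_mul hδ hz (k := n) (fun q hq => by
    rw [mul_comm]; exact hμ.mom_orthonormalPoly_mul hq) (hμ.natDegree_orthonormalPoly n).le).symm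

theorem inv_sub_im (z : ℂ) (t : ℝ) : (1 / (z - t)).im = -z.im / ‖z - t‖ ^ 2 := by
  rw [one_div, Complex.inv_im, Complex.normSq_eq_norm_sq]; simp

theorem Good.secondKind_im (hμ : Good μ) {z : ℂ} (hz : z.im ≠ 0) (w : ℝ[X]) :
    (secondKind μ w z).im = -z.im * ∫ t : ℝ, w.eval t / ‖z - t‖ ^ 2 ∂μ := by
  have hi := integrable_div_sub (hμ.integrable_ofReal_eval w) hz
  have h1 := integral_im hi
  simp only [RCLike.im_to_complex] at h1
  rw [secondKind, cauchyTransform, ← h1, ← integral_const_mul]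
  congr 1
  funext t
  rw [div_eq_mul_one_div, Complex.im_ofReal_mul, inv_sub_im]
  ring

theorem Good.integral_sq_div_pos (hμ : Good μ) {z : ℂ} (hz : z.im ≠ 0) {p : ℝ[X]} (hp : p ≠ 0) :
    0 < ∫ t : ℝ, (p * p).eval t / ‖z - t‖ ^ 2 ∂μ := by
  have hn : ∀ t : ℝ, 0 ≤ (p * p).eval t / ‖z - t‖ ^ 2 := fun t => by
    rw [eval_mul]; exact div_nonneg (mul_self_nonneg _) (by positivity)
  have hpos : ∀ t : ℝ, 0 < ‖z - t‖ := fun t => norm_pos_iff.2 (sub_ofReal_ne_zero hz t)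
  have hi : Integrable (fun t : ℝ => (p * p).eval t / ‖z - t‖ ^ 2) μ := by
    refine ((hμ.integrable_eval (p * p)).norm.div_const (|z.im| ^ 2)).mono' ?_
      (ae_of_all _ fun t => ?_)
    · simp_rw [div_eq_mul_inv]
      exact (hμ.integrable_eval _).1.mul (Measurable.aestronglyMeasurable (by fun_prop))
    · rw [norm_div, norm_pow, norm_norm]
      have := abs_im_le_norm_sub_ofReal z t
      have := abs_pos.2 hz
      gcongr
  refine (integral_nonneg hn).lt_of_ne fun h => ?_
  have h0 := (integral_eq_zero_iff_of_nonneg hn hi).1 h.symm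
  have h1 := hμ.pos p hp
  have h2 : ∫ x, p.eval x * p.eval x ∂μ = 0 := by
    rw [← integral_zero ℝ ℝ (μ := μ)]
    refine integral_congr_ae ?_
    filter_upwards [h0] with t ht
    have := (hpos t).ne'
    rw [Pi.zero_apply, div_eq_zero_iff] at ht
    rcases ht with h | h
    · simpa using h
    · exact absurd h (by positivity)
  linarith

theorem Good.secondKind_ne_zero (hμ : Good μ) {z : ℂ} (hz : z.im ≠ 0) (n : ℕ) :
    secondKind μ (orthonormalPoly μ n) z ≠ 0 := by
  intro h
  have h1 := hμ.mul_secondKind_orthonormalPoly (abs_pos.2 hz)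
    (ae_of_all _ fun t => abs_im_le_norm_sub_ofReal z t) n
  rw [h, mul_zero] at h1
  have h2 := hμ.secondKind_im hz (orthonormalPoly μ n * orthonormalPoly μ n)
  rw [← h1, Complex.zero_im] at h2
  have h3 := hμ.integral_sq_div_pos hz (hμ.orthonormalPoly_ne_zero n)
  exact mul_ne_zero (neg_ne_zero.2 hz) h3.ne' h2.symm

/-- The terms containing the Stieltjes transform cancel, and the polynomial identity `ostrogradsky`
evaluated at `z` remains. -/
theorem Good.secondKind_ostrogradsky (hμ : Good μ) {z : ℂ} (hz : z.im ≠ 0) (n : ℕ) :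
    secondKind μ (orthonormalPoly μ n) z * aeval z (nextPoly μ n) -
      secondKind μ (nextPoly μ n) z * aeval z (orthonormalPoly μ n) = 1 := by
  have h := congrArg (aeval z) (hμ.ostrogradsky n)
  rw [hμ.secondKind_eq_of_im hz, hμ.secondKind_eq_of_im hz]
  simp only [map_sub, map_mul, map_one] at h
  linear_combination h

end OP

/-! ## Residual vectors -/

namespace OP

variable {μ : Measure ℝ}

/-- The quotient of two consecutive functions of the second kind. -/
noncomputable def residualStieltjes (μ : Measure ℝ) (n : ℕ) (z : ℂ) : ℂ :=
  secondKind μ (nextPoly μ n) z / secondKind μ (orthonormalPoly μ n) z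

/-- The resolvent of the compressed multiplication operator, applied to `nextPoly μ n`. -/
noncomputable def residualVec (μ : Measure ℝ) (n : ℕ) (z : ℂ) (t : ℝ) : ℂ :=
  ((((nextPoly μ n).eval t : ℝ) : ℂ) -
    residualStieltjes μ n z * (((orthonormalPoly μ n).eval t : ℝ) : ℂ)) / (z - t)

theorem Good.memLp_eval (hμ : Good μ) (p : ℝ[X]) :
    MemLp (fun t : ℝ => ((p.eval t : ℝ) : ℂ)) 2 μ := by
  have h := (hμ.integrable_eval (p * p))
  rw [memLp_two_iff_integrable_sq_norm (hμ.integrable_ofReal_eval p).1]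
  refine h.congr (ae_of_all _ fun t => ?_)
  simp [sq]

theorem memLp_div_sub {f : ℝ → ℂ} (hf : MemLp f 2 μ) {z : ℂ} (hz : z.im ≠ 0) :
    MemLp (fun t : ℝ => f t / (z - t)) 2 μ := by
  have hpos := abs_pos.2 hz
  refine MemLp.of_le (hf.norm.const_mul (|z.im|⁻¹)) (aestronglyMeasurable_div_sub hf.1 z)
    (ae_of_all _ fun t => ?_)
  have := abs_im_le_norm_sub_ofReal z t
  rw [norm_div, norm_mul, norm_norm, norm_inv, Real.norm_of_nonneg hpos.le, div_eq_inv_mul]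
  gcongr

theorem Good.memLp_residualVec (hμ : Good μ) (n : ℕ) {z : ℂ} (hz : z.im ≠ 0) :
    MemLp (residualVec μ n z) 2 μ :=
  memLp_div_sub ((hμ.memLp_eval _).sub ((hμ.memLp_eval _).const_mul _)) hz

/-- For a polynomial `p` of degree at most `n`, both parts of the integral factor as `p(z)` times a
function of the second kind, and `residualStieltjes` is their quotient. So the residual vector is
orthogonal to the first `n + 1` chain sites. -/
theorem Good.integral_mul_residualVec (hμ : Good μ) {n : ℕ} {z : ℂ} (hz : z.im ≠ 0) {p : ℝ[X]}
    (hp : p.natDegree ≤ n) : ∫ t : ℝ, ((p.eval t : ℝ) : ℂ) * residualVec μ n z t ∂μ = 0 := by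
  have hδ := abs_pos.2 hz
  have hzt : ∀ᵐ t : ℝ ∂μ, |z.im| ≤ ‖z - t‖ := ae_of_all _ fun t => abs_im_le_norm_sub_ofReal z t
  have e : ∀ t : ℝ, ((p.eval t : ℝ) : ℂ) * residualVec μ n z t =
      (((p * nextPoly μ n).eval t : ℝ) : ℂ) / (z - t) - residualStieltjes μ n z *
        ((((p * orthonormalPoly μ n).eval t : ℝ) : ℂ) / (z - t)) := by
    intro t
    simp only [residualVec, eval_mul]
    push_cast
    ring
  simp_rw [e]
  rw [integral_sub (integrable_div_sub (hμ.integrable_ofReal_eval _) hz)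
    ((integrable_div_sub (hμ.integrable_ofReal_eval _) hz).const_mul _), integral_const_mul]
  have h1 := hμ.secondKind_mul hδ hzt (w := nextPoly μ n) (k := n + 1)
    (fun q hq => by rw [mul_comm]; exact hμ.mom_nextPoly_mul hq) (hp.trans (Nat.le_succ n))
  have h2 := hμ.secondKind_mul hδ hzt (w := orthonormalPoly μ n) (k := n)
    (fun q hq => by rw [mul_comm]; exact hμ.mom_orthonormalPoly_mul hq) hp
  have h3 := hμ.secondKind_ne_zero hz n
  rw [secondKind, cauchyTransform] at h1 h2
  rw [h1, h2, residualStieltjes]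
  field_simp
  ring

theorem Good.integrable_mul_residualVec (hμ : Good μ) (n : ℕ) {z : ℂ} (hz : z.im ≠ 0) (p : ℝ[X]) :
    Integrable (fun t : ℝ => ((p.eval t : ℝ) : ℂ) * residualVec μ n z t) μ :=
  (hμ.memLp_eval p).integrable_mul (hμ.memLp_residualVec n hz)

theorem integral_sub_sub_sub {a b c d : ℝ → ℂ} (ha : Integrable a μ) (hb : Integrable b μ)
    (hc : Integrable c μ) (hd : Integrable d μ) :
    ∫ t, (a t - b t - (c t - d t)) ∂μ =
      ∫ t, a t ∂μ - ∫ t, b t ∂μ - (∫ t, c t ∂μ - ∫ t, d t ∂μ) := by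
  have h := integral_sub (ha.sub hb) (hc.sub hd)
  simp only [Pi.sub_apply] at h
  rw [h, integral_sub ha hb, integral_sub hc hd]

/-- With `f` the residual vector, `v = t P - (t P - v)` and `t f = z f - (v - F P)`. Orthogonality
of `f` to degrees at most `n` and of `v` to `P` leaves only `F ⟨P, P⟩ = F`. -/
theorem Good.integral_nextPoly_mul_residualVec (hμ : Good μ) (n : ℕ) {z : ℂ} (hz : z.im ≠ 0) :
    ∫ t : ℝ, (((nextPoly μ n).eval t : ℝ) : ℂ) * residualVec μ n z t ∂μ =
      residualStieltjes μ n z := by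
  set P := orthonormalPoly μ n with hP
  set v := nextPoly μ n with hv
  set F := residualStieltjes μ n z with hF
  have h1 := hμ.integral_mul_residualVec hz (hμ.natDegree_X_mul_sub_nextPoly_le n)
  have h2 := hμ.integral_mul_residualVec hz (hμ.natDegree_orthonormalPoly n).le
  have i1 := hμ.integrable_mul_residualVec n hz (X * P - v)
  have i2 := hμ.integrable_mul_residualVec n hz P
  have e : ∀ t : ℝ, ((v.eval t : ℝ) : ℂ) * residualVec μ n z t =
      z * (((P.eval t : ℝ) : ℂ) * residualVec μ n z t) -
      (((X * P - v).eval t : ℝ) : ℂ) * residualVec μ n z t -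
      ((((v * P).eval t : ℝ) : ℂ) - F * (((P * P).eval t : ℝ) : ℂ)) := by
    intro t
    have hne := sub_ofReal_ne_zero hz t
    have h3 : residualVec μ n z t * (z - t) = ((v.eval t : ℝ) : ℂ) - F * ((P.eval t : ℝ) : ℂ) :=
      div_mul_cancel₀ _ hne
    simp only [eval_mul, eval_sub, eval_X]
    push_cast
    linear_combination (-((P.eval t : ℝ) : ℂ)) * h3
  have i3 := hμ.integrable_ofReal_eval (v * P)
  have i4 := (hμ.integrable_ofReal_eval (P * P)).const_mul F
  simp_rw [e]
  rw [integral_sub_sub_sub (i2.const_mul z) i1 i3 i4, integral_const_mul, integral_const_mul, h1, h2]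
  have h5 : ∫ t, (((v * P).eval t : ℝ) : ℂ) ∂μ = 0 := by
    rw [integral_complex_ofReal]
    have := hμ.mom_nextPoly_mul (n := n) (p := P)
      (by rw [hP, hμ.degree_orthonormalPoly]; exact_mod_cast Nat.lt_succ_self n)
    rw [mom] at this
    rw [this, Complex.ofReal_zero]
  have h6 : ∫ t, (((P * P).eval t : ℝ) : ℂ) ∂μ = 1 := by
    rw [integral_complex_ofReal]
    have := hμ.mom_orthonormalPoly_sq n
    rw [mom] at this
    rw [this, Complex.ofReal_one]
  rw [h5, h6]
  ring

/-- The Gram matrix of the vectors `residualVec μ n z`. -/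
theorem Good.gram_residualVec (hμ : Good μ) (n : ℕ) {z w : ℂ} (hz : z.im ≠ 0) (hw : w.im ≠ 0) :
    (z - (starRingEnd ℂ) w) *
      ∫ t : ℝ, (starRingEnd ℂ) (residualVec μ n w t) * residualVec μ n z t ∂μ =
      (starRingEnd ℂ) (residualStieltjes μ n w) - residualStieltjes μ n z := by
  set P := orthonormalPoly μ n with hP
  set v := nextPoly μ n with hv
  set Fz := residualStieltjes μ n z with hFz
  set Fw := residualStieltjes μ n w with hFw
  have hconj : ∀ p : ℝ[X], ∀ t : ℝ, ((p.eval t : ℝ) : ℂ) * (starRingEnd ℂ) (residualVec μ n w t) =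
      (starRingEnd ℂ) (((p.eval t : ℝ) : ℂ) * residualVec μ n w t) := fun p t => by
    rw [map_mul, Complex.conj_ofReal]
  have i1 := hμ.integrable_mul_residualVec n hz v
  have i2 := hμ.integrable_mul_residualVec n hz P
  have j1 : Integrable (fun t : ℝ => ((v.eval t : ℝ) : ℂ) *
      (starRingEnd ℂ) (residualVec μ n w t)) μ := by
    simp_rw [hconj]
    exact (LinearIsometryEquiv.integrable_comp_iff Complex.conjLIE).2
      (hμ.integrable_mul_residualVec n hw v)
  have j2 : Integrable (fun t : ℝ => ((P.eval t : ℝ) : ℂ) *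
      (starRingEnd ℂ) (residualVec μ n w t)) μ := by
    simp_rw [hconj]
    exact (LinearIsometryEquiv.integrable_comp_iff Complex.conjLIE).2
      (hμ.integrable_mul_residualVec n hw P)
  have v1 := hμ.integral_nextPoly_mul_residualVec n hz
  have v2 := hμ.integral_mul_residualVec hz (hμ.natDegree_orthonormalPoly n).le
  have w1 : ∫ t : ℝ, ((v.eval t : ℝ) : ℂ) * (starRingEnd ℂ) (residualVec μ n w t) ∂μ =
      (starRingEnd ℂ) Fw := by
    simp_rw [hconj]
    rw [integral_conj, hμ.integral_nextPoly_mul_residualVec n hw]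
  have w2 : ∫ t : ℝ, ((P.eval t : ℝ) : ℂ) * (starRingEnd ℂ) (residualVec μ n w t) ∂μ = 0 := by
    simp_rw [hconj]
    rw [integral_conj, hμ.integral_mul_residualVec hw (hμ.natDegree_orthonormalPoly n).le, map_zero]
  rw [← integral_const_mul]
  have e : ∀ t : ℝ, (z - (starRingEnd ℂ) w) *
      ((starRingEnd ℂ) (residualVec μ n w t) * residualVec μ n z t) =
      (((v.eval t : ℝ) : ℂ) * (starRingEnd ℂ) (residualVec μ n w t) -
        Fz * (((P.eval t : ℝ) : ℂ) * (starRingEnd ℂ) (residualVec μ n w t))) -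
      (((v.eval t : ℝ) : ℂ) * residualVec μ n z t -
        (starRingEnd ℂ) Fw * (((P.eval t : ℝ) : ℂ) * residualVec μ n z t)) := by
    intro t
    have h3 : residualVec μ n z t * (z - t) = ((v.eval t : ℝ) : ℂ) - Fz * ((P.eval t : ℝ) : ℂ) :=
      div_mul_cancel₀ _ (sub_ofReal_ne_zero hz t)
    have h4 : residualVec μ n w t * (w - t) = ((v.eval t : ℝ) : ℂ) - Fw * ((P.eval t : ℝ) : ℂ) :=
      div_mul_cancel₀ _ (sub_ofReal_ne_zero hw t)
    have h5 := congrArg (starRingEnd ℂ) h4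
    simp only [map_mul, map_sub, Complex.conj_ofReal] at h5
    linear_combination (starRingEnd ℂ) (residualVec μ n w t) * h3 - residualVec μ n z t * h5
  simp_rw [e]
  rw [integral_sub_sub_sub j1 (j2.const_mul _) i1 (i2.const_mul _), integral_const_mul,
    integral_const_mul, v1, v2, w1, w2]
  ring

theorem Good.residualStieltjes_im (hμ : Good μ) (n : ℕ) {z : ℂ} (hz : z.im ≠ 0) :
    -(residualStieltjes μ n z).im = z.im * ∫ t : ℝ, ‖residualVec μ n z t‖ ^ 2 ∂μ := by
  have h := hμ.gram_residualVec n hz hz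
  have e : ∀ t : ℝ, (starRingEnd ℂ) (residualVec μ n z t) * residualVec μ n z t =
      ((‖residualVec μ n z t‖ ^ 2 : ℝ) : ℂ) := fun t => by
    rw [Complex.conj_mul']; push_cast; rfl
  simp_rw [e] at h
  rw [integral_complex_ofReal, Complex.sub_conj] at h
  have h2 := congrArg Complex.im h
  rw [mul_right_comm, ← Complex.ofReal_mul, Complex.im_ofReal_mul] at h2
  simp at h2
  linarith

/-- Cauchy–Schwarz gives `‖F‖ ≤ ‖v‖ ‖f‖`. Since `Im z ‖f‖² = -Im F ≤ ‖F‖`, also `Im z ‖f‖ ≤ ‖v‖`,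
and the two bounds combine. -/
theorem Good.norm_residualStieltjes_le (hμ : Good μ) (n : ℕ) {z : ℂ} (hz : 0 < z.im) :
    ‖residualStieltjes μ n z‖ ≤ (∫ t, (nextPoly μ n).eval t ^ 2 ∂μ) / z.im := by
  have hv := hμ.memLp_eval (nextPoly μ n)
  have hf := hμ.memLp_residualVec n hz.ne'
  have h1 := norm_inner_le_norm (𝕜 := ℂ) (hv.toLp _) (hf.toLp _)
  rw [inner_toLp] at h1
  simp only [Complex.conj_ofReal] at h1
  rw [hμ.integral_nextPoly_mul_residualVec n hz.ne'] at h1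
  have h2 := hμ.residualStieltjes_im n hz.ne'
  rw [← norm_toLp_two_sq hf] at h2
  have h3 : ‖hv.toLp _‖ ^ 2 = ∫ t, (nextPoly μ n).eval t ^ 2 ∂μ := by
    rw [norm_toLp_two_sq]; simp
  rw [← h3, le_div_iff₀ hz]
  set a := ‖hv.toLp _‖
  set b := ‖hf.toLp _‖
  have ha : 0 ≤ a := norm_nonneg _
  have hb : 0 ≤ b := norm_nonneg _
  have h4 := (neg_le_abs _).trans (Complex.abs_im_le_norm (residualStieltjes μ n z))
  rw [h2] at h4
  have h5 : z.im * b ≤ a := by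
    rcases hb.eq_or_lt with h | h
    · rw [← h, mul_zero]; exact ha
    · have : (z.im * b) * b ≤ a * b := by nlinarith
      exact le_of_mul_le_mul_right this h
  calc _ ≤ a * b * z.im := by gcongr
    _ = a * (z.im * b) := by ring
    _ ≤ a * a := by gcongr
    _ = a ^ 2 := by ring

theorem Good.differentiableOn_residualStieltjes (hμ : Good μ) (n : ℕ) :
    DifferentiableOn ℂ (residualStieltjes μ n) {z | 0 < z.im} :=
  (differentiableOn_cauchyTransform (hμ.integrable_ofReal_eval _)).div
    (differentiableOn_cauchyTransform (hμ.integrable_ofReal_eval _))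
    fun _ hz => hμ.secondKind_ne_zero (ne_of_gt hz) n

theorem Good.residualStieltjes_im_nonpos (hμ : Good μ) (n : ℕ) {z : ℂ} (hz : 0 < z.im) :
    (residualStieltjes μ n z).im ≤ 0 := by
  have h := hμ.residualStieltjes_im n hz.ne'
  have : 0 ≤ z.im * ∫ t : ℝ, ‖residualVec μ n z t‖ ^ 2 ∂μ :=
    mul_nonneg hz.le (integral_nonneg fun t => by positivity)
  linarith

theorem secondKind_conj (w : ℝ[X]) (z : ℂ) :
    secondKind μ w ((starRingEnd ℂ) z) = (starRingEnd ℂ) (secondKind μ w z) := by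
  have := cauchyTransform_conj (μ := μ) (fun t => ((w.eval t : ℝ) : ℂ)) z
  simp only [Complex.conj_ofReal] at this
  exact this

theorem residualStieltjes_conj (n : ℕ) (z : ℂ) :
    residualStieltjes μ n ((starRingEnd ℂ) z) = (starRingEnd ℂ) (residualStieltjes μ n z) := by
  rw [residualStieltjes, secondKind_conj, secondKind_conj, ← map_div₀]; rfl

/-- Division of a polynomial by a linear factor, as a function on the real line. -/
theorem exists_complex_poly_div (p : ℂ[X]) (z : ℂ) {n : ℕ} (hp : p.natDegree ≤ n + 1)
    (hpz : p.eval z = 0) : ∃ q : ℂ[X], q.natDegree ≤ n ∧ p = (X - C z) * q := by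
  refine ⟨p /ₘ (X - C z), ?_, (mul_divByMonic_eq_iff_isRoot.2 hpz).symm⟩
  rw [natDegree_divByMonic _ (monic_X_sub_C z), natDegree_X_sub_C]
  omega

/-- With `R`, `T` the functions of the second kind of `P_n` and `v` at `z`, the polynomial `R v - T
P_n - 1` vanishes at `z` by the Ostrogradsky identity. Dividing it by `X - z` produces the remainder
`q`. This is what makes the range of the isometry large enough later. -/
theorem Good.exists_resolvent_decomposition (hμ : Good μ) (n : ℕ) {z : ℂ} (hz : z.im ≠ 0) :
    ∃ q : ℂ[X], q.natDegree ≤ n ∧ ∀ t : ℝ, 1 / (z - t) =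
      secondKind μ (orthonormalPoly μ n) z * residualVec μ n z t + q.eval (t : ℂ) := by
  set R := secondKind μ (orthonormalPoly μ n) z with hR
  set T := secondKind μ (nextPoly μ n) z with hT
  set ι := algebraMap ℝ ℂ with hι
  have hev : ∀ p : ℝ[X], (p.map ι).eval z = aeval z p := fun p => by
    rw [aeval_def, eval₂_eq_eval_map]
  have hevt : ∀ (p : ℝ[X]) (t : ℝ), (p.map ι).eval (t : ℂ) = ((p.eval t : ℝ) : ℂ) := fun p t =>
    eval_map_apply ι t
  obtain ⟨q, hq, hpq⟩ := exists_complex_poly_div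
    (C R * (nextPoly μ n).map ι - C T * (orthonormalPoly μ n).map ι - 1) z (n := n) (by
      refine (natDegree_sub_le _ _).trans (max_le ((natDegree_sub_le _ _).trans
        (max_le ?_ ?_)) (by rw [natDegree_one]; exact Nat.zero_le _))
      · exact (natDegree_C_mul_le _ _).trans (natDegree_map_le.trans (hμ.natDegree_nextPoly_le n))
      · exact (natDegree_C_mul_le _ _).trans (natDegree_map_le.trans
          ((hμ.natDegree_orthonormalPoly n).le.trans (Nat.le_succ n)))) (by
      simp only [eval_sub, eval_mul, eval_C, eval_one, hev]
      rw [hμ.secondKind_ostrogradsky hz, sub_self])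
  refine ⟨q, hq, fun t => ?_⟩
  have h1 := congrArg (eval (t : ℂ)) hpq
  simp only [eval_sub, eval_mul, eval_C, eval_one, hevt, eval_X] at h1
  have hne := sub_ofReal_ne_zero hz t
  have hRne := hμ.secondKind_ne_zero hz n
  rw [residualVec, residualStieltjes, ← hR, ← hT]
  rw [← hR] at hRne
  field_simp
  linear_combination -h1

end OP

/-! ## Measures with a positive density on an interval -/

namespace OP

/-- `μ` has the density `w`, which is positive exactly on the open interval `O`. -/
structure DensityOn (μ : Measure ℝ) (w : ℝ → ℝ) (O : Set ℝ) : Prop where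
  good : Good μ
  integrable : Integrable w
  eq_withDensity : μ = volume.withDensity fun t => ENNReal.ofReal (w t)
  isOpen : IsOpen O
  ordConnected : O.OrdConnected
  pos : ∀ t ∈ O, 0 < w t
  zero : ∀ t ∉ O, w t = 0

variable {μ : Measure ℝ} {w : ℝ → ℝ} {O : Set ℝ}

theorem DensityOn.nonneg (h : DensityOn μ w O) (t : ℝ) : 0 ≤ w t := by
  by_cases ht : t ∈ O
  · exact (h.pos t ht).le
  · exact (h.zero t ht).ge

theorem DensityOn.integral_eq (h : DensityOn μ w O) (f : ℝ → ℂ) :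
    ∫ t, f t ∂μ = ∫ t, w t • f t := by
  rw [h.eq_withDensity, integral_withDensity_eq_integral_toReal_smul₀
    h.integrable.1.aemeasurable.ennreal_ofReal (ae_of_all _ fun t => ENNReal.ofReal_lt_top)]
  congr 1
  funext t
  rw [ENNReal.toReal_ofReal (h.nonneg t)]

theorem DensityOn.singleton (h : DensityOn μ w O) (x : ℝ) : μ {x} = 0 := by
  rw [h.eq_withDensity]
  exact withDensity_absolutelyContinuous _ _ (by simp)

theorem DensityOn.nullSingletonClass (h : DensityOn μ w O) : NullSingletonClass μ :=
  ⟨h.singleton⟩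

theorem DensityOn.ae_mem (h : DensityOn μ w O) : ∀ᵐ t ∂μ, t ∈ O := by
  rw [h.eq_withDensity, ae_withDensity_iff' h.integrable.1.aemeasurable.ennreal_ofReal]
  refine ae_of_all _ fun t ht => ?_
  by_contra hO
  exact ht (by rw [h.zero t hO, ENNReal.ofReal_zero])

/-! ### Boundary values of the functions of the second kind -/

theorem DensityOn.stieltjes_eq (h : DensityOn μ w O) (z : ℂ) :
    stieltjes μ z = cauchyTransform volume (fun t => (w t : ℂ)) z := by
  rw [stieltjes, h.integral_eq, cauchyTransform]
  congr 1
  funext t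
  rw [Complex.real_smul, mul_one_div]

theorem tendsto_vertical (x : ℝ) :
    Tendsto (fun ε : ℝ => (x + ε * Complex.I : ℂ)) (𝓝[>] 0) (𝓝 (x : ℂ)) := by
  refine tendsto_nhdsWithin_of_tendsto_nhds ?_
  have : Continuous fun ε : ℝ => (x + ε * Complex.I : ℂ) := by fun_prop
  simpa using this.tendsto 0

theorem continuous_aeval (p : ℝ[X]) : Continuous fun z : ℂ => aeval z p := p.continuous_aeval

theorem aeval_ofReal (p : ℝ[X]) (x : ℝ) : aeval (x : ℂ) p = ((p.eval x : ℝ) : ℂ) := by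
  rw [← Complex.coe_algebraMap, aeval_algebraMap_apply]; rfl

theorem tendsto_aeval_vertical (p : ℝ[X]) (x : ℝ) :
    Tendsto (fun ε : ℝ => aeval (x + ε * Complex.I : ℂ) p) (𝓝[>] 0) (𝓝 ((p.eval x : ℝ) : ℂ)) := by
  rw [← aeval_ofReal]
  exact ((continuous_aeval p).tendsto _).comp (tendsto_vertical x)

/-- The Stieltjes transform has finite boundary values almost everywhere. -/
theorem DensityOn.ae_exists_tendsto_stieltjes (h : DensityOn μ w O) :
    ∀ᵐ x : ℝ, ∃ l : ℂ, Tendsto (fun y : ℝ => stieltjes μ (x + y * Complex.I)) (𝓝[>] 0) (𝓝 l) ∧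
      l.im = -Real.pi * w x := by
  simp_rw [h.stieltjes_eq]
  exact ae_exists_tendsto_cauchyTransform h.integrable h.nonneg

theorem Good.tendsto_secondKind (hμ : Good μ) {x : ℝ} {l : ℂ}
    (hl : Tendsto (fun y : ℝ => stieltjes μ (x + y * Complex.I)) (𝓝[>] 0) (𝓝 l)) (p : ℝ[X]) :
    Tendsto (fun y : ℝ => secondKind μ p (x + y * Complex.I)) (𝓝[>] 0)
      (𝓝 (((p.eval x : ℝ) : ℂ) * l - (((sec μ p).eval x : ℝ) : ℂ))) := by
  refine (((tendsto_aeval_vertical p x).mul hl).sub (tendsto_aeval_vertical (sec μ p) x)).congr' ?_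
  filter_upwards [self_mem_nhdsWithin] with y hy
  have hy : 0 < y := hy
  rw [hμ.secondKind_eq_of_im (by simpa using hy.ne')]

theorem Good.ostrogradsky_eval (hμ : Good μ) (n : ℕ) (x : ℝ) :
    (orthonormalPoly μ n).eval x * (sec μ (nextPoly μ n)).eval x -
      (nextPoly μ n).eval x * (sec μ (orthonormalPoly μ n)).eval x = 1 := by
  have := congrArg (eval x) (hμ.ostrogradsky n)
  simpa using this

/-- The imaginary part would force `P_n(x) = 0`, the real part then a common zero of `P_n` and its
secondary polynomial, against the Ostrogradsky identity. -/
theorem Good.boundary_ne_zero (hμ : Good μ) (n : ℕ) (x : ℝ) {l : ℂ} (hl : l.im ≠ 0) :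
    (((orthonormalPoly μ n).eval x : ℝ) : ℂ) * l -
      (((sec μ (orthonormalPoly μ n)).eval x : ℝ) : ℂ) ≠ 0 := by
  intro h
  have h1 := congrArg Complex.im h
  simp only [Complex.sub_im, Complex.im_ofReal_mul, Complex.ofReal_im, sub_zero,
    Complex.zero_im] at h1
  have h2 : (orthonormalPoly μ n).eval x = 0 := (mul_eq_zero.1 h1).resolve_right hl
  have h3 := hμ.ostrogradsky_eval n x
  rw [h2] at h h3
  simp only [Complex.ofReal_zero, zero_mul, zero_sub, neg_eq_zero, Complex.ofReal_eq_zero] at h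
  rw [h] at h3
  simp at h3

/-- Boundary values of the quotient where the density does not vanish. -/
theorem DensityOn.tendsto_residualStieltjes (h : DensityOn μ w O) (n : ℕ) {x : ℝ} (hx : x ∈ O)
    {l : ℂ} (hl : Tendsto (fun y : ℝ => stieltjes μ (x + y * Complex.I)) (𝓝[>] 0) (𝓝 l))
    (him : l.im = -Real.pi * w x) :
    ∃ L : ℂ, Tendsto (fun y : ℝ => residualStieltjes μ n (x + y * Complex.I)) (𝓝[>] 0) (𝓝 L) ∧
      0 < -L.im := by
  have hμ := h.good
  have hπ := Real.pi_pos
  have hw := h.pos x hx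
  have hl0 : l.im < 0 := by rw [him]; nlinarith
  have hne := hμ.boundary_ne_zero n x hl0.ne
  refine ⟨_, (hμ.tendsto_secondKind hl _).div (hμ.tendsto_secondKind hl _) hne, ?_⟩
  set P := (orthonormalPoly μ n).eval x
  set v := (nextPoly μ n).eval x
  set sP := (sec μ (orthonormalPoly μ n)).eval x
  set sv := (sec μ (nextPoly μ n)).eval x
  have ho : P * sv - v * sP = 1 := hμ.ostrogradsky_eval n x
  have hN : 0 < Complex.normSq ((P : ℂ) * l - (sP : ℂ)) := Complex.normSq_pos.2 hne
  rw [Complex.div_im, ← sub_div, ← neg_div]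
  refine div_pos ?_ hN
  simp only [Complex.sub_im, Complex.im_ofReal_mul, Complex.ofReal_im, sub_zero, Complex.sub_re,
    Complex.re_ofReal_mul, Complex.ofReal_re]
  -- The numerator of the imaginary part of the quotient is the Ostrogradsky determinant times the
  -- imaginary part of the boundary value of the Stieltjes transform.
  have : -(v * l.im * (P * l.re - sP) - (v * l.re - sv) * (P * l.im)) =
      -l.im * (P * sv - v * sP) := by ring
  rw [this, ho]
  linarith

/-! ### Absence of atoms and local boundedness of the quotient -/

theorem Good.integral_sq_mul_pos (hμ : Good μ) {p : ℝ[X]} (hp : p ≠ 0) {k : ℝ → ℝ}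
    (hk : ∀ᵐ t ∂μ, 0 < k t) (hi : Integrable (fun t => (p * p).eval t * k t) μ) :
    0 < ∫ t, (p * p).eval t * k t ∂μ := by
  have hn : 0 ≤ᵐ[μ] fun t => (p * p).eval t * k t := by
    filter_upwards [hk] with t ht
    rw [eval_mul]; exact mul_nonneg (mul_self_nonneg _) ht.le
  refine (integral_nonneg_of_ae hn).lt_of_ne fun h => ?_
  have h0 := (integral_eq_zero_iff_of_nonneg_ae hn hi).1 h.symm
  have h1 := hμ.pos p hp
  have h2 : ∫ x, p.eval x * p.eval x ∂μ = 0 := by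
    rw [← integral_zero ℝ ℝ (μ := μ)]
    refine integral_congr_ae ?_
    filter_upwards [h0, hk] with t ht htk
    rw [Pi.zero_apply, mul_eq_zero] at ht
    rcases ht with h | h
    · simpa using h
    · exact absurd h htk.ne'
  linarith

theorem DensityOn.side (h : DensityOn μ w O) {x : ℝ} (hx : x ∉ O) :
    ∃ σ : ℝ, |σ| = 1 ∧ ∀ t ∈ O, 0 < σ * (t - x) := by
  by_cases hlt : ∀ t ∈ O, x < t
  · exact ⟨1, abs_one, fun t ht => by rw [one_mul]; exact sub_pos.2 (hlt t ht)⟩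
  · push Not at hlt
    obtain ⟨s, hs, hsx⟩ := hlt
    refine ⟨-1, by simp, fun t ht => ?_⟩
    have : t < x := by
      by_contra hc
      exact hx (h.ordConnected.out hs ht ⟨hsx, not_lt.1 hc⟩)
    linarith

/-- Off the open interval `O` the functions of the second kind stay away from zero. -/
theorem DensityOn.exists_le_norm_secondKind (h : DensityOn μ w O) (n : ℕ) {x : ℝ} (hx : x ∉ O) :
    ∃ c > 0, ∀ ε : ℝ, 0 < ε → ε ≤ 1 →
      c ≤ ‖secondKind μ (orthonormalPoly μ n) (x + ε * Complex.I)‖ := by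
  have hμ := h.good
  obtain ⟨σ, hσ, hside⟩ := h.side hx
  set P := orthonormalPoly μ n with hP
  have hσ2 : σ * σ = 1 := by rw [← abs_mul_abs_self, hσ, one_mul]
  -- Up to sign, the real part of the Cauchy kernel. It is positive on `O`, since `O` lies on one
  -- side of `x`, and decreases in `ε`, so its value at `ε = 1` gives a uniform lower bound.
  set k : ℝ → ℝ → ℝ := fun ε t => σ * (t - x) / ((t - x) ^ 2 + ε ^ 2) with hk
  have hki : ∀ ε : ℝ, 0 < ε → Integrable (fun t => (P * P).eval t * k ε t) μ := by
    intro ε hε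
    have hm : Continuous (k ε) := by
      refine Continuous.div (by fun_prop) (by fun_prop) fun t => ?_
      positivity
    refine (hμ.integrable_eval (P * P)).mul_bdd (c := 1 / ε) hm.aestronglyMeasurable
      (ae_of_all _ fun t => ?_)
    rw [hk, Real.norm_eq_abs, abs_div, abs_mul, hσ, one_mul,
      abs_of_pos (show 0 < (t - x) ^ 2 + ε ^ 2 by positivity), div_le_div_iff₀ (by positivity) hε]
    nlinarith [sq_abs (t - x), sq_nonneg (|t - x| - ε), abs_nonneg (t - x), sq_nonneg ε]
  set c₀ := ∫ t, (P * P).eval t * k 1 t ∂μ with hc₀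
  have hc₀pos : 0 < c₀ := by
    refine hμ.integral_sq_mul_pos (hμ.orthonormalPoly_ne_zero n) ?_ (hki 1 one_pos)
    filter_upwards [h.ae_mem] with t ht
    have := hside t ht
    positivity
  have hle : ∀ ε : ℝ, 0 < ε → ε ≤ 1 → c₀ ≤ ‖secondKind μ (P * P) (x + ε * Complex.I)‖ := by
    intro ε hε hε1
    have hz : (x + ε * Complex.I : ℂ).im ≠ 0 := by simpa using hε.ne'
    have h1 : c₀ ≤ ∫ t, (P * P).eval t * k ε t ∂μ := by
      refine integral_mono_ae (hki 1 one_pos) (hki ε hε) ?_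
      filter_upwards [h.ae_mem] with t ht
      have h2 := hside t ht
      have h3 : 0 ≤ (P * P).eval t := by rw [eval_mul]; exact mul_self_nonneg _
      simp only [hk]
      gcongr
    have h4 : (secondKind μ (P * P) (x + ε * Complex.I)).re =
        -σ * ∫ t, (P * P).eval t * k ε t ∂μ := by
      have hi := integrable_div_sub (hμ.integrable_ofReal_eval (P * P)) hz
      have h5 := integral_re hi
      simp only [RCLike.re_to_complex] at h5
      rw [secondKind, cauchyTransform, ← h5, ← integral_const_mul]
      congr 1
      funext t
      have h6 : (1 / (x + ε * Complex.I - t : ℂ)).re = (x - t) / ((t - x) ^ 2 + ε ^ 2) := by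
        rw [one_div, Complex.inv_re, Complex.normSq_apply]
        simp
        ring
      rw [div_eq_mul_one_div, Complex.re_ofReal_mul, h6, hk]
      simp only
      rw [mul_div_assoc, neg_mul, mul_left_comm σ, ← mul_assoc σ σ, hσ2]
      ring
    refine h1.trans ((le_abs_self _).trans ?_)
    have h7 := Complex.abs_re_le_norm (secondKind μ (P * P) (x + ε * Complex.I))
    rwa [h4, abs_mul, abs_neg, hσ, one_mul] at h7
  obtain ⟨M, hM⟩ : ∃ M, ∀ ε ∈ Set.Icc (0:ℝ) 1, ‖aeval (x + ε * Complex.I : ℂ) P‖ ≤ M :=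
    isCompact_Icc.exists_bound_of_continuousOn
      ((continuous_aeval P).comp (by fun_prop)).continuousOn
  have hM0 : 0 ≤ M := (norm_nonneg _).trans (hM 0 ⟨le_rfl, zero_le_one⟩)
  refine ⟨c₀ / (M + 1), by positivity, fun ε hε hε1 => ?_⟩
  have hz : (x + ε * Complex.I : ℂ).im ≠ 0 := by simpa using hε.ne'
  have h1 := hμ.mul_secondKind_orthonormalPoly (abs_pos.2 hz)
    (ae_of_all _ fun t => abs_im_le_norm_sub_ofReal _ t) n
  have h2 := hle ε hε hε1
  rw [← h1, norm_mul] at h2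
  rw [div_le_iff₀ (by positivity), mul_comm]
  refine h2.trans ?_
  have := hM ε ⟨hε.le, hε1⟩
  gcongr
  linarith

theorem DensityOn.tendsto_mul_residualStieltjes (h : DensityOn μ w O) (n : ℕ) {x c : ℝ}
    (hc : 0 < c) (hle : ∀ᶠ ε : ℝ in 𝓝[>] 0,
      c ≤ ‖secondKind μ (orthonormalPoly μ n) (x + ε * Complex.I)‖) :
    Tendsto (fun ε : ℝ => (ε : ℂ) * residualStieltjes μ n (x + ε * Complex.I)) (𝓝[>] 0) (𝓝 0) := by
  have h1 := tendsto_mul_cauchyTransform (h.good.integrable_ofReal_eval (nextPoly μ n))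
    (h.singleton x)
  refine squeeze_zero_norm' (a := fun ε : ℝ =>
    ‖(ε : ℂ) * secondKind μ (nextPoly μ n) (x + ε * Complex.I)‖ / c) ?_ ?_
  · filter_upwards [hle] with ε hε
    rw [residualStieltjes, ← mul_div_assoc, norm_div]
    gcongr
  · have := h1.norm.div_const c
    rwa [norm_zero, zero_div] at this

/-- No atoms at the zeros of `P_n`. -/
theorem DensityOn.tendsto_mul_residualStieltjes_of_root (h : DensityOn μ w O) (n : ℕ) {x : ℝ}
    (hx : (orthonormalPoly μ n).eval x = 0) :
    Tendsto (fun ε : ℝ => (ε : ℂ) * residualStieltjes μ n (x + ε * Complex.I)) (𝓝[>] 0) (𝓝 0) := by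
  have hμ := h.good
  have ho := hμ.ostrogradsky_eval n x
  rw [hx, zero_mul, zero_sub] at ho
  set sP := (sec μ (orthonormalPoly μ n)).eval x with hsP
  have hsP0 : sP ≠ 0 := by intro h0; rw [h0] at ho; simp at ho
  obtain ⟨q, hq⟩ := dvd_iff_isRoot.2 hx
  have hS := tendsto_mul_cauchyTransform (hμ.integrable_ofReal_eval 1) (h.singleton x)
  -- The zero of `P_n` supplies a factor `iε`, and `ε` times the Stieltjes transform tends to zero
  -- even where that transform is unbounded. What remains is minus the secondary polynomial, nonzero
  -- by the Ostrogradsky identity.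
  have h1 : Tendsto (fun ε : ℝ => secondKind μ (orthonormalPoly μ n) (x + ε * Complex.I)) (𝓝[>] 0)
      (𝓝 (-(sP : ℂ))) := by
    have h2 := (((tendsto_aeval_vertical q x).mul_const Complex.I).mul hS).sub
      (tendsto_aeval_vertical (sec μ (orthonormalPoly μ n)) x)
    rw [mul_zero, zero_sub] at h2
    refine h2.congr' ?_
    filter_upwards [self_mem_nhdsWithin] with y hy
    have hy : 0 < y := hy
    rw [hμ.secondKind_eq_of_im (by simpa using hy.ne'), ← secondKind_one]
    have hPz : aeval (x + y * Complex.I : ℂ) (orthonormalPoly μ n) =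
        y * Complex.I * aeval (x + y * Complex.I : ℂ) q := by
      conv_lhs => rw [hq]
      simp only [map_mul, map_sub, aeval_X, aeval_C, Complex.coe_algebraMap]
      ring
    rw [hPz, secondKind]
    ring
  refine h.tendsto_mul_residualStieltjes n (c := |sP| / 2) (by positivity) ?_
  have h3 := h1.norm
  rw [norm_neg, Complex.norm_real, Real.norm_eq_abs] at h3
  exact (h3.eventually (lt_mem_nhds (half_lt_self (abs_pos.2 hsP0)))).mono fun _ => le_of_lt

/-- On the smaller ball of radius `ε` the kernel is at least `1 / (2 π ε)`, and that ball has length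
`2 ε`. -/
theorem one_div_pi_le_integral_poissonHP {ε δ : ℝ} (hε : 0 < ε) (hεδ : ε < δ) (x : ℝ) :
    Real.pi⁻¹ ≤ ∫ t in Metric.ball x δ, poissonHP ε (x - t) := by
  have hπ := Real.pi_pos
  have hi := integrable_poissonHP_sub hε x
  calc Real.pi⁻¹ = ∫ t in Metric.ball x ε, 1 / (2 * Real.pi * ε) := by
        rw [setIntegral_const, Real.volume_real_ball hε.le, smul_eq_mul]
        field_simp
    _ ≤ ∫ t in Metric.ball x ε, poissonHP ε (x - t) := by
        refine setIntegral_mono_on (integrableOn_const measure_ball_lt_top.ne) hi.integrableOn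
          Metric.isOpen_ball.measurableSet fun t ht => ?_
        rw [Metric.mem_ball, Real.dist_eq, abs_sub_comm] at ht
        unfold poissonHP
        have : (x - t) ^ 2 ≤ ε ^ 2 := by rw [← sq_abs]; gcongr
        rw [div_le_div_iff₀ (by positivity) (by positivity)]
        nlinarith [mul_le_mul_of_nonneg_left this hπ.le]
    _ ≤ ∫ t in Metric.ball x δ, poissonHP ε (x - t) :=
        setIntegral_mono_set hi.integrableOn (ae_of_all _ fun t => (poissonHP_pos hε _).le)
          (Metric.ball_subset_ball hεδ.le).eventuallyLE

theorem DensityOn.le_neg_stieltjes_im (h : DensityOn μ w O) {x δ c ε : ℝ} (hc : 0 ≤ c)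
    (hwc : ∀ t ∈ Metric.ball x δ, c ≤ w t) (hε : 0 < ε) (hεδ : ε < δ) :
    c ≤ -(stieltjes μ (x + ε * Complex.I)).im := by
  have hπ := Real.pi_pos
  rw [h.stieltjes_eq, cauchyTransform_im h.integrable x hε, neg_mul, neg_neg]
  have hi := poissonHP_mul_integrable h.integrable hε x
  have hip := integrable_poissonHP_sub hε x
  have h1 : c * Real.pi⁻¹ ≤ ∫ t, poissonHP ε (x - t) * w t :=
    calc c * Real.pi⁻¹ ≤ c * ∫ t in Metric.ball x δ, poissonHP ε (x - t) := by
          gcongr; exact one_div_pi_le_integral_poissonHP hε hεδ x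
      _ = ∫ t in Metric.ball x δ, c * poissonHP ε (x - t) := (integral_const_mul _ _).symm
      _ ≤ ∫ t in Metric.ball x δ, poissonHP ε (x - t) * w t := by
          refine setIntegral_mono_on (hip.const_mul c).integrableOn hi.integrableOn
            Metric.isOpen_ball.measurableSet fun t ht => ?_
          rw [mul_comm]
          exact mul_le_mul_of_nonneg_left (hwc t ht) (poissonHP_pos hε _).le
      _ ≤ ∫ t, poissonHP ε (x - t) * w t :=
          setIntegral_le_integral hi (ae_of_all _ fun t =>
            mul_nonneg (poissonHP_pos hε _).le (h.nonneg t))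
  rw [← div_eq_mul_inv, div_le_iff₀ hπ] at h1
  linarith

theorem eventually_nhds_ofReal {p : ℂ → Prop} {x : ℝ} (h : ∀ᶠ z in 𝓝 (x : ℂ), p z) :
    ∃ δ > 0, ∀ x' ε : ℝ, |x' - x| < δ → 0 < ε → ε < δ → p (x' + ε * Complex.I) := by
  obtain ⟨r, hr, hp⟩ := Metric.eventually_nhds_iff.1 h
  refine ⟨r / 2, half_pos hr, fun x' ε h1 h2 h3 => hp ?_⟩
  rw [dist_eq_norm]
  have e : (x' + ε * Complex.I - x : ℂ) = ((x' - x : ℝ) : ℂ) + ε * Complex.I := by push_cast; ring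
  rw [e]
  refine (norm_add_le _ _).trans_lt ?_
  rw [norm_mul, Complex.norm_I, mul_one, Complex.norm_real, Complex.norm_real, Real.norm_eq_abs,
    Real.norm_of_nonneg h2.le]
  linarith

theorem eventually_norm_le {f : ℂ → ℂ} {z : ℂ} (hf : ContinuousAt f z) :
    ∀ᶠ y in 𝓝 z, ‖f y‖ ≤ ‖f z‖ + 1 :=
  (hf.norm.tendsto.eventually (gt_mem_nhds (lt_add_one _))).mono fun _ => le_of_lt

/-- Local boundedness at points of `O` that are not zeros of `P_n`. -/
theorem DensityOn.locally_bounded (h : DensityOn μ w O) (hcont : ContinuousOn w O) (n : ℕ) {x : ℝ}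
    (hx : x ∈ O) (hP0 : (orthonormalPoly μ n).eval x ≠ 0) :
    ∃ δ > 0, ∃ M, ∀ x' ε : ℝ, |x' - x| < δ → 0 < ε → ε < δ →
      ‖residualStieltjes μ n (x' + ε * Complex.I)‖ ≤ M := by
  have hμ := h.good
  set P := orthonormalPoly μ n with hP
  set v := nextPoly μ n with hv
  set c := w x / 2 with hc
  have hc0 : 0 < c := half_pos (h.pos x hx)
  -- Here continuity of the density enters: a lower bound on a whole neighbourhood bounds `-Im` of
  -- the Stieltjes transform from below near `x`.
  obtain ⟨δ₁, hδ₁, hw₁⟩ : ∃ δ₁ > 0, ∀ t, |t - x| < δ₁ → c ≤ w t := by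
    have h1 := ((hcont x hx).continuousAt (h.isOpen.mem_nhds hx)).tendsto.eventually
      (lt_mem_nhds (half_lt_self (h.pos x hx)))
    obtain ⟨r, hr, hp⟩ := Metric.eventually_nhds_iff.1 h1
    exact ⟨r, hr, fun t ht => (hp (by rwa [Real.dist_eq])).le⟩
  have hPx : aeval (x : ℂ) P ≠ 0 := by rw [aeval_ofReal]; exact_mod_cast hP0
  have hca : ∀ p : ℝ[X], ContinuousAt (fun z : ℂ => aeval z p) (x : ℂ) := fun p =>
    (continuous_aeval p).continuousAt
  -- The denominator of the quotient is `P (S - q)`, with `q` real at `x`. Near `x`, `|Im q| < c /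
  -- 2` while `-Im S ≥ c`, so `‖S - q‖ ≥ c / 2`; writing the quotient as `A + B / (S - q)` then
  -- bounds it without any upper bound on `S`.
  set q : ℂ → ℂ := fun z => aeval z (sec μ P) / aeval z P with hq
  have hqc : ContinuousAt q (x : ℂ) := (hca _).div (hca _) hPx
  have hqim : (q x).im = 0 := by
    rw [hq]
    simp only [aeval_ofReal]
    rw [← Complex.ofReal_div, Complex.ofReal_im]
  have ev1 : ∀ᶠ z in 𝓝 (x : ℂ), |(q z).im| < c / 2 := by
    have := (Complex.continuous_im.continuousAt.comp hqc).abs.tendsto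
    simp only [Function.comp, hqim, abs_zero] at this
    exact this.eventually (gt_mem_nhds (half_pos hc0))
  have ev2 : ∀ᶠ z in 𝓝 (x : ℂ), aeval z P ≠ 0 := (hca P).eventually_ne hPx
  set A : ℂ → ℂ := fun z => aeval z v / aeval z P with hA
  set B : ℂ → ℂ := fun z => (aeval z v * q z - aeval z (sec μ v)) / aeval z P with hB
  have ev3 := eventually_norm_le (f := A) ((hca _).div (hca _) hPx)
  have ev4 := eventually_norm_le (f := B) ((((hca _).mul hqc).sub (hca _)).div (hca _) hPx)
  obtain ⟨δ₂, hδ₂, hall⟩ := eventually_nhds_ofReal (ev1.and (ev2.and (ev3.and ev4)))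
  refine ⟨min (δ₁ / 2) δ₂, by positivity, (‖A x‖ + 1) + (‖B x‖ + 1) / (c / 2),
    fun x' ε h1 h2 h3 => ?_⟩
  obtain ⟨e1, e2, e3, e4⟩ := hall x' ε (h1.trans_le (min_le_right _ _)) h2
    (h3.trans_le (min_le_right _ _))
  have him := h.le_neg_stieltjes_im (x := x') (δ := δ₁ / 2) hc0.le (fun t ht => hw₁ t (by
    rw [Metric.mem_ball, Real.dist_eq] at ht
    have := abs_sub_le t x' x
    have := h1.trans_le (min_le_left _ _)
    linarith)) h2 (h3.trans_le (min_le_left _ _))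
  set z : ℂ := x' + ε * Complex.I with hz
  have hzim : z.im ≠ 0 := by simpa [hz] using h2.ne'
  set D := stieltjes μ z - q z with hD
  have hDn : c / 2 ≤ ‖D‖ := by
    refine le_trans ?_ (Complex.abs_im_le_norm D)
    refine le_trans ?_ (neg_le_abs _)
    rw [hD, Complex.sub_im]
    have := (abs_lt.1 e1).1
    linarith
  have hD0 : D ≠ 0 := norm_pos_iff.1 ((half_pos hc0).trans_le hDn)
  have hF : residualStieltjes μ n z = A z + B z / D := by
    rw [residualStieltjes, hμ.secondKind_eq_of_im hzim, hμ.secondKind_eq_of_im hzim]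
    have hPD : aeval z P * stieltjes μ z - aeval z (sec μ P) = aeval z P * D := by
      rw [hD, hq]; field_simp
    rw [← hP, ← hv, hPD, hA, hB]
    simp only
    have hS : stieltjes μ z = D + q z := by rw [hD]; ring
    rw [hS]
    field_simp
    ring
  rw [hF]
  refine (norm_add_le _ _).trans (add_le_add e3 ?_)
  rw [norm_div]
  gcongr

theorem DensityOn.exists_pos_le_norm_sub (h : DensityOn μ w O) {x : ℝ} (hx : x ∉ closure O) :
    ∃ δ > 0, ∀ᵐ t : ℝ ∂μ, δ ≤ ‖(x : ℂ) - t‖ := by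
  obtain ⟨δ, hδ, hb⟩ := Metric.isOpen_iff.1 isClosed_closure.isOpen_compl x hx
  refine ⟨δ, hδ, ?_⟩
  filter_upwards [h.ae_mem] with t ht
  rw [← Complex.ofReal_sub, Complex.norm_real, Real.norm_eq_abs]
  by_contra hlt
  exact hb (show t ∈ Metric.ball x δ by
    rw [Metric.mem_ball, Real.dist_eq, abs_sub_comm]; exact not_le.1 hlt) (subset_closure ht)

/-- Outside the closed support the quotient is holomorphic and real on the real line. -/
theorem DensityOn.continuousAt_residualStieltjes (h : DensityOn μ w O) (n : ℕ) {x : ℝ}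
    (hx : x ∉ closure O) : ContinuousAt (residualStieltjes μ n) (x : ℂ) ∧
      (residualStieltjes μ n (x : ℂ)).im = 0 := by
  obtain ⟨δ, hδ, hδt⟩ := h.exists_pos_le_norm_sub hx
  have hc : ∀ p, ContinuousAt (secondKind μ p) (x : ℂ) := fun p =>
    (differentiableAt_cauchyTransform (h.good.integrable_ofReal_eval p) hδ hδt).continuousAt
  have hne : secondKind μ (orthonormalPoly μ n) (x : ℂ) ≠ 0 := by
    obtain ⟨c, hc0, hcl⟩ := h.exists_le_norm_secondKind n (fun hO => hx (subset_closure hO))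
    have h1 := ((hc (orthonormalPoly μ n)).tendsto.comp (tendsto_vertical x)).norm
    have h2 : c ≤ ‖secondKind μ (orthonormalPoly μ n) (x : ℂ)‖ := by
      refine ge_of_tendsto h1 ?_
      filter_upwards [Ioo_mem_nhdsGT one_pos] with ε hε using hcl ε hε.1 hε.2.le
    exact norm_pos_iff.1 (hc0.trans_le h2)
  refine ⟨(hc _).div (hc _) hne, ?_⟩
  have := residualStieltjes_conj (μ := μ) n (x : ℂ)
  rw [Complex.conj_ofReal] at this
  exact Complex.conj_eq_iff_im.1 this.symm

theorem DensityOn.finite_closure_diff (h : DensityOn μ w O) : (closure O \ O).Finite := by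
  refine ((Set.finite_singleton (sSup O)).insert (sInf O)).subset fun x hx => ?_
  have hne : O.Nonempty := closure_nonempty_iff.1 ⟨x, hx.1⟩
  obtain ⟨σ, hσ, hside⟩ := h.side hx.2
  rcases eq_or_eq_neg_of_abs_eq hσ with rfl | rfl
  · left
    have hlb : x ∈ lowerBounds O := fun t ht => by have := hside t ht; linarith
    exact ((isGLB_of_mem_closure hlb hx.1).csInf_eq hne).symm
  · right
    have hub : x ∈ upperBounds O := fun t ht => by have := hside t ht; linarith
    exact ((isLUB_of_mem_closure hub hx.1).csSup_eq hne).symm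

/-- The quotient of consecutive functions of the second kind is, up to a real constant, the Stieltjes
transform of a density that is positive almost everywhere on `O` and vanishes elsewhere. -/
theorem DensityOn.exists_residual_density (h : DensityOn μ w O) (hcont : ContinuousOn w O) (n : ℕ) :
    ∃ j : ℝ → ℝ, Integrable j ∧ (∀ᵐ x, x ∈ O → 0 < j x) ∧ (∀ᵐ x, x ∉ O → j x = 0) ∧
      ∃ a : ℝ, ∀ z : ℂ, z.im ≠ 0 →
        residualStieltjes μ n z = cauchyTransform volume (fun t => (j t : ℂ)) z + a := by
  have hμ := h.good
  have hπ := Real.pi_pos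
  set F := residualStieltjes μ n with hF
  have hlimO : ∀ᵐ x : ℝ, x ∈ O → ∃ L : ℂ,
      Tendsto (fun y : ℝ => F (x + y * Complex.I)) (𝓝[>] 0) (𝓝 L) ∧ 0 < -L.im := by
    filter_upwards [h.ae_exists_tendsto_stieltjes] with x ⟨l, hl, him⟩ hx
    exact h.tendsto_residualStieltjes n hx hl him
  have hlimC : ∀ᵐ x : ℝ, x ∉ O → ∃ L : ℂ,
      Tendsto (fun y : ℝ => F (x + y * Complex.I)) (𝓝[>] 0) (𝓝 L) ∧ L.im = 0 := by
    have : ∀ᵐ x : ℝ, x ∉ closure O \ O := h.finite_closure_diff.measure_zero volume |>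
      measure_eq_zero_iff_ae_notMem.1
    filter_upwards [this] with x hx hxO
    have hxc : x ∉ closure O := fun hc => hx ⟨hc, hxO⟩
    obtain ⟨h1, h2⟩ := h.continuousAt_residualStieltjes n hxc
    exact ⟨F x, h1.tendsto.comp (tendsto_vertical x), h2⟩
  set j : ℝ → ℝ := fun x => -(limUnder (𝓝[>] 0) fun y : ℝ => F (x + y * Complex.I)).im with hj
  have hjL : ∀ (x : ℝ) (L : ℂ), Tendsto (fun y : ℝ => F (x + y * Complex.I)) (𝓝[>] 0) (𝓝 L) →
      j x = -L.im := fun x L hL => by simp only [hj]; rw [hL.limUnder_eq]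
  have hjlim : ∀ᵐ x : ℝ, Tendsto (fun ε : ℝ => -(F (x + ε * Complex.I)).im) (𝓝[>] 0)
      (𝓝 (j x)) := by
    filter_upwards [hlimO, hlimC] with x h1 h2
    have : ∃ L : ℂ, Tendsto (fun y : ℝ => F (x + y * Complex.I)) (𝓝[>] 0) (𝓝 L) := by
      by_cases hx : x ∈ O
      · obtain ⟨L, hL, -⟩ := h1 hx; exact ⟨L, hL⟩
      · obtain ⟨L, hL, -⟩ := h2 hx; exact ⟨L, hL⟩
    obtain ⟨L, hL⟩ := this
    rw [hjL x L hL]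
    exact ((Complex.continuous_im.tendsto _).comp hL).neg
  -- The finitely many exceptional points are the endpoints of `O` and the zeros of `P_n`. Local
  -- boundedness is not known there, but atoms are excluded.
  have hbad : ∀ x ∈ closure O \ O ∪ {x | (orthonormalPoly μ n).IsRoot x},
      Tendsto (fun ε : ℝ => (ε : ℂ) * F (x + ε * Complex.I)) (𝓝[>] 0) (𝓝 0) := by
    rintro x (hx | hx)
    · obtain ⟨c, hc0, hcl⟩ := h.exists_le_norm_secondKind n hx.2
      refine h.tendsto_mul_residualStieltjes n hc0 ?_
      filter_upwards [Ioo_mem_nhdsGT one_pos] with ε hε using hcl ε hε.1 hε.2.le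
    · exact h.tendsto_mul_residualStieltjes_of_root n hx
  have hloc : ∀ x ∉ closure O \ O ∪ {x | (orthonormalPoly μ n).IsRoot x}, ∃ δ > 0, ∃ M,
      ∀ x' ε : ℝ, |x' - x| < δ → 0 < ε → ε < δ → ‖F (x' + ε * Complex.I)‖ ≤ M := by
    intro x hx
    have hx1 : ¬ (x ∈ closure O ∧ x ∉ O) := fun h' => hx (Or.inl h')
    have hx2 : (orthonormalPoly μ n).eval x ≠ 0 := fun h' => hx (Or.inr h')
    by_cases hxO : x ∈ O
    · exact h.locally_bounded hcont n hxO hx2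
    · have hxc : x ∉ closure O := fun hc => hx1 ⟨hc, hxO⟩
      obtain ⟨δ, hδ, hb⟩ := eventually_nhds_ofReal
        (eventually_norm_le (h.continuousAt_residualStieltjes n hxc).1)
      exact ⟨δ, hδ, _, hb⟩
  obtain ⟨hji, hj0, hrep⟩ := herglotz_representation (F := F)
    (hμ.differentiableOn_residualStieltjes n) (fun z hz => hμ.norm_residualStieltjes_le n hz)
    (fun z hz => hμ.residualStieltjes_im_nonpos n hz) hjlim
    (s := closure O \ O ∪ {x | (orthonormalPoly μ n).IsRoot x})
    (h.finite_closure_diff.union (finite_setOfPred_isRoot (hμ.orthonormalPoly_ne_zero n))) hbad hloc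
  · refine ⟨fun t => j t / Real.pi, hji.div_const _, ?_, ?_, ?_⟩
    · filter_upwards [hlimO] with x hx hxO
      obtain ⟨L, hL, hL0⟩ := hx hxO
      rw [hjL x L hL]
      positivity
    · filter_upwards [hlimC] with x hx hxO
      obtain ⟨L, hL, hL0⟩ := hx hxO
      rw [hjL x L hL, hL0]
      simp
    · set G : ℂ → ℂ := cauchyTransform volume (fun t => ((j t / Real.pi : ℝ) : ℂ)) with hG
      have hji' : Integrable fun t => j t / Real.pi := hji.div_const _
      obtain ⟨a, ha⟩ := exists_eq_real_of_im_eq_zero (G := fun z => F z - G z)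
        ((hμ.differentiableOn_residualStieltjes n).sub
          (differentiableOn_cauchyTransform hji'.ofReal)) (by
        intro z hz
        have h1 := cauchyTransform_im hji' z.re hz
        rw [Complex.re_add_im, ← hG] at h1
        have h2 := hrep z hz
        rw [Complex.sub_im, h1]
        simp_rw [mul_div_assoc']
        rw [integral_div, ← h2]
        field_simp
        ring)
      refine ⟨a, fun z hz => ?_⟩
      rcases lt_or_gt_of_ne hz with hz | hz
      · have h1 := ha ((starRingEnd ℂ) z) (by simpa using hz)
        have h2 : G ((starRingEnd ℂ) z) = (starRingEnd ℂ) (G z) := by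
          have := cauchyTransform_conj (μ := volume) (fun t => ((j t / Real.pi : ℝ) : ℂ)) z
          simp only [Complex.conj_ofReal] at this
          exact this
        rw [hF, residualStieltjes_conj, ← hF, h2, ← map_sub] at h1
        have h3 := congrArg (starRingEnd ℂ) h1
        rw [Complex.conj_conj, Complex.conj_ofReal] at h3
        rw [← h3]; ring
      · rw [← ha z hz]; ring
end OP

/-! ## Change of variables from momenta to frequencies -/

namespace Bath

/-- The standing hypotheses on a bath. -/
structure Regular (B : Bath) : Prop where
  lt : B.kMin < B.kMax
  diff : DifferentiableOn ℝ B.g B.K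
  inj : Set.InjOn B.g B.K
  memLp : MemLp B.h 2 (volume.restrict B.K)
  moments : B.FiniteMoments
  gapless : B.Gapless

/-- The open momentum interval. -/
def openK (B : Bath) : Set ℝ := {k | B.kMin < (k : EReal) ∧ (k : EReal) < B.kMax}

variable {B : Bath}

theorem openK_subset : B.openK ⊆ B.K := fun _ h => ⟨h.1.le, h.2.le⟩

theorem isOpen_openK : IsOpen B.openK :=
  (isOpen_Ioo (a := B.kMin) (b := B.kMax)).preimage continuous_coe_real_ereal

theorem isOpen_freq : IsOpen B.freq :=
  (isOpen_Ioo (a := B.ωMin) (b := B.ωMax)).preimage continuous_coe_real_ereal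

theorem ordConnected_freq : B.freq.OrdConnected :=
  ⟨fun _ hx _ hy _ hz => ⟨hx.1.trans_le (EReal.coe_le_coe_iff.2 hz.1),
    (EReal.coe_le_coe_iff.2 hz.2).trans_lt hy.2⟩⟩

theorem ordConnected_K : B.K.OrdConnected :=
  ⟨fun _ hx _ hy _ hz => ⟨hx.1.trans (EReal.coe_le_coe_iff.2 hz.1),
    (EReal.coe_le_coe_iff.2 hz.2).trans hy.2⟩⟩

theorem measurableSet_K : MeasurableSet B.K :=
  (isClosed_Icc (a := B.kMin) (b := B.kMax)).preimage continuous_coe_real_ereal |>.measurableSet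

theorem restrict_K_eq : volume.restrict B.K = volume.restrict B.openK := by
  refine (Measure.restrict_congr_set ?_).symm
  have hcount : (B.K \ B.openK).Countable := by
    refine ((Set.countable_singleton B.kMax.toReal).insert B.kMin.toReal).mono ?_
    rintro k ⟨⟨h1, h2⟩, h3⟩
    rcases h1.lt_or_eq with h1 | h1
    · rcases h2.lt_or_eq with h2 | h2
      · exact absurd ⟨h1, h2⟩ h3
      · right; simp [← h2]
    · left; simp [h1]
  have h0 : volume (B.K \ B.openK) = 0 := hcount.measure_zero volume
  exact openK_subset.eventuallyLE.antisymm (ae_le_set.2 h0)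

namespace Regular

theorem exists_between (h : B.Regular) : ∃ k, k ∈ B.openK :=
  let ⟨x, h1, h2⟩ := EReal.lt_iff_exists_real_btwn.1 h.lt
  ⟨x, h1, h2⟩

theorem continuousOn (h : B.Regular) : ContinuousOn B.g B.K := h.diff.continuousOn

/-- A continuous injective function on an interval is strictly monotone, so an interior value lies
strictly between values on either side. -/
theorem g_mem_freq (h : B.Regular) {k : ℝ} (hk : k ∈ B.openK) : B.g k ∈ B.freq := by
  obtain ⟨k₁, h1, h1'⟩ := EReal.lt_iff_exists_real_btwn.1 hk.1
  obtain ⟨k₂, h2', h2⟩ := EReal.lt_iff_exists_real_btwn.1 hk.2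
  have h1k : k₁ < k := EReal.coe_lt_coe_iff.1 h1'
  have h2k : k < k₂ := EReal.coe_lt_coe_iff.1 h2'
  have m1 : k₁ ∈ B.K := ⟨h1.le, (h1'.trans hk.2).le⟩
  have m2 : k₂ ∈ B.K := ⟨(hk.1.trans h2').le, h2.le⟩
  have hsub : Set.Icc k₁ k₂ ⊆ B.K := ordConnected_K.out m1 m2
  have i0 : k ∈ Set.Icc k₁ k₂ := ⟨h1k.le, h2k.le⟩
  have i1 : k₁ ∈ Set.Icc k₁ k₂ := ⟨le_rfl, (h1k.trans h2k).le⟩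
  have i2 : k₂ ∈ Set.Icc k₁ k₂ := ⟨(h1k.trans h2k).le, le_rfl⟩
  have key : ∀ a ∈ B.K, ∀ b ∈ B.K, B.g a < B.g k → B.g k < B.g b → B.g k ∈ B.freq :=
    fun a ha b hb hak hkb =>
    ⟨(iInf₂_le a ha).trans_lt (EReal.coe_lt_coe_iff.2 hak),
      (EReal.coe_lt_coe_iff.2 hkb).trans_le (le_iSup₂ (f := fun k _ => (B.g k : EReal)) b hb)⟩
  rcases (h.continuousOn.mono hsub).strictMonoOn_of_injOn_Icc' (h1k.trans h2k).le
    (h.inj.mono hsub) with hm | hm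
  · exact key _ m1 _ m2 (hm i1 i0 h1k) (hm i0 i2 h2k)
  · exact key _ m2 _ m1 (hm i0 i2 h2k) (hm i1 i0 h1k)

theorem exists_g_eq (h : B.Regular) {ω : ℝ} (hω : ω ∈ B.freq) : ∃ k ∈ B.openK, B.g k = ω := by
  obtain ⟨a, ha, haω⟩ : ∃ a ∈ B.K, B.g a < ω := by
    have := hω.1
    simp only [ωMin, iInf_lt_iff, EReal.coe_lt_coe_iff] at this
    obtain ⟨a, ha, hl⟩ := this
    exact ⟨a, ha, hl⟩
  obtain ⟨b, hb, hbω⟩ : ∃ b ∈ B.K, ω < B.g b := by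
    have := hω.2
    simp only [ωMax, lt_iSup_iff, EReal.coe_lt_coe_iff] at this
    obtain ⟨a, ha, hl⟩ := this
    exact ⟨a, ha, hl⟩
  have hsub : Set.uIcc a b ⊆ B.K := ordConnected_K.uIcc_subset ha hb
  obtain ⟨k, hk, hkω⟩ := intermediate_value_uIcc (h.continuousOn.mono hsub)
    (show ω ∈ Set.uIcc (B.g a) (B.g b) from Set.Icc_subset_uIcc ⟨haω.le, hbω.le⟩)
  have hka : k ≠ a := by rintro rfl; exact haω.ne hkω
  have hkb : k ≠ b := by rintro rfl; exact hbω.ne' hkω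
  refine ⟨k, ?_, hkω⟩
  rcases Set.mem_uIcc.1 hk with ⟨h1, h2⟩ | ⟨h1, h2⟩
  · exact ⟨ha.1.trans_lt (EReal.coe_lt_coe_iff.2 (h1.lt_of_ne hka.symm)),
      (EReal.coe_lt_coe_iff.2 (h2.lt_of_ne hkb)).trans_le hb.2⟩
  · exact ⟨hb.1.trans_lt (EReal.coe_lt_coe_iff.2 (h1.lt_of_ne hkb.symm)),
      (EReal.coe_lt_coe_iff.2 (h2.lt_of_ne hka)).trans_le ha.2⟩

theorem image_g (h : B.Regular) : B.g '' B.openK = B.freq :=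
  Set.Subset.antisymm (by rintro _ ⟨k, hk, rfl⟩; exact h.g_mem_freq hk)
    fun _ hω => h.exists_g_eq hω

theorem gInv_g (h : B.Regular) {k : ℝ} (hk : k ∈ B.K) : B.gInv (B.g k) = k :=
  h.inj.leftInvOn_invFunOn hk

theorem nonempty_freq (h : B.Regular) : B.freq.Nonempty :=
  let ⟨_, hk⟩ := h.exists_between
  ⟨_, h.g_mem_freq hk⟩

theorem hasDerivAt_g (h : B.Regular) {k : ℝ} (hk : k ∈ B.openK) :
    HasDerivAt B.g (deriv B.g k) k :=
  ((h.diff k (openK_subset hk)).differentiableAt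
    (mem_of_superset (isOpen_openK.mem_nhds hk) openK_subset)).hasDerivAt

/-- A positive `J` forces `deriv gInv ≠ 0`. Since `deriv` is zero at points of
non-differentiability, the inverse is truly differentiable there and the chain rule applies. -/
theorem deriv_gInv_mul (h : B.Regular) {k : ℝ} (hk : k ∈ B.openK) :
    deriv B.gInv (B.g k) * deriv B.g k = 1 := by
  have hJ := h.gapless _ (h.g_mem_freq hk)
  have hd : deriv B.gInv (B.g k) ≠ 0 := by
    intro h0
    simp [J, h0] at hJ
  have hc := (differentiableAt_of_deriv_ne_zero hd).hasDerivAt.comp k (h.hasDerivAt_g hk)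
  have hid : B.gInv ∘ B.g =ᶠ[𝓝 k] id := by
    filter_upwards [isOpen_openK.mem_nhds hk] with x hx using h.gInv_g (openK_subset hx)
  exact (hc.congr_of_eventuallyEq hid.symm).unique (hasDerivAt_id k)

theorem deriv_ne_zero (h : B.Regular) {k : ℝ} (hk : k ∈ B.openK) : deriv B.g k ≠ 0 :=
  right_ne_zero_of_mul_eq_one (h.deriv_gInv_mul hk)

theorem h_ne_zero (h : B.Regular) {k : ℝ} (hk : k ∈ B.openK) : B.h k ≠ 0 := by
  intro h0
  have hJ := h.gapless _ (h.g_mem_freq hk)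
  simp [J, h.gInv_g (openK_subset hk), h0] at hJ

theorem abs_deriv_mul_J (h : B.Regular) (f : ℝ → ℝ) {k : ℝ} (hk : k ∈ B.openK) :
    |deriv B.g k| * ({ B with h := f } : Bath).J (B.g k) = Real.pi * f k ^ 2 := by
  have h1 : ({ B with h := f } : Bath).J (B.g k) =
      Real.pi * f (B.gInv (B.g k)) ^ 2 * |deriv B.gInv (B.g k)| := rfl
  rw [h1, h.gInv_g (openK_subset hk)]
  have h2 := congrArg abs (h.deriv_gInv_mul hk)
  rw [abs_mul, abs_one] at h2
  linear_combination Real.pi * f k ^ 2 * h2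

/-- Change of variables `ω = g(k)`. -/
theorem setIntegral_freq {E : Type*} [NormedAddCommGroup E] [NormedSpace ℝ E] (h : B.Regular)
    (ψ : ℝ → E) : ∫ ω in B.freq, ψ ω = ∫ k in B.K, |deriv B.g k| • ψ (B.g k) := by
  rw [restrict_K_eq, ← h.image_g]
  exact integral_image_eq_integral_abs_deriv_smul isOpen_openK.measurableSet
    (fun k hk => (h.hasDerivAt_g hk).hasDerivWithinAt) (h.inj.mono openK_subset) ψ

theorem integrableOn_freq_iff {E : Type*} [NormedAddCommGroup E] [NormedSpace ℝ E]
    (h : B.Regular) (ψ : ℝ → E) : IntegrableOn ψ B.freq ↔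
      IntegrableOn (fun k => |deriv B.g k| • ψ (B.g k)) B.K := by
  rw [IntegrableOn, IntegrableOn, restrict_K_eq, ← h.image_g]
  exact integrableOn_image_iff_integrableOn_abs_deriv_smul isOpen_openK.measurableSet
    (fun k hk => (h.hasDerivAt_g hk).hasDerivWithinAt) (h.inj.mono openK_subset) ψ

theorem ae_K {p : ℝ → Prop} (hp : ∀ k ∈ B.openK, p k) : ∀ᵐ k ∂volume.restrict B.K, p k := by
  rw [restrict_K_eq]
  exact (ae_restrict_iff' isOpen_openK.measurableSet).2 (ae_of_all _ hp)

theorem setIntegral_K (h : B.Regular) (f : ℝ → ℝ) (ψ : ℝ → ℂ) :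
    ∫ k in B.K, ((f k : ℂ) ^ 2 * ψ (B.g k)) =
      ∫ ω in B.freq, (({ B with h := f } : Bath).J ω / Real.pi) • ψ ω := by
  rw [h.setIntegral_freq]
  refine integral_congr_ae (ae_K fun k hk => ?_)
  have h1 := h.abs_deriv_mul_J f hk
  simp only [smul_smul, ← mul_div_assoc, h1]
  rw [mul_div_cancel_left₀ _ Real.pi_ne_zero, Complex.real_smul, Complex.ofReal_pow]

theorem integrableOn_K_iff (h : B.Regular) (f : ℝ → ℝ) (ψ : ℝ → ℂ) :
    IntegrableOn (fun k => (f k : ℂ) ^ 2 * ψ (B.g k)) B.K ↔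
      IntegrableOn (fun ω => (({ B with h := f } : Bath).J ω / Real.pi) • ψ ω) B.freq := by
  rw [h.integrableOn_freq_iff]
  refine integrable_congr (ae_K fun k hk => ?_)
  have h1 := h.abs_deriv_mul_J f hk
  simp only [smul_smul, ← mul_div_assoc, h1]
  rw [mul_div_cancel_left₀ _ Real.pi_ne_zero, Complex.real_smul, Complex.ofReal_pow]

theorem aemeasurable_g (h : B.Regular) : AEMeasurable B.g (volume.restrict B.K) :=
  h.continuousOn.aemeasurable measurableSet_K

end Regular

/-- The density of the spectral measure of the coupling function `f`, extended by zero. -/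
noncomputable def density (B : Bath) (f : ℝ → ℝ) : ℝ → ℝ :=
  B.freq.indicator fun ω => ({ B with h := f } : Bath).J ω / Real.pi

theorem J_nonneg (B : Bath) (ω : ℝ) : 0 ≤ B.J ω :=
  mul_nonneg (mul_nonneg Real.pi_pos.le (sq_nonneg _)) (abs_nonneg _)

theorem density_nonneg (B : Bath) (f : ℝ → ℝ) (ω : ℝ) : 0 ≤ B.density f ω :=
  Set.indicator_nonneg (fun ω _ => div_nonneg (J_nonneg _ ω) Real.pi_pos.le) ω

namespace Regular

theorem integral_density_smul (h : B.Regular) (f : ℝ → ℝ) (ψ : ℝ → ℂ) :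
    ∫ k in B.K, ((f k : ℂ) ^ 2 * ψ (B.g k)) = ∫ ω, B.density f ω • ψ ω := by
  rw [h.setIntegral_K, ← integral_indicator isOpen_freq.measurableSet]
  congr 1
  funext ω
  by_cases hω : ω ∈ B.freq <;> simp [density, hω]

theorem integrable_density_smul_iff (h : B.Regular) (f : ℝ → ℝ) (ψ : ℝ → ℂ) :
    IntegrableOn (fun k => (f k : ℂ) ^ 2 * ψ (B.g k)) B.K ↔
      Integrable (fun ω => B.density f ω • ψ ω) := by
  rw [h.integrableOn_K_iff, ← integrable_indicator_iff isOpen_freq.measurableSet]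
  refine iff_of_eq (congrArg (Integrable · volume) ?_)
  funext ω
  by_cases hω : ω ∈ B.freq <;> simp [density, hω]

theorem integrable_density (h : B.Regular) {f : ℝ → ℝ} (hf : MemLp f 2 (volume.restrict B.K)) :
    Integrable (B.density f) := by
  have h1 := (h.integrable_density_smul_iff f fun _ => 1).1 (by
    have h0 : Integrable (fun k => ((f k ^ 2 : ℝ) : ℂ)) (volume.restrict B.K) :=
      hf.integrable_sq.ofReal
    simpa [IntegrableOn] using h0)
  have h2 := h1.re
  simpa using h2

theorem _root_.Bath.lam_eq (B : Bath) :
    B.lam = volume.withDensity fun t => ENNReal.ofReal (B.density B.h t) := by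
  rw [lam, ← withDensity_indicator isOpen_freq.measurableSet]
  congr 1
  funext ω
  by_cases hω : ω ∈ B.freq <;> simp [density, hω]

theorem integrable_lam_iff {E : Type*} [NormedAddCommGroup E] [NormedSpace ℝ E]
    (h : B.Regular) (ψ : ℝ → E) :
    Integrable ψ B.lam ↔ Integrable fun t => B.density B.h t • ψ t := by
  rw [B.lam_eq, integrable_withDensity_iff_integrable_smul₀'
    (h.integrable_density h.memLp).1.aemeasurable.ennreal_ofReal
    (ae_of_all _ fun t => ENNReal.ofReal_lt_top)]
  simp_rw [ENNReal.toReal_ofReal (B.density_nonneg _ _)]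

theorem integral_lam {E : Type*} [NormedAddCommGroup E] [NormedSpace ℝ E] [CompleteSpace E]
    (h : B.Regular) (ψ : ℝ → E) :
    ∫ t, ψ t ∂B.lam = ∫ t, B.density B.h t • ψ t := by
  rw [B.lam_eq, integral_withDensity_eq_integral_toReal_smul₀
    (h.integrable_density h.memLp).1.aemeasurable.ennreal_ofReal
    (ae_of_all _ fun t => ENNReal.ofReal_lt_top)]
  simp_rw [ENNReal.toReal_ofReal (B.density_nonneg _ _)]

theorem integrable_eval (h : B.Regular) (p : ℝ[X]) : Integrable (fun x => p.eval x) B.lam := by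
  have hpow : ∀ n : ℕ, Integrable (fun x : ℝ => x ^ n) B.lam := fun n => by
    rw [h.integrable_lam_iff]
    refine (integrable_congr (ae_of_all _ fun ω => ?_)).1
      ((integrable_indicator_iff isOpen_freq.measurableSet).2 ((h.moments n).div_const Real.pi))
    by_cases hω : ω ∈ B.freq
    · simp only [density, Set.indicator_of_mem hω, smul_eq_mul]
      ring
    · simp [density, hω]
  simp_rw [eval_eq_sum_range]
  exact integrable_finsetSum _ fun i _ => (hpow i).const_mul _

theorem good (h : B.Regular) : OP.Good B.lam where
  integrable_pow n := by
    simpa using h.integrable_eval (X ^ n)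
  pos p hp := by
    have hint : Integrable fun t => B.density B.h t • (p.eval t * p.eval t) := by
      rw [← h.integrable_lam_iff]
      simp_rw [← eval_mul]
      exact h.integrable_eval (p * p)
    rw [h.integral_lam, integral_pos_iff_support_of_nonneg
      (fun t => smul_nonneg (B.density_nonneg _ _) (mul_self_nonneg _)) hint]
    have hsub : B.freq \ {x | p.IsRoot x} ⊆
        Function.support fun t => B.density B.h t • (p.eval t * p.eval t) := by
      rintro t ⟨ht, hr⟩
      have : p.eval t ≠ 0 := hr
      simp only [Function.mem_support, density, Set.indicator_of_mem ht, smul_eq_mul]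
      exact mul_ne_zero (div_pos (h.gapless t ht) Real.pi_pos).ne' (mul_ne_zero this this)
    refine lt_of_lt_of_le ?_ (measure_mono hsub)
    rw [measure_sdiff_null ((finite_setOfPred_isRoot hp).measure_zero volume)]
    exact isOpen_freq.measure_pos volume h.nonempty_freq

theorem densityOn (h : B.Regular) : OP.DensityOn B.lam (B.density B.h) B.freq where
  good := h.good
  integrable := h.integrable_density h.memLp
  eq_withDensity := B.lam_eq
  isOpen := isOpen_freq
  ordConnected := ordConnected_freq
  pos t ht := by
    rw [density, Set.indicator_of_mem ht]
    exact div_pos (h.gapless t ht) Real.pi_pos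
  zero t ht := Set.indicator_of_notMem ht _

end Regular

end Bath

/-! ## Resolvents of the one-particle energy -/

namespace Bath

variable {B : Bath}

theorem vec_eq {f : ℝ → ℝ} (hf : MemLp (fun k => (f k : ℂ)) 2 (volume.restrict B.K)) :
    B.vec f = hf.toLp := dif_pos hf

theorem coeFn_vec {f : ℝ → ℝ} (hf : MemLp f 2 (volume.restrict B.K)) :
    B.vec f =ᵐ[volume.restrict B.K] fun k => (f k : ℂ) := by
  have h0 : MemLp (fun k => (f k : ℂ)) 2 (volume.restrict B.K) := hf.ofReal
  rw [vec_eq h0]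
  exact h0.coeFn_toLp

theorem inner_H1 (u v : B.H1) :
    inner ℂ u v = ∫ k in B.K, (starRingEnd ℂ) (u k) * v k := by
  rw [L2.inner_def]
  simp_rw [RCLike.inner_apply']

theorem coeFn_mulG (u : B.domG) :
    B.mulG u =ᵐ[volume.restrict B.K] fun k => (B.g k : ℂ) * (u : B.H1) k :=
  (B.mem_domG u.2).coeFn_toLp

theorem mulG_inner (u v : B.domG) :
    inner ℂ (B.mulG u) (v : B.H1) = inner ℂ (u : B.H1) (B.mulG v) := by
  rw [inner_H1, inner_H1]
  refine integral_congr_ae ?_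
  filter_upwards [coeFn_mulG u, coeFn_mulG v] with k h1 h2
  rw [h1, h2, map_mul, Complex.conj_ofReal]
  ring

namespace Regular

theorem aestronglyMeasurable_res (h : B.Regular) (z : ℂ) :
    AEStronglyMeasurable (fun k => (z - B.g k)⁻¹) (volume.restrict B.K) := by
  have h1 : AEMeasurable (fun k => (B.g k : ℂ)) (volume.restrict B.K) :=
    Complex.measurable_ofReal.comp_aemeasurable h.aemeasurable_g
  exact (h1.const_sub z).inv.aestronglyMeasurable

theorem memLp_res (h : B.Regular) {z : ℂ} (hz : z.im ≠ 0) {u : ℝ → ℂ}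
    (hu : MemLp u 2 (volume.restrict B.K)) :
    MemLp (fun k => (z - B.g k)⁻¹ * u k) 2 (volume.restrict B.K) := by
  refine hu.of_le_mul (c := |z.im|⁻¹) ((h.aestronglyMeasurable_res z).mul hu.1)
    (ae_of_all _ fun k => ?_)
  rw [norm_mul, norm_inv]
  gcongr
  exact abs_im_le_norm_sub_ofReal z _

/-- The resolvent `(z - g)⁻¹` of the multiplication operator. -/
noncomputable def res (h : B.Regular) {z : ℂ} (hz : z.im ≠ 0) : B.H1 →L[ℂ] B.H1 :=
  LinearMap.mkContinuous
    { toFun := fun u => (h.memLp_res hz (Lp.memLp u)).toLp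
      map_add' := fun u v => by
        rw [← MemLp.toLp_add]
        refine (MemLp.toLp_eq_toLp_iff _ _).2 ?_
        filter_upwards [Lp.coeFn_add u v] with k hk
        rw [hk, Pi.add_apply, Pi.add_apply, mul_add]
      map_smul' := fun c u => by
        rw [RingHom.id_apply, ← MemLp.toLp_const_smul]
        refine (MemLp.toLp_eq_toLp_iff _ _).2 ?_
        filter_upwards [Lp.coeFn_smul c u] with k hk
        rw [hk, Pi.smul_apply, Pi.smul_apply, smul_eq_mul, smul_eq_mul, mul_left_comm] }
    |z.im|⁻¹ fun u => by
      refine Lp.norm_le_mul_norm_of_ae_le_mul ?_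
      filter_upwards [(h.memLp_res hz (Lp.memLp u)).coeFn_toLp] with k hk
      simp only [LinearMap.coe_mk, AddHom.coe_mk]
      rw [hk, norm_mul, norm_inv]
      gcongr
      exact abs_im_le_norm_sub_ofReal z _

theorem coeFn_res (h : B.Regular) {z : ℂ} (hz : z.im ≠ 0) (u : B.H1) :
    h.res hz u =ᵐ[volume.restrict B.K] fun k => (z - B.g k)⁻¹ * u k :=
  (h.memLp_res hz (Lp.memLp u)).coeFn_toLp

theorem res_mem_domG (h : B.Regular) {z : ℂ} (hz : z.im ≠ 0) (u : B.H1) :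
    h.res hz u ∈ B.domG := by
  have h1 : MemLp (fun k => z * (h.res hz u k) - u k) 2 (volume.restrict B.K) :=
    ((Lp.memLp (h.res hz u)).const_mul z).sub (Lp.memLp u)
  refine h1.ae_eq ?_
  filter_upwards [h.coeFn_res hz u] with k hk
  have := sub_ofReal_ne_zero hz (B.g k)
  rw [hk]
  field_simp
  ring

theorem mulG_res (h : B.Regular) {z : ℂ} (hz : z.im ≠ 0) (u : B.H1) :
    B.mulG ⟨h.res hz u, h.res_mem_domG hz u⟩ = z • h.res hz u - u := by
  refine Lp.ext ?_
  filter_upwards [coeFn_mulG ⟨h.res hz u, h.res_mem_domG hz u⟩, h.coeFn_res hz u,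
    Lp.coeFn_sub (z • h.res hz u) u, Lp.coeFn_smul z (h.res hz u)] with k h1 h2 h3 h4
  have := sub_ofReal_ne_zero hz (B.g k)
  rw [h1, h3, Pi.sub_apply, h4, Pi.smul_apply, smul_eq_mul, h2]
  field_simp
  ring

theorem res_smul_sub_mulG (h : B.Regular) {z : ℂ} (hz : z.im ≠ 0) (u : B.domG) :
    h.res hz (z • (u : B.H1) - B.mulG u) = u := by
  refine Lp.ext ?_
  filter_upwards [coeFn_mulG u, h.coeFn_res hz (z • (u : B.H1) - B.mulG u),
    Lp.coeFn_sub (z • (u : B.H1)) (B.mulG u), Lp.coeFn_smul z (u : B.H1)] with k h1 h2 h3 h4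
  have := sub_ofReal_ne_zero hz (B.g k)
  rw [h2, h3, Pi.sub_apply, h4, Pi.smul_apply, smul_eq_mul, h1]
  field_simp

theorem inner_res (h : B.Regular) {z : ℂ} (hz : z.im ≠ 0) (hz' : ((starRingEnd ℂ) z).im ≠ 0)
    (u v : B.H1) : inner ℂ (h.res hz u) v = inner ℂ u (h.res hz' v) := by
  rw [inner_H1, inner_H1]
  refine integral_congr_ae ?_
  filter_upwards [h.coeFn_res hz u, h.coeFn_res hz' v] with k h1 h2
  rw [h1, h2, map_mul, map_inv₀, map_sub, Complex.conj_ofReal]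
  ring

theorem res_res (h : B.Regular) {z w : ℂ} (hz : z.im ≠ 0) (hw : w.im ≠ 0) (u : B.H1) :
    (z - w) • h.res hz (h.res hw u) = h.res hw u - h.res hz u := by
  refine Lp.ext ?_
  filter_upwards [h.coeFn_res hz (h.res hw u), h.coeFn_res hw u, h.coeFn_res hz u,
    Lp.coeFn_sub (h.res hw u) (h.res hz u), Lp.coeFn_smul (z - w) (h.res hz (h.res hw u))]
    with k h1 h2 h3 h4 h5
  have := sub_ofReal_ne_zero hz (B.g k)
  have := sub_ofReal_ne_zero hw (B.g k)
  rw [h5, Pi.smul_apply, smul_eq_mul, h1, h4, Pi.sub_apply, h2, h3]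
  field_simp
  ring

theorem inner_vec_res_vec (h : B.Regular) {f : ℝ → ℝ} (hf : MemLp f 2 (volume.restrict B.K))
    {z : ℂ} (hz : z.im ≠ 0) : inner ℂ (B.vec f) (h.res hz (B.vec f)) =
      cauchyTransform volume (fun t => (B.density f t : ℂ)) z := by
  rw [inner_H1, cauchyTransform]
  have h1 := h.integral_density_smul f fun t => (z - t)⁻¹
  simp only [Complex.real_smul, ← div_eq_mul_inv] at h1
  rw [← h1]
  refine integral_congr_ae ?_
  filter_upwards [h.coeFn_res hz (B.vec f), coeFn_vec hf] with k h2 h3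
  rw [h2, h3, Complex.conj_ofReal]
  ring

/-- With `x = (z - g)⁻¹ u` one has `⟨u, x⟩ = conj z ‖x‖² - ⟨g x, x⟩`, and the last term is real.
Norms of resolvent vectors thereby become Poisson integrals. -/
theorem im_mul_norm_res_sq (h : B.Regular) {z : ℂ} (hz : z.im ≠ 0) (u : B.H1) :
    z.im * ‖h.res hz u‖ ^ 2 = -(inner ℂ u (h.res hz u)).im := by
  set x : B.domG := ⟨h.res hz u, h.res_mem_domG hz u⟩ with hx
  have h1 : u = z • (x : B.H1) - B.mulG x := by
    rw [hx, h.mulG_res hz u]; simp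
  have h2 : (inner ℂ (B.mulG x) (x : B.H1)).im = 0 := by
    refine Complex.conj_eq_iff_im.1 ?_
    rw [inner_conj_symm, mulG_inner]
  have h3 : inner ℂ u (h.res hz u) =
      (starRingEnd ℂ) z * ((‖(x : B.H1)‖ ^ 2 : ℝ) : ℂ) - inner ℂ (B.mulG x) (x : B.H1) := by
    conv_lhs => rw [h1]
    rw [show h.res hz (z • (x : B.H1) - B.mulG x) = x from h.res_smul_sub_mulG hz x,
      inner_sub_left, inner_smul_left, inner_self_eq_norm_sq_to_K]
    push_cast
    rfl
  rw [h3, Complex.sub_im, h2, Complex.im_mul_ofReal, Complex.conj_im]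
  simp [hx]

/-- The vectors `(z - g)⁻¹ f`, with `z` in two opposite open quadrants, are total if `f` does not
vanish. -/
theorem eq_zero_of_inner_res_eq_zero (h : B.Regular) {f : ℝ → ℝ}
    (hf : MemLp f 2 (volume.restrict B.K)) (hf0 : ∀ᵐ k ∂volume.restrict B.K, f k ≠ 0) (v : B.H1)
    (hv : ∀ (z : ℂ) (hz : z.im ≠ 0), 0 < z.re * z.im → inner ℂ (h.res hz (B.vec f)) v = 0) :
    v = 0 := by
  -- The product `f v` transported to the frequency axis; its Cauchy transform collects the inner
  -- products of `v` with the resolvent vectors.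
  set V : ℝ → ℂ := B.freq.indicator fun ω =>
    |deriv B.gInv ω| • ((f (B.gInv ω) : ℂ) * v (B.gInv ω)) with hV
  have hVg : ∀ k ∈ B.openK, |deriv B.g k| • V (B.g k) = f k * v k := fun k hk => by
    rw [hV, Set.indicator_of_mem (h.g_mem_freq hk), h.gInv_g (openK_subset hk), smul_smul,
      ← abs_mul, mul_comm (deriv B.g k), h.deriv_gInv_mul hk, abs_one, one_smul]
  have hfv : Integrable (fun k => (f k : ℂ) * v k) (volume.restrict B.K) :=
    hf.ofReal.integrable_mul (Lp.memLp v)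
  have hVi : Integrable V := by
    rw [← integrableOn_iff_integrable_of_support_subset
      (Set.support_indicator_subset : Function.support V ⊆ B.freq), h.integrableOn_freq_iff]
    refine (integrable_congr (ae_K fun k hk => ?_)).2 hfv
    exact hVg k hk
  have hC : ∀ z : ℂ, z.im ≠ 0 → cauchyTransform volume V z =
      ∫ k in B.K, (z - B.g k)⁻¹ * (f k * v k) := fun z hz => by
    have h1 : cauchyTransform volume V z = ∫ ω in B.freq, V ω / (z - ω) := by
      rw [cauchyTransform, ← integral_indicator isOpen_freq.measurableSet]
      congr 1
      funext ω
      by_cases hω : ω ∈ B.freq <;> simp [hV, hω]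
    rw [h1, h.setIntegral_freq]
    refine integral_congr_ae (ae_K fun k hk => ?_)
    have := hVg k hk
    simp only [Complex.real_smul] at this ⊢
    rw [← this, div_eq_mul_inv]
    ring
  -- The first slot of the inner product conjugates `z`, so vanishing is known in the reflected
  -- quadrants. Each half-plane contains one of them, and the identity theorem extends the vanishing
  -- to both half-planes.
  have hCq : ∀ z : ℂ, z.re * z.im < 0 → cauchyTransform volume V z = 0 := fun z hz => by
    have hz' : ((starRingEnd ℂ) z).im ≠ 0 := by
      rw [Complex.conj_im]; exact neg_ne_zero.2 (right_ne_zero_of_mul hz.ne)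
    have hz0 : z.im ≠ 0 := right_ne_zero_of_mul hz.ne
    have h1 := hv _ hz' (by rw [Complex.conj_re, Complex.conj_im]; linarith)
    rw [hC z hz0, ← h1, inner_H1]
    refine integral_congr_ae ?_
    filter_upwards [h.coeFn_res hz' (B.vec f), coeFn_vec hf] with k h2 h3
    rw [h2, h3, map_mul, map_inv₀, map_sub, Complex.conj_ofReal, Complex.conj_conj,
      Complex.conj_ofReal, mul_assoc]
  have hC0 : ∀ z : ℂ, z.im ≠ 0 → cauchyTransform volume V z = 0 := by
    have key : ∀ (U : Set ℂ), IsOpen U → Convex ℝ U → (∀ z ∈ U, z.im ≠ 0) → (∃ z₀ ∈ U, z₀.re * z₀.im < 0) →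
        ∀ z ∈ U, cauchyTransform volume V z = 0 := by
      rintro U hUo hUc hU0 ⟨z₀, hz₀, hneg⟩ z hz
      have han : AnalyticOnNhd ℂ (cauchyTransform volume V) U :=
        DifferentiableOn.analyticOnNhd (fun z hz => (differentiableAt_cauchyTransform_of_im hVi
          (hU0 z hz)).differentiableWithinAt) hUo
      refine han.eqOn_zero_of_preconnected_of_eventuallyEq_zero hUc.isPreconnected hz₀ ?_ hz
      have : ∀ᶠ z : ℂ in 𝓝 z₀, z.re * z.im < 0 :=
        (Complex.continuous_re.mul Complex.continuous_im).continuousAt.eventually_lt_const hneg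
      filter_upwards [this] with z hz using hCq z hz
    intro z hz
    rcases lt_or_gt_of_ne hz with hz | hz
    · exact key {z | z.im < 0} (isOpen_lt Complex.continuous_im continuous_const)
        (convex_halfSpace_im_lt 0) (fun z hz => ne_of_lt hz) ⟨⟨1, -1⟩, by simp, by simp⟩ z hz
    · exact key {z | 0 < z.im} (isOpen_lt continuous_const Complex.continuous_im)
        (convex_halfSpace_im_gt 0) (fun z hz => ne_of_gt hz) ⟨⟨-1, 1⟩, by simp, by simp⟩ z hz
  -- The vanishing jump across the real line is a Poisson integral of `V`, which tends to `V` almost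
  -- everywhere.
  have hV0 : ∀ᵐ x, V x = 0 := by
    filter_upwards [ae_tendsto_poissonHP_of_integrable hVi] with x hx
    refine tendsto_nhds_unique (hx.congr' ?_) tendsto_const_nhds
    filter_upwards [self_mem_nhdsWithin] with y hy
    have hy : 0 < y := hy
    have h1 := cauchyTransform_jump hVi x hy
    rw [hC0 _ (by simpa using hy.ne'), hC0 _ (by simpa using hy.ne'), sub_zero] at h1
    have h2 : (2 * Real.pi * Complex.I : ℂ) ≠ 0 := by simp [Real.pi_ne_zero]
    exact (mul_eq_zero.1 h1.symm).resolve_left h2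
  have hnorm : ∫ k in B.K, ‖(f k : ℂ) * v k‖ = 0 := by
    have h1 : ∫ ω in B.freq, ‖V ω‖ = 0 :=
      integral_eq_zero_of_ae ((ae_restrict_of_ae hV0).mono fun x hx => by simp [hx])
    rw [h.setIntegral_freq] at h1
    rw [← h1]
    refine integral_congr_ae (ae_K fun k hk => ?_)
    simp only [← hVg k hk, norm_smul, norm_abs_eq_norm, smul_eq_mul, Real.norm_eq_abs]
  rw [integral_eq_zero_iff_of_nonneg (fun _ => norm_nonneg _) hfv.norm] at hnorm
  refine Lp.ext ?_
  filter_upwards [hnorm, hf0, Lp.coeFn_zero ℂ 2 (volume.restrict B.K)] with k h1 h2 h3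
  rw [h3, Pi.zero_apply]
  have h4 : (f k : ℂ) * v k = 0 := norm_eq_zero.1 h1
  exact (mul_eq_zero.1 h4).resolve_left (Complex.ofReal_ne_zero.2 h2)

end Regular

end Bath

/-! ## One-particle vectors given by functions of the frequency -/

namespace Bath

open Classical in
/-- The one-particle vector `k ↦ h(k) ψ(g(k))`. -/
noncomputable def specVec (B : Bath) (ψ : ℝ → ℂ) : B.H1 :=
  if hψ : MemLp (fun k => (B.h k : ℂ) * ψ (B.g k)) 2 (volume.restrict B.K) then hψ.toLp else 0

/-- The one-particle vector `p(g) h` of a polynomial `p`. -/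
noncomputable def polyVec (B : Bath) (p : ℝ[X]) : B.H1 :=
  B.specVec fun t => ((p.eval t : ℝ) : ℂ)

variable {B : Bath}

/-- The measurable square integrable functions of the frequency. -/
structure SpecFun (B : Bath) (ψ : ℝ → ℂ) : Prop where
  measurable : Measurable ψ
  memLp : MemLp ψ 2 B.lam

theorem SpecFun.add {ψ χ : ℝ → ℂ} (hψ : B.SpecFun ψ) (hχ : B.SpecFun χ) :
    B.SpecFun fun t => ψ t + χ t := ⟨hψ.1.add hχ.1, hψ.2.add hχ.2⟩

theorem SpecFun.const_mul {ψ : ℝ → ℂ} (c : ℂ) (hψ : B.SpecFun ψ) : B.SpecFun fun t => c * ψ t :=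
  ⟨hψ.1.const_mul c, hψ.2.const_mul c⟩

namespace Regular

variable {ψ χ : ℝ → ℂ}

theorem aestronglyMeasurable_comp_g (h : B.Regular) (hψ : Measurable ψ) :
    AEStronglyMeasurable (fun k => ψ (B.g k)) (volume.restrict B.K) :=
  (hψ.comp_aemeasurable h.aemeasurable_g).aestronglyMeasurable

theorem memLp_spec (h : B.Regular) (hψ : B.SpecFun ψ) :
    MemLp (fun k => (B.h k : ℂ) * ψ (B.g k)) 2 (volume.restrict B.K) := by
  have hm : AEStronglyMeasurable (fun k => (B.h k : ℂ) * ψ (B.g k)) (volume.restrict B.K) :=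
    h.memLp.ofReal.1.mul (h.aestronglyMeasurable_comp_g hψ.measurable)
  rw [memLp_two_iff_integrable_sq_norm hm]
  have h1 := hψ.memLp.integrable_norm_pow (p := 2) (by norm_num)
  have h2 : Integrable (fun t => ((‖ψ t‖ ^ 2 : ℝ) : ℂ)) B.lam := by
    simpa using h1.ofReal (𝕜 := ℂ)
  rw [h.integrable_lam_iff] at h2
  have h3 := ((h.integrable_density_smul_iff B.h _).2 h2).re
  refine (integrable_congr (ae_of_all _ fun k => ?_)).1 h3
  simp only [norm_mul, mul_pow, Complex.norm_real, Real.norm_eq_abs, sq_abs]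
  rw [← Complex.ofReal_pow, ← Complex.ofReal_mul]
  exact Complex.ofReal_re _

theorem coeFn_specVec (h : B.Regular) (hψ : B.SpecFun ψ) :
    B.specVec ψ =ᵐ[volume.restrict B.K] fun k => (B.h k : ℂ) * ψ (B.g k) := by
  rw [specVec, dif_pos (h.memLp_spec hψ)]
  exact (h.memLp_spec hψ).coeFn_toLp

theorem inner_specVec (h : B.Regular) (hψ : B.SpecFun ψ) (hχ : B.SpecFun χ) :
    inner ℂ (B.specVec ψ) (B.specVec χ) = ∫ t, (starRingEnd ℂ) (ψ t) * χ t ∂B.lam := by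
  rw [h.integral_lam, ← h.integral_density_smul, inner_H1]
  refine integral_congr_ae ?_
  filter_upwards [h.coeFn_specVec hψ, h.coeFn_specVec hχ] with k h1 h2
  rw [h1, h2, map_mul, Complex.conj_ofReal]
  ring

theorem specVec_add (h : B.Regular) (hψ : B.SpecFun ψ) (hχ : B.SpecFun χ) :
    B.specVec (fun t => ψ t + χ t) = B.specVec ψ + B.specVec χ := by
  refine Lp.ext ?_
  filter_upwards [h.coeFn_specVec (hψ.add hχ), h.coeFn_specVec hψ, h.coeFn_specVec hχ,
    Lp.coeFn_add (B.specVec ψ) (B.specVec χ)] with k h1 h2 h3 h4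
  rw [h1, h4, Pi.add_apply, h2, h3, mul_add]

theorem specVec_const_mul (h : B.Regular) (c : ℂ) (hψ : B.SpecFun ψ) :
    B.specVec (fun t => c * ψ t) = c • B.specVec ψ := by
  refine Lp.ext ?_
  filter_upwards [h.coeFn_specVec (hψ.const_mul c), h.coeFn_specVec hψ,
    Lp.coeFn_smul c (B.specVec ψ)] with k h1 h2 h4
  rw [h1, h4, Pi.smul_apply, smul_eq_mul, h2, mul_left_comm]

theorem specFun_eval (h : B.Regular) (p : ℝ[X]) : B.SpecFun fun t => ((p.eval t : ℝ) : ℂ) :=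
  ⟨(Complex.continuous_ofReal.comp p.continuous).measurable, h.good.memLp_eval p⟩

theorem specFun_div (_ : B.Regular) {z : ℂ} (hz : z.im ≠ 0) (hψ : B.SpecFun ψ) :
    B.SpecFun fun t => ψ t / (z - t) :=
  ⟨hψ.1.div (measurable_const.sub Complex.measurable_ofReal), OP.memLp_div_sub hψ.2 hz⟩

theorem res_specVec (h : B.Regular) {z : ℂ} (hz : z.im ≠ 0) (hψ : B.SpecFun ψ) :
    h.res hz (B.specVec ψ) = B.specVec fun t => ψ t / (z - t) := by
  refine Lp.ext ?_
  filter_upwards [h.coeFn_specVec hψ, h.coeFn_specVec (h.specFun_div hz hψ),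
    h.coeFn_res hz (B.specVec ψ)] with k h1 h2 h3
  rw [h3, h1, h2]
  ring

/-! ### Polynomial vectors and the chain modes -/

theorem coeFn_polyVec (h : B.Regular) (p : ℝ[X]) :
    B.polyVec p =ᵐ[volume.restrict B.K] fun k => (B.h k : ℂ) * ((p.eval (B.g k) : ℝ) : ℂ) :=
  h.coeFn_specVec (h.specFun_eval p)

theorem polyVec_add (h : B.Regular) (p q : ℝ[X]) :
    B.polyVec (p + q) = B.polyVec p + B.polyVec q := by
  rw [polyVec, polyVec, polyVec, ← h.specVec_add (h.specFun_eval p) (h.specFun_eval q)]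
  simp

theorem polyVec_C_mul (h : B.Regular) (c : ℝ) (p : ℝ[X]) :
    B.polyVec (C c * p) = (c : ℂ) • B.polyVec p := by
  rw [polyVec, polyVec, ← h.specVec_const_mul c (h.specFun_eval p)]
  simp

theorem polyVec_one (h : B.Regular) : B.polyVec 1 = B.vec B.h := by
  refine Lp.ext ?_
  filter_upwards [h.coeFn_polyVec 1, coeFn_vec h.memLp] with k h1 h2
  simp [h1, h2]

theorem inner_polyVec (h : B.Regular) (p q : ℝ[X]) :
    inner ℂ (B.polyVec p) (B.polyVec q) = (OP.mom B.lam (p * q) : ℂ) := by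
  rw [polyVec, polyVec, h.inner_specVec (h.specFun_eval p) (h.specFun_eval q), OP.mom,
    ← integral_complex_ofReal]
  simp

theorem chainMode_eq (h : B.Regular) (n : ℕ) :
    B.chainMode n = B.polyVec (OP.orthonormalPoly B.lam n) := by
  have : (fun k => (((OP.monicPoly B.lam n).eval (B.g k) * B.h k /
      √(OP.normSq B.lam n) : ℝ) : ℂ)) = fun k =>
      (B.h k : ℂ) * (((OP.orthonormalPoly B.lam n).eval (B.g k) : ℝ) : ℂ) := by
    funext k
    rw [OP.orthonormalPoly_def, eval_mul, eval_C]
    push_cast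
    ring
  have h1 := h.memLp_spec (h.specFun_eval (OP.orthonormalPoly B.lam n))
  have h2 := h1
  rw [← this] at h2
  rw [chainMode, vec_eq h2, polyVec, specVec, dif_pos h1]
  exact (MemLp.toLp_eq_toLp_iff h2 h1).2 (ae_of_all _ (congrFun this))

theorem polyVec_mem_domG (h : B.Regular) (p : ℝ[X]) : B.polyVec p ∈ B.domG := by
  refine (h.memLp_spec (h.specFun_eval (X * p))).ae_eq ?_
  filter_upwards [h.coeFn_polyVec p] with k h1
  rw [h1, eval_mul, eval_X]
  push_cast
  ring

theorem mulG_polyVec (h : B.Regular) (p : ℝ[X]) :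
    B.mulG ⟨B.polyVec p, h.polyVec_mem_domG p⟩ = B.polyVec (X * p) := by
  refine Lp.ext ?_
  filter_upwards [coeFn_mulG ⟨B.polyVec p, h.polyVec_mem_domG p⟩, h.coeFn_polyVec p,
    h.coeFn_polyVec (X * p)] with k h1 h2 h3
  rw [h1, h2, h3, eval_mul, eval_X]
  push_cast
  ring

theorem inner_chainMode (h : B.Regular) (m n : ℕ) :
    inner ℂ (B.chainMode m) (B.chainMode n) = if m = n then 1 else 0 := by
  rw [h.chainMode_eq, h.chainMode_eq, h.inner_polyVec,
    h.good.mom_orthonormalPoly_mul_orthonormalPoly]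
  split_ifs <;> simp

theorem chainMode_mem_domG (h : B.Regular) (n : ℕ) : B.chainMode n ∈ B.domG := by
  rw [h.chainMode_eq]
  exact h.polyVec_mem_domG _

theorem mulG_chainMode (h : B.Regular) (n : ℕ) :
    B.mulG ⟨B.chainMode n, h.chainMode_mem_domG n⟩ =
      B.polyVec (X * OP.orthonormalPoly B.lam n) := by
  rw [← h.mulG_polyVec]
  congr 2
  exact h.chainMode_eq n

theorem mulG_chainMode_zero (h : B.Regular) :
    B.mulG ⟨B.chainMode 0, h.chainMode_mem_domG 0⟩ =
      ((√(OP.beta B.lam 1) : ℝ) : ℂ) • B.chainMode 1 + (OP.alpha B.lam 0 : ℂ) • B.chainMode 0 := by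
  rw [h.mulG_chainMode, h.good.recurrence_zero, h.polyVec_add, h.polyVec_C_mul, h.polyVec_C_mul,
    h.chainMode_eq, h.chainMode_eq]

theorem mulG_chainMode_succ (h : B.Regular) (n : ℕ) :
    B.mulG ⟨B.chainMode (n + 1), h.chainMode_mem_domG (n + 1)⟩ =
      ((√(OP.beta B.lam (n + 2)) : ℝ) : ℂ) • B.chainMode (n + 2) +
      (OP.alpha B.lam (n + 1) : ℂ) • B.chainMode (n + 1) +
      ((√(OP.beta B.lam (n + 1)) : ℝ) : ℂ) • B.chainMode n := by
  rw [h.mulG_chainMode, h.good.recurrence, h.polyVec_add, h.polyVec_add, h.polyVec_C_mul,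
    h.polyVec_C_mul, h.polyVec_C_mul, h.chainMode_eq, h.chainMode_eq, h.chainMode_eq]

theorem vec_h_eq (h : B.Regular) :
    B.vec B.h = ((√(OP.beta B.lam 0) : ℝ) : ℂ) • B.chainMode 0 := by
  have hb := h.good.normSq_pos 0
  rw [← h.polyVec_one, h.chainMode_eq, ← h.polyVec_C_mul, OP.orthonormalPoly_def]
  congr 1
  rw [OP.monicPoly_eq, OP.beta, ← mul_assoc, ← C_mul, mul_one_div_cancel (Real.sqrt_pos.2 hb).ne']
  simp

theorem inner_chainMode_res (h : B.Regular) {z : ℂ} (hz : z.im ≠ 0) (n : ℕ) :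
    inner ℂ (B.chainMode n) (h.res hz (B.vec B.h)) =
      OP.secondKind B.lam (OP.orthonormalPoly B.lam n) z := by
  rw [h.chainMode_eq, ← h.polyVec_one, polyVec, polyVec, h.res_specVec hz (h.specFun_eval 1),
    h.inner_specVec (h.specFun_eval _) (h.specFun_div hz (h.specFun_eval 1)), OP.secondKind,
    cauchyTransform]
  simp [div_eq_mul_inv]

end Regular

end Bath

/-! ## The formula for the residual spectral densities -/

namespace Bath.Regular

variable {B : Bath}

/-- Decomposition of a vector along the first chain sites and the range of `W`. -/
theorem decomposition (h : B.Regular) {n : ℕ} {W : B.H1 →ₗᵢ[ℂ] B.H1}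
    (hr : W.toLinearMap.range = (Submodule.span ℂ (B.chainMode '' {j | j < n + 1}))ᗮ) (u : B.H1) :
    u = ∑ j ∈ Finset.range (n + 1), inner ℂ (B.chainMode j) u • B.chainMode j +
      W (W.toContinuousLinearMap.adjoint u) := by
  set A := W.toContinuousLinearMap.adjoint with hA
  have hWinner : ∀ x y : B.H1, inner ℂ (A x) y = inner ℂ x (W y) := fun x y =>
    ContinuousLinearMap.adjoint_inner_left _ _ _
  have hAW : ∀ y, A (W y) = y := fun y => by
    refine ext_inner_right ℂ fun v => ?_
    rw [hWinner, W.inner_map_map]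
  have hUW : ∀ j ∈ Finset.range (n + 1), ∀ y, inner ℂ (B.chainMode j) (W y) = 0 := fun j hj y => by
    have : W y ∈ W.toLinearMap.range := ⟨y, rfl⟩
    rw [hr] at this
    exact this _ (Submodule.subset_span ⟨j, Finset.mem_range.1 hj, rfl⟩)
  set r := u - ∑ j ∈ Finset.range (n + 1), inner ℂ (B.chainMode j) u • B.chainMode j with hrdef
  have hrU : r ∈ (Submodule.span ℂ (B.chainMode '' {j | j < n + 1}))ᗮ := by
    rw [Submodule.mem_orthogonal]
    intro x hx
    induction hx using Submodule.span_induction with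
    | mem x hx =>
      obtain ⟨i, hi, rfl⟩ := hx
      have hi' : i ∈ Finset.range (n + 1) := Finset.mem_range.2 hi
      rw [hrdef, inner_sub_right, inner_sum]
      simp [inner_smul_right, h.inner_chainMode, hi', -Finset.mem_range]
    | zero => simp
    | add x y _ _ hx hy => rw [inner_add_left, hx, hy, add_zero]
    | smul c x _ hx => rw [inner_smul_left, hx, mul_zero]
  rw [← hr] at hrU
  obtain ⟨y, hy⟩ := hrU
  have hy' : W y = r := hy
  have hAr : A u = y := by
    have h1 : A r = A u := by
      refine ext_inner_right ℂ fun v => ?_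
      rw [hWinner, hWinner, hrdef, inner_sub_left, sum_inner, Finset.sum_eq_zero, sub_zero]
      intro j hj
      rw [inner_smul_left, hUW j hj, mul_zero]
    rw [← h1, ← hy', hAW]
  rw [hAr, hy', hrdef]
  abel

theorem adjoint_chainMode {n : ℕ} {W : B.H1 →ₗᵢ[ℂ] B.H1}
    (hr : W.toLinearMap.range = (Submodule.span ℂ (B.chainMode '' {j | j < n + 1}))ᗮ)
    {j : ℕ} (hj : j < n + 1) : W.toContinuousLinearMap.adjoint (B.chainMode j) = 0 := by
  refine ext_inner_right ℂ fun y => ?_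
  rw [ContinuousLinearMap.adjoint_inner_left, inner_zero_left]
  have : W y ∈ W.toLinearMap.range := ⟨y, rfl⟩
  rw [hr] at this
  exact this _ (Submodule.subset_span ⟨j, hj, rfl⟩)

theorem adjoint_apply (W : B.H1 →ₗᵢ[ℂ] B.H1) (y : B.H1) :
    W.toContinuousLinearMap.adjoint (W y) = y := by
  refine ext_inner_right ℂ fun v => ?_
  rw [ContinuousLinearMap.adjoint_inner_left]
  exact W.inner_map_map y v

theorem norm_sq_decomposition (h : B.Regular) {n : ℕ} {W : B.H1 →ₗᵢ[ℂ] B.H1}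
    (hr : W.toLinearMap.range = (Submodule.span ℂ (B.chainMode '' {j | j < n + 1}))ᗮ) (u : B.H1) :
    ‖u‖ ^ 2 = ∑ j ∈ Finset.range (n + 1), ‖inner ℂ (B.chainMode j) u‖ ^ 2 +
      ‖W.toContinuousLinearMap.adjoint u‖ ^ 2 := by
  have h1 : inner ℂ u u = ∑ j ∈ Finset.range (n + 1),
      (((‖inner ℂ (B.chainMode j) u‖ ^ 2 : ℝ)) : ℂ) +
      ((‖W.toContinuousLinearMap.adjoint u‖ ^ 2 : ℝ) : ℂ) := by
    conv_lhs => rw [h.decomposition hr u]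
    rw [inner_add_left, sum_inner]
    congr 1
    · refine Finset.sum_congr rfl fun j _ => ?_
      conv_lhs => rw [← h.decomposition hr u]
      rw [inner_smul_left, Complex.conj_mul']
      push_cast
      rfl
    · rw [← h.decomposition hr u]
      have := ContinuousLinearMap.adjoint_inner_right W.toContinuousLinearMap
        (W.toContinuousLinearMap.adjoint u) u
      rw [inner_self_eq_norm_sq_to_K] at this
      push_cast
      exact this.symm
  rw [inner_self_eq_norm_sq_to_K, ← Complex.ofReal_sum, ← Complex.ofReal_add] at h1
  exact Complex.ofReal_injective ((Complex.ofReal_pow _ _).trans h1)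

/-- The resolvent formula for a residual environment. -/
theorem adjoint_res_vec (h : B.Regular) {n : ℕ} {W : B.H1 →ₗᵢ[ℂ] B.H1}
    (hW : ∀ u, u ∈ B.domG → W.toContinuousLinearMap.adjoint u ∈ B.domG)
    (hr : W.toLinearMap.range = (Submodule.span ℂ (B.chainMode '' {j | j < n + 1}))ᗮ) {hm : ℝ → ℝ}
    (hid : ∀ u : B.domG, W.toContinuousLinearMap.adjoint (B.mulG u) =
      B.mulG ⟨W.toContinuousLinearMap.adjoint u, hW u u.2⟩ +
        inner ℂ (B.chainMode n) (u : B.H1) • B.vec hm) {z : ℂ} (hz : z.im ≠ 0) :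
    W.toContinuousLinearMap.adjoint (h.res hz (B.vec B.h)) =
      OP.secondKind B.lam (OP.orthonormalPoly B.lam n) z • h.res hz (B.vec hm) := by
  set A := W.toContinuousLinearMap.adjoint with hA
  have h1 := hid ⟨h.res hz (B.vec B.h), h.res_mem_domG hz _⟩
  rw [h.mulG_res, map_sub, map_smul, h.inner_chainMode_res hz] at h1
  -- The coupling function is a multiple of `U_0`, which is orthogonal to the range of `W`.
  have h2 : A (B.vec B.h) = 0 := by
    rw [h.vec_h_eq, map_smul, adjoint_chainMode hr (Nat.succ_pos n), smul_zero]
  rw [h2, sub_zero] at h1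
  have h3 := h.res_smul_sub_mulG hz ⟨A (h.res hz (B.vec B.h)), hW _ (h.res_mem_domG hz _)⟩
  refine h3.symm.trans ?_
  rw [← (h.res hz).map_smul]
  exact congrArg (h.res hz) (sub_eq_iff_eq_add'.2 h1)

/-- Parseval for `(z - g)⁻¹ h` along the chain sites and the range of `W`, multiplied by `Im z`. The
resolvent norms turn into Poisson integrals and converge to the densities; the functions of the
second kind have finite limits, so the chain terms vanish with the factor `Im z`. -/
theorem residual_density_eq (h : B.Regular) {n : ℕ} {W : B.H1 →ₗᵢ[ℂ] B.H1}
    (hW : ∀ u, u ∈ B.domG → W.toContinuousLinearMap.adjoint u ∈ B.domG)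
    (hr : W.toLinearMap.range = (Submodule.span ℂ (B.chainMode '' {j | j < n + 1}))ᗮ) {hm : ℝ → ℝ}
    (hhm : MemLp hm 2 (volume.restrict B.K))
    (hid : ∀ u : B.domG, W.toContinuousLinearMap.adjoint (B.mulG u) =
      B.mulG ⟨W.toContinuousLinearMap.adjoint u, hW u u.2⟩ +
        inner ℂ (B.chainMode n) (u : B.H1) • B.vec hm) :
    ∀ᵐ x : ℝ, ∃ l : ℂ,
      Tendsto (fun y : ℝ => OP.stieltjes B.lam (x + y * Complex.I)) (𝓝[>] 0) (𝓝 l) ∧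
      l.im = -Real.pi * B.density B.h x ∧
      B.density B.h x = ‖(((OP.orthonormalPoly B.lam n).eval x : ℝ) : ℂ) * l -
        (((OP.sec B.lam (OP.orthonormalPoly B.lam n)).eval x : ℝ) : ℂ)‖ ^ 2 * B.density hm x := by
  have hd := h.densityOn
  have hi0 := h.integrable_density h.memLp
  have him := h.integrable_density hhm
  set P := OP.orthonormalPoly B.lam with hP
  filter_upwards [hd.ae_exists_tendsto_stieltjes, ae_tendsto_poissonHP_of_integrable hi0,
    ae_tendsto_poissonHP_of_integrable him] with x ⟨l, hl, hlim⟩ h0 hm'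
  refine ⟨l, hl, hlim, ?_⟩
  have hsec : ∀ p : ℝ[X], Tendsto (fun y : ℝ => OP.secondKind B.lam p (x + y * Complex.I)) (𝓝[>] 0)
      (𝓝 (((p.eval x : ℝ) : ℂ) * l - (((OP.sec B.lam p).eval x : ℝ) : ℂ))) := fun p =>
    h.good.tendsto_secondKind hl p
  have key : ∀ y : ℝ, 0 < y → Real.pi * ∫ t, poissonHP y (x - t) * B.density B.h t =
      y * ∑ j ∈ Finset.range (n + 1), ‖OP.secondKind B.lam (P j) (x + y * Complex.I)‖ ^ 2 +
      ‖OP.secondKind B.lam (P n) (x + y * Complex.I)‖ ^ 2 *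
        (Real.pi * ∫ t, poissonHP y (x - t) * B.density hm t) := by
    intro y hy
    have him' : (x + y * Complex.I : ℂ).im = y := by simp
    have hz : (x + y * Complex.I : ℂ).im ≠ 0 := by rw [him']; exact hy.ne'
    have e : ∀ f : ℝ → ℝ, MemLp f 2 (volume.restrict B.K) →
        Real.pi * ∫ t, poissonHP y (x - t) * B.density f t = y * ‖h.res hz (B.vec f)‖ ^ 2 := by
      intro f hf
      have h1 := h.im_mul_norm_res_sq hz (B.vec f)
      rw [h.inner_vec_res_vec hf hz, him',
        cauchyTransform_im (h.integrable_density hf) x hy] at h1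
      rw [h1]; ring
    rw [e _ h.memLp, e _ hhm, h.norm_sq_decomposition hr, h.adjoint_res_vec hW hr hid hz,
      norm_smul, mul_pow, mul_add]
    simp_rw [h.inner_chainMode_res hz]
    ring
  have hL : Tendsto (fun y => Real.pi * ∫ t, poissonHP y (x - t) * B.density B.h t) (𝓝[>] 0)
      (𝓝 (Real.pi * B.density B.h x)) := h0.const_mul _
  have hR : Tendsto (fun y : ℝ =>
      y * ∑ j ∈ Finset.range (n + 1), ‖OP.secondKind B.lam (P j) (x + y * Complex.I)‖ ^ 2 +
      ‖OP.secondKind B.lam (P n) (x + y * Complex.I)‖ ^ 2 *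
        (Real.pi * ∫ t, poissonHP y (x - t) * B.density hm t)) (𝓝[>] 0)
      (𝓝 (0 * ∑ j ∈ Finset.range (n + 1), ‖(((P j).eval x : ℝ) : ℂ) * l -
          (((OP.sec B.lam (P j)).eval x : ℝ) : ℂ)‖ ^ 2 +
        ‖(((P n).eval x : ℝ) : ℂ) * l - (((OP.sec B.lam (P n)).eval x : ℝ) : ℂ)‖ ^ 2 *
          (Real.pi * B.density hm x))) :=
    ((tendsto_id.mono_left nhdsWithin_le_nhds).mul
      (tendsto_finsetSum _ fun j _ => ((hsec (P j)).norm.pow 2))).add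
      (((hsec (P n)).norm.pow 2).mul (hm'.const_mul _))
  have := tendsto_nhds_unique (hL.congr' (by
    filter_upwards [self_mem_nhdsWithin] with y hy using key y hy)) hR
  rw [zero_mul, zero_add, mul_left_comm] at this
  exact mul_left_cancel₀ Real.pi_ne_zero this

/-- The formula for the residual spectral densities. -/
theorem residual_formula (h : B.Regular) {n : ℕ} {W : B.H1 →ₗᵢ[ℂ] B.H1}
    (hW : ∀ u, u ∈ B.domG → W.toContinuousLinearMap.adjoint u ∈ B.domG)
    (hr : W.toLinearMap.range = (Submodule.span ℂ (B.chainMode '' {j | j < n + 1}))ᗮ) {hm : ℝ → ℝ}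
    (hhm : MemLp hm 2 (volume.restrict B.K))
    (hid : ∀ u : B.domG, W.toContinuousLinearMap.adjoint (B.mulG u) =
      B.mulG ⟨W.toContinuousLinearMap.adjoint u, hW u u.2⟩ +
        inner ℂ (B.chainMode n) (u : B.H1) • B.vec hm) :
    ∀ᵐ ω ∂(volume.restrict B.freq), ∃ φ : ℝ, OP.HasReducer B.lam ω φ ∧
      ({ B with h := hm } : Bath).J ω = B.J ω /
        (((OP.orthonormalPoly B.lam n).eval ω * φ / 2 - OP.secondaryPoly B.lam n ω) ^ 2
          + B.J ω ^ 2 * (OP.orthonormalPoly B.lam n).eval ω ^ 2) := by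
  have := h.densityOn.nullSingletonClass
  rw [ae_restrict_iff' isOpen_freq.measurableSet]
  filter_upwards [h.residual_density_eq hW hr hhm hid] with ω ⟨l, hl, him, hd⟩ hω
  have hπ := Real.pi_pos
  have hJ := h.gapless ω hω
  have hdens : ∀ f, B.density f ω = ({ B with h := f } : Bath).J ω / Real.pi := fun f =>
    Set.indicator_of_mem hω _
  have hdh : B.density B.h ω = B.J ω / Real.pi := hdens B.h
  rw [hdh] at him hd
  rw [hdens hm] at hd
  have him' : l.im = -B.J ω := by rw [him]; field_simp
  -- The Stieltjes transforms at `ω - iε` and `ω + iε` are conjugate, so their sum tends to twice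
  -- the real part of `l`, and `l = φ / 2 - i J`.
  refine ⟨2 * l.re, ?_, ?_⟩
  · have h1 : Tendsto (fun y : ℝ => (starRingEnd ℂ) (OP.stieltjes B.lam (ω + y * Complex.I)) +
        OP.stieltjes B.lam (ω + y * Complex.I)) (𝓝[>] 0) (𝓝 ((starRingEnd ℂ) l + l)) :=
      ((Complex.continuous_conj.tendsto l).comp hl).add hl
    have h2 : (starRingEnd ℂ) l + l = ((2 * l.re : ℝ) : ℂ) := by
      rw [add_comm, Complex.add_conj]
    rw [h2] at h1
    refine h1.congr fun y => ?_
    have h3 := OP.secondKind_conj (μ := B.lam) 1 (ω + y * Complex.I)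
    rw [OP.secondKind_one] at h3
    rw [← h3]
    simp [mul_comm, sub_eq_add_neg]
  · rw [h.good.secondaryPoly_eq]
    set p := (OP.orthonormalPoly B.lam n).eval ω
    set q := (OP.sec B.lam (OP.orthonormalPoly B.lam n)).eval ω
    have hn : ‖(p : ℂ) * l - (q : ℂ)‖ ^ 2 = (p * (2 * l.re) / 2 - q) ^ 2 + B.J ω ^ 2 * p ^ 2 := by
      rw [Complex.sq_norm, Complex.normSq_apply]
      simp [him']
      ring
    rw [hn] at hd
    have hd' : B.J ω = ((p * (2 * l.re) / 2 - q) ^ 2 + B.J ω ^ 2 * p ^ 2) *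
        ({ B with h := hm } : Bath).J ω := by
      field_simp at hd
      linarith
    -- Were the denominator zero, the product identity would give `J(ω) = 0`, against gaplessness.
    have hne : (p * (2 * l.re) / 2 - q) ^ 2 + B.J ω ^ 2 * p ^ 2 ≠ 0 := by
      intro h0
      rw [h0, zero_mul] at hd'
      exact hJ.ne' hd'
    rw [eq_div_iff hne, mul_comm]
    exact hd'.symm

end Bath.Regular

/-! ## Second quantisation of one-particle identities -/

namespace Fock

variable {M V : Type*} [AddCommGroup M] [Module ℂ M]

section
variable [AddCommGroup V] [Module ℂ V] {i : M →ₗ[ℂ] V}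
  {T T' : M →ₗ[ℂ] SymmetricAlgebra ℂ V}

theorem symMap_ι (i : M →ₗ[ℂ] V) (u : M) :
    symMap i (SymmetricAlgebra.ι ℂ M u) = SymmetricAlgebra.ι ℂ V (i u) := by
  simp [symMap]

theorem leibniz_one (i : M →ₗ[ℂ] V) (T : M →ₗ[ℂ] SymmetricAlgebra ℂ V) : leibniz i T 1 = 0 := by
  simp [leibniz]

theorem leibniz_ι (i : M →ₗ[ℂ] V) (T : M →ₗ[ℂ] SymmetricAlgebra ℂ V) (u : M) :
    leibniz i T (SymmetricAlgebra.ι ℂ M u) = T u := by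
  simp [leibniz]

theorem fst_leibniz (i : M →ₗ[ℂ] V) (T : M →ₗ[ℂ] SymmetricAlgebra ℂ V) (x : SymmetricAlgebra ℂ M) :
    (SymmetricAlgebra.lift
      ((TrivSqZeroExt.inlAlgHom ℂ (SymmetricAlgebra ℂ V) (SymmetricAlgebra ℂ V)).toLinearMap ∘ₗ
          SymmetricAlgebra.ι ℂ V ∘ₗ i +
        (TrivSqZeroExt.inrHom (SymmetricAlgebra ℂ V)
          (SymmetricAlgebra ℂ V)).restrictScalars ℂ ∘ₗ T) x).fst = symMap i x := by
  have : (TrivSqZeroExt.fstHom ℂ (SymmetricAlgebra ℂ V) (SymmetricAlgebra ℂ V)).comp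
    (SymmetricAlgebra.lift
      ((TrivSqZeroExt.inlAlgHom ℂ (SymmetricAlgebra ℂ V) (SymmetricAlgebra ℂ V)).toLinearMap ∘ₗ
          SymmetricAlgebra.ι ℂ V ∘ₗ i +
        (TrivSqZeroExt.inrHom (SymmetricAlgebra ℂ V)
          (SymmetricAlgebra ℂ V)).restrictScalars ℂ ∘ₗ T)) = symMap i := by
    refine SymmetricAlgebra.algHom_ext ?_
    ext u
    simp [symMap]
  exact congrArg (fun f => f x) this

theorem leibniz_mul (i : M →ₗ[ℂ] V) (T : M →ₗ[ℂ] SymmetricAlgebra ℂ V)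
    (x y : SymmetricAlgebra ℂ M) :
    leibniz i T (x * y) = leibniz i T x * symMap i y + symMap i x * leibniz i T y := by
  simp only [← fst_leibniz i T]
  simp only [leibniz, LinearMap.comp_apply, AlgHom.toLinearMap_apply, map_mul,
    LinearMap.restrictScalars_apply, TrivSqZeroExt.sndHom_apply, TrivSqZeroExt.snd_mul]
  simp only [smul_eq_mul, MulOpposite.smul_eq_mul_unop, MulOpposite.unop_op]
  ring

/-- A Leibniz map is determined by its recursion on products. -/
theorem eq_leibniz {D : SymmetricAlgebra ℂ M →ₗ[ℂ] SymmetricAlgebra ℂ V} (h1 : D 1 = 0)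
    (h2 : ∀ u x, D (SymmetricAlgebra.ι ℂ M u * x) =
      T u * symMap i x + SymmetricAlgebra.ι ℂ V (i u) * D x) : D = leibniz i T := by
  -- Quantifying over a right factor `y` lets the induction use only left multiplication by
  -- generators.
  have key : ∀ x y : SymmetricAlgebra ℂ M, D y = leibniz i T y → D (x * y) = leibniz i T (x * y) := by
    intro x
    induction x using SymmetricAlgebra.induction with
    | algebraMap r =>
      intro y hy
      rw [← Algebra.smul_def, map_smul, map_smul, hy]
    | ι u =>
      intro y hy
      rw [h2, leibniz_mul, leibniz_ι, symMap_ι, hy]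
    | mul a b ha hb =>
      intro y hy
      rw [mul_assoc]
      exact ha _ (hb _ hy)
    | add a b ha hb =>
      intro y hy
      rw [add_mul, map_add, map_add, ha _ hy, hb _ hy]
  refine LinearMap.ext fun x => ?_
  have := key x 1 (by rw [h1, leibniz_one])
  rwa [mul_one] at this

theorem leibniz_add : leibniz i (T + T') = leibniz i T + leibniz i T' := by
  refine (eq_leibniz ?_ fun u x => ?_).symm
  · simp [leibniz_one]
  · simp only [LinearMap.add_apply, leibniz_mul, leibniz_ι, symMap_ι]
    ring

theorem leibniz_smul (c : ℂ) : leibniz i (c • T) = c • leibniz i T := by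
  refine (eq_leibniz ?_ fun u x => ?_).symm
  · simp [leibniz_one]
  · simp only [LinearMap.smul_apply, leibniz_mul, leibniz_ι, symMap_ι, smul_add, smul_mul_assoc,
      mul_smul_comm]

theorem leibniz_zero : leibniz i (0 : M →ₗ[ℂ] SymmetricAlgebra ℂ V) = 0 := by
  refine (eq_leibniz ?_ fun u x => ?_).symm <;> simp

theorem leibniz_sum {κ : Type*} (s : Finset κ) (T : κ → M →ₗ[ℂ] SymmetricAlgebra ℂ V) :
    leibniz i (∑ j ∈ s, T j) = ∑ j ∈ s, leibniz i (T j) := by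
  classical
  induction s using Finset.induction_on with
  | empty => simp [leibniz_zero]
  | insert a s ha ih => rw [Finset.sum_insert ha, Finset.sum_insert ha, leibniz_add, ih]

/-- The algebra homomorphism into the square-zero extension of `ℂ` by `V` recovers `u` from `ι u` as
its second component. -/
theorem ι_injective : Function.Injective (SymmetricAlgebra.ι ℂ V) := by
  let : Module ℂᵐᵒᵖ V := Module.compHom V ((RingHom.id ℂ).fromOpposite mul_comm)
  have : IsCentralScalar ℂ V := ⟨fun r m => rfl⟩
  intro x y hxy
  have h := congrArg (fun t => (SymmetricAlgebra.lift (TrivSqZeroExt.inrHom ℂ V) t).snd) hxy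
  simpa using h

theorem create_smul (c : ℂ) (f : V) : create (c • f) = c • create f := by
  ext x; simp [create]

end

section
variable [NormedAddCommGroup V] [InnerProductSpace ℂ V]

/-- The operator `u ↦ ⟨g, u⟩ f`. -/
noncomputable def rankOne (f g : V) : V →ₗ[ℂ] V := (innerSL ℂ g).toLinearMap.smulRight f

theorem rankOne_apply (f g u : V) : rankOne f g u = inner ℂ g u • f := rfl

theorem annihilate_mul (f : V) (u : V) (x : SymmetricAlgebra ℂ V) :
    annihilate f (SymmetricAlgebra.ι ℂ V u * x) =
      inner ℂ f u • x + SymmetricAlgebra.ι ℂ V u * annihilate f x := by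
  have hid : symMap (LinearMap.id : V →ₗ[ℂ] V) = AlgHom.id ℂ _ := by
    refine SymmetricAlgebra.algHom_ext ?_
    ext u
    simp [symMap]
  rw [annihilate, leibniz_mul, leibniz_ι, hid]
  simp [Algebra.smul_def]

theorem annihilate_one (f : V) : annihilate f (1 : SymmetricAlgebra ℂ V) = 0 := leibniz_one _ _

theorem annihilate_smul (c : ℂ) (f : V) :
    annihilate (c • f) = (starRingEnd ℂ) c • annihilate f := by
  rw [annihilate, annihilate, ← leibniz_smul]
  congr 1
  ext u
  simp [Algebra.smul_def]

/-- A product `a*(f) a(g)` is the second quantisation of a rank-one operator. All quadratic terms of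
the Hamiltonians thus become one-particle operators. -/
theorem create_comp_annihilate (D : Submodule ℂ V) (f g : V) :
    create f ∘ₗ annihilate g ∘ₗ (symMap D.subtype).toLinearMap =
      leibniz D.subtype (SymmetricAlgebra.ι ℂ V ∘ₗ rankOne f g ∘ₗ D.subtype) := by
  refine eq_leibniz ?_ fun u x => ?_
  · simp [create, annihilate_one]
  · simp only [LinearMap.comp_apply, AlgHom.toLinearMap_apply, map_mul, symMap_ι, annihilate_mul,
      create, LinearMap.mulLeft_apply, rankOne_apply, map_smul, Submodule.subtype_apply]
    rw [mul_add, smul_mul_assoc, mul_smul_comm]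
    ring

/-- The commutator is `⟨f, g⟩`. Orthogonality of neighbouring chain sites, and of `U_n` and `W h_m`,
permits normal ordering without an additive constant. -/
theorem annihilate_comp_create {f g : V} (hfg : inner ℂ f g = 0) :
    annihilate f ∘ₗ create g = create g ∘ₗ annihilate f := by
  ext x
  simp only [LinearMap.comp_apply, create, LinearMap.mulLeft_apply, annihilate_mul, hfg, zero_smul,
    zero_add]

end

end Fock

namespace Bath

variable {B : Bath} {S : Type*} [NormedAddCommGroup S] [InnerProductSpace ℂ S]

theorem envOp_eq (HS A : S →ₗ.[ℂ] S) (f g : B.H1) :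
    B.envOp HS A (Fock.create f ∘ₗ Fock.annihilate g) =
      TensorProduct.map (sysDom HS A).subtype (Fock.leibniz B.domG.subtype
        (SymmetricAlgebra.ι ℂ B.H1 ∘ₗ Fock.rankOne f g ∘ₗ B.domG.subtype)) := by
  rw [← Fock.create_comp_annihilate]
  rfl

/-- The one-particle operator of the environment, split along the first `n + 1` chain sites. -/
noncomputable def splitEnergy (B : Bath) (n : ℕ) (W : B.H1 →ₗᵢ[ℂ] B.H1)
    (hW : ∀ u, u ∈ B.domG → W.toContinuousLinearMap.adjoint u ∈ B.domG) (hm : ℝ → ℝ) :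
    B.domG →ₗ[ℂ] B.H1 :=
  ∑ j ∈ Finset.range n, ((√(OP.beta B.lam (j + 1)) : ℝ) : ℂ) •
      ((Fock.rankOne (B.chainMode j) (B.chainMode (j + 1)) +
        Fock.rankOne (B.chainMode (j + 1)) (B.chainMode j)) ∘ₗ B.domG.subtype) +
    ∑ j ∈ Finset.range (n + 1), (OP.alpha B.lam j : ℂ) •
      (Fock.rankOne (B.chainMode j) (B.chainMode j) ∘ₗ B.domG.subtype) +
    B.transported W hW +
    (Fock.rankOne (W (B.vec hm)) (B.chainMode n) + Fock.rankOne (B.chainMode n) (W (B.vec hm))) ∘ₗ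
      B.domG.subtype

/-- Evaluation on `s ⊗ ι u`, followed by pairing the system factor with `s`, recovers `T u`. -/
theorem map_dGamma_injective {HS A : S →ₗ.[ℂ] S} {s : S} (hs : s ∈ sysDom HS A) (hs0 : s ≠ 0)
    {T T' : B.domG →ₗ[ℂ] B.H1} (h : TensorProduct.map (sysDom HS A).subtype
      (Fock.dGamma B.domG T) = TensorProduct.map (sysDom HS A).subtype (Fock.dGamma B.domG T')) :
    T = T' := by
  refine LinearMap.ext fun u => ?_
  have h1 := congrArg (fun f => f ((⟨s, hs⟩ : sysDom HS A) ⊗ₜ SymmetricAlgebra.ι ℂ _ u)) h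
  simp only [TensorProduct.map_tmul, Fock.dGamma, Fock.leibniz_ι, Submodule.subtype_apply,
    LinearMap.comp_apply] at h1
  have h2 := congrArg (fun t => TensorProduct.lid ℂ _
    (TensorProduct.map (innerSL ℂ s).toLinearMap LinearMap.id t)) h1
  simp only [TensorProduct.map_tmul, TensorProduct.lid_tmul, LinearMap.id_apply] at h2
  have h3 : (innerSL ℂ s).toLinearMap s ≠ 0 := by
    simpa using hs0
  exact Fock.ι_injective (smul_right_injective _ h3 h2)

/-- The system term is common to both sides, and so is the coupling term since `h = √β_0 U_0`.
Everything else is a second quantisation, and second quantisation is injective on one-particle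
operators. -/
theorem Regular.hamiltonian_eq_iff (h : B.Regular) (HS A : S →ₗ.[ℂ] S)
    (hdom : ∃ s ∈ sysDom HS A, s ≠ 0) (n : ℕ) (W : B.H1 →ₗᵢ[ℂ] B.H1)
    (hW : ∀ u, u ∈ B.domG → W.toContinuousLinearMap.adjoint u ∈ B.domG)
    (hr : W.toLinearMap.range = (Submodule.span ℂ (B.chainMode '' {j | j < n + 1}))ᗮ)
    (hm : ℝ → ℝ) :
    B.hamiltonian HS A =
        B.embeddedSystem HS A (n + 1) +
        TensorProduct.map (sysDom HS A).subtype (Fock.dGamma B.domG (B.transported W hW)) +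
        B.envOp HS A (Fock.create (W (B.vec hm)) ∘ₗ B.b n +
          Fock.annihilate (W (B.vec hm)) ∘ₗ B.bStar n) ↔
      B.mulG = B.splitEnergy n W hW hm := by
  have hWU : inner ℂ (W (B.vec hm)) (B.chainMode n) = 0 := by
    have : W (B.vec hm) ∈ W.toLinearMap.range := ⟨_, rfl⟩
    rw [hr] at this
    exact inner_eq_zero_symm.1 (this _ (Submodule.subset_span ⟨n, Nat.lt_succ_self n, rfl⟩))
  have henvadd : ∀ F G, B.envOp HS A (F + G) = B.envOp HS A F + B.envOp HS A G := fun F G => by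
    simp only [envOp, tensorOp, LinearMap.add_comp, TensorProduct.map_add_right]
  have hmapadd : ∀ F G : SymmetricAlgebra ℂ B.domG →ₗ[ℂ] SymmetricAlgebra ℂ B.H1,
      TensorProduct.map (sysDom HS A).subtype (F + G) =
        TensorProduct.map (sysDom HS A).subtype F + TensorProduct.map (sysDom HS A).subtype G :=
    fun F G => TensorProduct.map_add_right _ _ _
  have hsysA : B.tensorOp (sysA HS A) (Fock.create (B.vec B.h) + Fock.annihilate (B.vec B.h)) =
      ((√(OP.beta B.lam 0) : ℝ) : ℂ) • B.tensorOp (sysA HS A) (B.bStar 0 + B.b 0) := by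
    rw [h.vec_h_eq, Fock.create_smul, Fock.annihilate_smul, Complex.conj_ofReal, ← smul_add,
      tensorOp, LinearMap.smul_comp, TensorProduct.map_smul_right]
    rfl
  have hsplit : TensorProduct.map (sysDom HS A).subtype
      (Fock.dGamma B.domG (B.splitEnergy n W hW hm)) =
      (∑ j ∈ Finset.range n, ((√(OP.beta B.lam (j + 1)) : ℝ) : ℂ) •
        B.envOp HS A (B.bStar j ∘ₗ B.b (j + 1) + B.b j ∘ₗ B.bStar (j + 1))) +
      ∑ j ∈ Finset.range (n + 1), (OP.alpha B.lam j : ℂ) • B.envOp HS A (B.bStar j ∘ₗ B.b j) +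
      TensorProduct.map (sysDom HS A).subtype (Fock.dGamma B.domG (B.transported W hW)) +
      B.envOp HS A (Fock.create (W (B.vec hm)) ∘ₗ B.b n +
          Fock.annihilate (W (B.vec hm)) ∘ₗ B.bStar n) := by
    have hc : ∀ j, Fock.annihilate (B.chainMode j) ∘ₗ Fock.create (B.chainMode (j + 1)) =
        Fock.create (B.chainMode (j + 1)) ∘ₗ Fock.annihilate (B.chainMode j) := fun j =>
      Fock.annihilate_comp_create (by simp [h.inner_chainMode])
    have hc' : Fock.annihilate (W (B.vec hm)) ∘ₗ Fock.create (B.chainMode n) =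
        Fock.create (B.chainMode n) ∘ₗ Fock.annihilate (W (B.vec hm)) := Fock.annihilate_comp_create hWU
    have hsum : ∀ (k : ℕ) (F : ℕ → B.domG →ₗ[ℂ] B.H1), SymmetricAlgebra.ι ℂ B.H1 ∘ₗ
        ∑ j ∈ Finset.range k, F j = ∑ j ∈ Finset.range k, SymmetricAlgebra.ι ℂ B.H1 ∘ₗ F j :=
      fun k F => by ext u; simp
    simp only [b, bStar, hc, hc', henvadd, envOp_eq]
    simp only [Fock.dGamma, splitEnergy, LinearMap.comp_add, Fock.leibniz_add, hmapadd,
      hsum, LinearMap.comp_smul, LinearMap.add_comp, Fock.leibniz_sum,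
      Fock.leibniz_smul]
    simp only [← TensorProduct.mapBilinear_apply, map_sum, map_smul, map_add]
  have hE : B.embeddedSystem HS A (n + 1) =
      B.tensorOp (sysH HS A) LinearMap.id +
        ((√(OP.beta B.lam 0) : ℝ) : ℂ) • B.tensorOp (sysA HS A) (B.bStar 0 + B.b 0) +
      (∑ j ∈ Finset.range n, ((√(OP.beta B.lam (j + 1)) : ℝ) : ℂ) •
        B.envOp HS A (B.bStar j ∘ₗ B.b (j + 1) + B.b j ∘ₗ B.bStar (j + 1))) +
      ∑ j ∈ Finset.range (n + 1), (OP.alpha B.lam j : ℂ) • B.envOp HS A (B.bStar j ∘ₗ B.b j) := rfl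
  have hkey : (B.hamiltonian HS A =
        B.embeddedSystem HS A (n + 1) +
        TensorProduct.map (sysDom HS A).subtype (Fock.dGamma B.domG (B.transported W hW)) +
        B.envOp HS A (Fock.create (W (B.vec hm)) ∘ₗ B.b n +
          Fock.annihilate (W (B.vec hm)) ∘ₗ B.bStar n)) ↔
      TensorProduct.map (sysDom HS A).subtype (Fock.dGamma B.domG B.mulG) =
        TensorProduct.map (sysDom HS A).subtype
          (Fock.dGamma B.domG (B.splitEnergy n W hW hm)) := by
    rw [hamiltonian, hE, hsysA, hsplit]
    constructor
    · intro h1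
      rw [← sub_eq_zero] at h1 ⊢
      rw [← h1]
      abel
    · intro h1
      rw [h1]
      abel
  rw [hkey]
  obtain ⟨s, hs, hs0⟩ := hdom
  exact ⟨map_dGamma_injective hs hs0, fun h1 => by rw [h1]⟩

end Bath

/-! ## Coupling functions with a prescribed density -/

section Total

variable {E ι : Type*} [NormedAddCommGroup E] [InnerProductSpace ℂ E] [CompleteSpace E]
  {ρ f : ι → E}

theorem dense_span_of_total (hρ : ∀ v, (∀ z, inner ℂ (ρ z) v = 0) → v = 0) :
    Dense (Submodule.span ℂ (Set.range ρ) : Set E) := by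
  rw [Submodule.dense_iff_topologicalClosure_eq_top, Submodule.topologicalClosure_eq_top_iff,
    Submodule.eq_bot_iff]
  intro v hv
  exact hρ v fun z => hv _ (Submodule.subset_span ⟨z, rfl⟩)

/-- Two families with the same Gram matrix, the first of them total, are related by an isometry. -/
theorem exists_isometry_of_gram (hρ : ∀ v, (∀ z, inner ℂ (ρ z) v = 0) → v = 0)
    (hgram : ∀ w z, inner ℂ (f w) (f z) = inner ℂ (ρ w) (ρ z)) :
    ∃ W : E →ₗᵢ[ℂ] E, ∀ z, W (ρ z) = f z := by
  set Φ := Finsupp.linearCombination ℂ ρ with hΦ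
  set Ψ := Finsupp.linearCombination ℂ f with hΨ
  -- Equal Gram matrices give equal norms of corresponding linear combinations, so `Φ c ↦ Ψ c` is
  -- well defined and isometric on a dense subspace.
  have hnorm : ∀ c, ‖Ψ c‖ = ‖Φ c‖ := fun c => by
    have h1 : inner ℂ (Ψ c) (Ψ c) = inner ℂ (Φ c) (Φ c) := by
      simp only [hΦ, hΨ, Finsupp.linearCombination_apply, Finsupp.sum, sum_inner, inner_sum,
        inner_smul_left, inner_smul_right, hgram]
    rw [inner_self_eq_norm_sq_to_K, inner_self_eq_norm_sq_to_K] at h1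
    have h2 : ‖Ψ c‖ ^ 2 = ‖Φ c‖ ^ 2 := by exact_mod_cast h1
    exact (sq_eq_sq₀ (norm_nonneg _) (norm_nonneg _)).1 h2
  have hdense : DenseRange Φ := by
    have h1 := dense_span_of_total hρ
    rw [← Finsupp.range_linearCombination] at h1
    exact h1
  have hbound : ∃ C, ∀ c, ‖Ψ c‖ ≤ C * ‖Φ c‖ := ⟨1, fun c => by rw [one_mul, hnorm]⟩
  set W := Ψ.extendOfNorm Φ with hW
  have hWΦ : ∀ c, W (Φ c) = Ψ c := fun c => LinearMap.extendOfNorm_eq hdense hbound c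
  refine ⟨⟨W.toLinearMap, fun x => ?_⟩, fun z => ?_⟩
  · change ‖W x‖ = ‖x‖
    refine hdense.induction_on (p := fun x => ‖W x‖ = ‖x‖) x
      (isClosed_eq (W.continuous.norm) continuous_norm) fun c => ?_
    rw [hWΦ, hnorm]
  · have := hWΦ (Finsupp.single z 1)
    simpa [hΦ, hΨ] using this

end Total

namespace Bath.Regular

variable {B : Bath}

theorem ae_comp_g (h : B.Regular) {p : ℝ → Prop} (hp : ∀ᵐ ω, ω ∈ B.freq → p ω) :
    ∀ᵐ k ∂volume.restrict B.K, p (B.g k) := by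
  classical
  set ψ : ℝ → ℝ := fun ω => if p ω then 0 else 1 with hψ
  have h0 : ψ =ᵐ[volume.restrict B.freq] 0 := by
    rw [EventuallyEq, ae_restrict_iff' isOpen_freq.measurableSet]
    filter_upwards [hp] with ω hω hf
    simp [hψ, hω hf]
  have h1 : IntegrableOn ψ B.freq := (integrable_zero _ _ _).congr h0.symm
  have h2 : ∫ ω in B.freq, ψ ω = 0 := integral_eq_zero_of_ae h0
  rw [h.integrableOn_freq_iff] at h1
  rw [h.setIntegral_freq, integral_eq_zero_iff_of_nonneg _ h1] at h2
  · filter_upwards [h2, ae_K (p := fun k => deriv B.g k ≠ 0) fun k hk => h.deriv_ne_zero hk]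
      with k hk hk'
    by_contra hpk
    simp [hψ, hpk, hk'] at hk
  · intro k
    simp only [hψ, smul_eq_mul, Pi.zero_apply]
    split_ifs <;> simp

/-- Every integrable density, positive on the frequency interval, belongs to a coupling function. -/
theorem exists_coupling (h : B.Regular) {j : ℝ → ℝ} (hj : Integrable j)
    (hpos : ∀ᵐ x, x ∈ B.freq → 0 < j x) (hzero : ∀ᵐ x, x ∉ B.freq → j x = 0) :
    ∃ hm : ℝ → ℝ, MemLp hm 2 (volume.restrict B.K) ∧
      (∀ᵐ k ∂volume.restrict B.K, hm k ≠ 0) ∧ B.density hm =ᵐ[volume] j := by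
  set i := hj.1.mk j with hi
  have hij : j =ᵐ[volume] i := hj.1.ae_eq_mk
  have him : Measurable i := hj.1.stronglyMeasurable_mk.measurable
  -- This inverts the definition of the spectral density. The measurable representative `i` and its
  -- absolute value make the square root meaningful everywhere.
  set hm : ℝ → ℝ := fun k => √(|deriv B.g k| * |i (B.g k)|) with hhm
  have hsq : ∀ k, hm k ^ 2 = |deriv B.g k| * |i (B.g k)| := fun k => Real.sq_sqrt (by positivity)
  refine ⟨hm, ?_, ?_, ?_⟩
  · have hmeas : AEStronglyMeasurable hm (volume.restrict B.K) := by
      have h1 : AEMeasurable (fun k => i (B.g k)) (volume.restrict B.K) :=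
        him.comp_aemeasurable h.aemeasurable_g
      have h2 : AEMeasurable (fun k => deriv B.g k) (volume.restrict B.K) :=
        (measurable_deriv B.g).aemeasurable
      exact ((h2.abs.mul h1.abs).sqrt).aestronglyMeasurable
    rw [memLp_two_iff_integrable_sq hmeas]
    simp_rw [hsq]
    exact (h.integrableOn_freq_iff fun ω => |i ω|).1 (hj.congr hij).abs.integrableOn
  · have h1 : ∀ᵐ ω, ω ∈ B.freq → i ω ≠ 0 := by
      filter_upwards [hpos, hij] with ω h1 h2 hω
      rw [← h2]
      exact (h1 hω).ne'
    filter_upwards [h.ae_comp_g h1, ae_K (p := fun k => deriv B.g k ≠ 0) fun k hk =>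
      h.deriv_ne_zero hk] with k h2 h3
    have : hm k ^ 2 ≠ 0 := by
      rw [hsq]
      exact mul_ne_zero (abs_ne_zero.2 h3) (abs_ne_zero.2 h2)
    exact fun h0 => this (by rw [h0]; simp)
  · filter_upwards [hpos, hzero, hij] with ω h1 h2 h3
    by_cases hω : ω ∈ B.freq
    · obtain ⟨k, hk, rfl⟩ := h.exists_g_eq hω
      have h4 := h.abs_deriv_mul_J hm hk
      rw [hsq, mul_left_comm] at h4
      have h5 := mul_left_cancel₀ (abs_ne_zero.2 (h.deriv_ne_zero hk)) h4
      rw [density, Set.indicator_of_mem hω, h5, mul_div_cancel_left₀ _ Real.pi_ne_zero, ← h3,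
        abs_of_pos (h1 hω)]
    · rw [density, Set.indicator_of_notMem hω, h2 hω]

theorem continuousOn_density (hJ : ContinuousOn B.J B.freq) :
    ContinuousOn (B.density B.h) B.freq :=
  (hJ.div_const Real.pi).congr fun _ hω => Set.indicator_of_mem hω _

/-- This is the resolvent identity. The residual vectors satisfy a relation of the same form with
`residualStieltjes` in place of `⟨u, (z - g)⁻¹ u⟩`, so matching these scalar functions matches the
Gram matrices. -/
theorem gram_res (h : B.Regular) (u : B.H1) {z w : ℂ} (hz : z.im ≠ 0) (hw : w.im ≠ 0) :
    (z - (starRingEnd ℂ) w) * inner ℂ (h.res hw u) (h.res hz u) =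
      (starRingEnd ℂ) (inner ℂ u (h.res hw u)) - inner ℂ u (h.res hz u) := by
  have hw' : ((starRingEnd ℂ) w).im ≠ 0 := by rw [Complex.conj_im]; exact neg_ne_zero.2 hw
  have h1 := congrArg (inner ℂ u) (h.res_res hw' hz u)
  rw [inner_smul_right, inner_sub_right, ← h.inner_res hw hw', ← h.inner_res hw hw'] at h1
  rw [inner_conj_symm]
  linear_combination -h1

theorem specFun_residualVec (h : B.Regular) (n : ℕ) {z : ℂ} (hz : z.im ≠ 0) :
    B.SpecFun (OP.residualVec B.lam n z) := by
  refine ⟨?_, h.good.memLp_residualVec n hz⟩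
  have h1 := (h.specFun_eval (OP.nextPoly B.lam n)).1
  have h2 := (h.specFun_eval (OP.orthonormalPoly B.lam n)).1
  exact (h1.sub (h2.const_mul _)).div (measurable_const.sub Complex.measurable_ofReal)

end Bath.Regular

/-! ## The isometry onto the residual environment -/

namespace Bath.Regular

variable {B : Bath}

theorem inner_polyVec_eq_zero (h : B.Regular) {n : ℕ} {x : B.H1} (hx : ∀ j < n + 1, inner ℂ x (B.chainMode j) = 0) :
    ∀ m ≤ n + 1, ∀ p : ℝ[X], p.degree < m → inner ℂ x (B.polyVec p) = 0 := by
  intro m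
  induction m with
  | zero =>
    intro _ p hp
    have : p = 0 := OP.degree_lt_zero_iff.1 hp
    rw [this, show (0 : ℝ[X]) = C 0 * 0 by simp, h.polyVec_C_mul]
    simp
  | succ m ih =>
    intro hm p hp
    obtain ⟨c, q, hq, rfl⟩ := OP.exists_degree_lt_add_C_mul_monicPoly (μ := B.lam) hp
    have h1 := Real.sqrt_pos.2 (h.good.normSq_pos m)
    have h2 : C c * OP.monicPoly B.lam m =
        C (c * √(OP.normSq B.lam m)) * OP.orthonormalPoly B.lam m := by
      rw [OP.orthonormalPoly_def, ← mul_assoc, ← C_mul]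
      congr 2
      field_simp
    rw [h.polyVec_add, h2, h.polyVec_C_mul, inner_add_right, inner_smul_right, ← h.chainMode_eq,
      hx m (by omega), ih (by omega) q hq]
    simp

/-- The real constant `a` cancels between `conj F(w)` and `F(z)`. The sign conditions exclude `z =
conj w`, where the Gram relation carries no information; the weak inequality for `z` admits `z = i`.
-/
theorem gram_residualVec (h : B.Regular) {n : ℕ} {hm : ℝ → ℝ} {a : ℝ}
    (hst : ∀ (z : ℂ) (hz : z.im ≠ 0), OP.residualStieltjes B.lam n z =
      inner ℂ (B.vec hm) (h.res hz (B.vec hm)) + a) {z w : ℂ} (hz : z.im ≠ 0) (hw : w.im ≠ 0)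
    (hz' : 0 ≤ z.re * z.im) (hw' : 0 < w.re * w.im) :
    inner ℂ (B.specVec (OP.residualVec B.lam n w)) (B.specVec (OP.residualVec B.lam n z)) =
      inner ℂ (h.res hw (B.vec hm)) (h.res hz (B.vec hm)) := by
  have hne : z - (starRingEnd ℂ) w ≠ 0 := by
    intro h0
    rw [sub_eq_zero.1 h0, Complex.conj_re, Complex.conj_im] at hz'
    linarith
  refine mul_left_cancel₀ hne ?_
  rw [h.inner_specVec (h.specFun_residualVec n hw) (h.specFun_residualVec n hz),
    h.good.gram_residualVec n hz hw, h.gram_res, hst z hz, hst w hw, map_add, Complex.conj_ofReal]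
  ring

theorem inner_chainMode_residualVec (h : B.Regular) {n j : ℕ} (hj : j < n + 1) {z : ℂ}
    (hz : z.im ≠ 0) : inner ℂ (B.chainMode j) (B.specVec (OP.residualVec B.lam n z)) = 0 := by
  rw [h.chainMode_eq, polyVec, h.inner_specVec (h.specFun_eval _) (h.specFun_residualVec n hz)]
  simp only [Complex.conj_ofReal]
  rw [h.good.integral_mul_residualVec hz]
  rw [h.good.natDegree_orthonormalPoly]
  omega

/-- A coupling function `hm` together with an isometry onto the complement of the first chain sites,
in terms of the resolvents. -/
structure ResidualData (h : B.Regular) (n : ℕ) (hm : ℝ → ℝ) (a : ℝ) (W : B.H1 →ₗᵢ[ℂ] B.H1) :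
    Prop where
  memLp : MemLp hm 2 (volume.restrict B.K)
  ne_zero : ∀ᵐ k ∂volume.restrict B.K, hm k ≠ 0
  stieltjes : ∀ (z : ℂ) (hz : z.im ≠ 0), OP.residualStieltjes B.lam n z =
    inner ℂ (B.vec hm) (h.res hz (B.vec hm)) + a
  map_res : ∀ (z : ℂ) (hz : z.im ≠ 0), 0 < z.re * z.im →
    W (h.res hz (B.vec hm)) = B.specVec (OP.residualVec B.lam n z)

/-- Only the quadrants with `Re z · Im z > 0` are used: there `z - conj w` never vanishes, and the
resolvent vectors are still total. -/
theorem exists_residualData (h : B.Regular) (hJ : ContinuousOn B.J B.freq) (n : ℕ) :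
    ∃ hm a W, ResidualData h n hm a W := by
  obtain ⟨j, hj, hpos, hzero, a, ha⟩ :=
    h.densityOn.exists_residual_density (continuousOn_density hJ) n
  obtain ⟨hm, hmL, hm0, hmj⟩ := h.exists_coupling hj hpos hzero
  have hst : ∀ (z : ℂ) (hz : z.im ≠ 0), OP.residualStieltjes B.lam n z =
      inner ℂ (B.vec hm) (h.res hz (B.vec hm)) + a := fun z hz => by
    rw [ha z hz, h.inner_vec_res_vec hmL hz]
    congr 1
    refine integral_congr_ae ?_
    filter_upwards [hmj] with t ht
    rw [ht]
  have him : ∀ z : {z : ℂ // 0 < z.re * z.im}, (z : ℂ).im ≠ 0 := fun z =>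
    right_ne_zero_of_mul z.2.ne'
  obtain ⟨W, hW⟩ := exists_isometry_of_gram
    (ρ := fun z : {z : ℂ // 0 < z.re * z.im} => h.res (him z) (B.vec hm))
    (f := fun z => B.specVec (OP.residualVec B.lam n z))
    (fun v hv => h.eq_zero_of_inner_res_eq_zero hmL hm0 v fun z _ hz' => hv ⟨z, hz'⟩)
    (fun w z => h.gram_residualVec hst (him z) (him w) z.2.le w.2)
  exact ⟨hm, a, W, hmL, hm0, hst, fun z _ hz' => hW ⟨z, hz'⟩⟩

namespace ResidualData

variable {h : B.Regular} {n : ℕ} {hm : ℝ → ℝ} {a : ℝ} {W : B.H1 →ₗᵢ[ℂ] B.H1}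

/-- Continuous linear maps are determined by their values on the resolvent vectors. -/
theorem ext_clm (d : ResidualData h n hm a W) {F G : B.H1 →L[ℂ] B.H1}
    (hFG : ∀ (z : ℂ) (hz : z.im ≠ 0), 0 < z.re * z.im →
      F (h.res hz (B.vec hm)) = G (h.res hz (B.vec hm))) : F = G := by
  have him : ∀ z : {z : ℂ // 0 < z.re * z.im}, (z : ℂ).im ≠ 0 := fun z =>
    right_ne_zero_of_mul z.2.ne'
  have hd := dense_span_of_total
    (ρ := fun z : {z : ℂ // 0 < z.re * z.im} => h.res (him z) (B.vec hm))
    (fun v hv => h.eq_zero_of_inner_res_eq_zero d.memLp d.ne_zero v fun z _ hz' => hv ⟨z, hz'⟩)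
  refine ContinuousLinearMap.ext_on hd ?_
  rintro _ ⟨z, rfl⟩
  exact hFG z (him z) z.2

theorem inner_chainMode_map (d : ResidualData h n hm a W) {j : ℕ} (hj : j < n + 1) (y : B.H1) :
    inner ℂ (B.chainMode j) (W y) = 0 := by
  have h1 : W.toContinuousLinearMap.adjoint (B.chainMode j) = 0 := by
    refine h.eq_zero_of_inner_res_eq_zero d.memLp d.ne_zero _ fun z hz hz' => ?_
    rw [ContinuousLinearMap.adjoint_inner_right]
    change inner ℂ (W (h.res hz (B.vec hm))) _ = 0
    rw [d.map_res z hz hz', ← inner_conj_symm, h.inner_chainMode_residualVec hj hz, map_zero]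
  have h2 := ContinuousLinearMap.adjoint_inner_left W.toContinuousLinearMap y (B.chainMode j)
  rw [h1, inner_zero_left] at h2
  exact h2.symm

/-- If `x` is orthogonal to the chain sites, then `x - W W* x` is orthogonal to the polynomial
vectors of degree at most `n` and to the residual vectors, hence by `exists_resolvent_decomposition`
to all `(z - g)⁻¹ h` in the two quadrants. These are total because `h` does not vanish. -/
theorem range_eq (d : ResidualData h n hm a W) :
    W.toLinearMap.range = (Submodule.span ℂ (B.chainMode '' {j | j < n + 1}))ᗮ := by
  refine le_antisymm ?_ ?_
  · rintro _ ⟨y, rfl⟩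
    rw [Submodule.mem_orthogonal]
    intro x hx
    induction hx using Submodule.span_induction with
    | mem x hx =>
      obtain ⟨i, hi, rfl⟩ := hx
      exact d.inner_chainMode_map hi y
    | zero => simp
    | add x y _ _ hx hy => rw [inner_add_left, hx, hy, add_zero]
    | smul c x _ hx => rw [inner_smul_left, hx, mul_zero]
  · intro x hx
    set A := W.toContinuousLinearMap.adjoint with hA
    have hxU : ∀ j < n + 1, inner ℂ (x - W (A x)) (B.chainMode j) = 0 := fun j hj => by
      have h1 : inner ℂ (B.chainMode j) x = 0 := hx _ (Submodule.subset_span ⟨j, hj, rfl⟩)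
      rw [inner_eq_zero_symm, inner_sub_right, h1, d.inner_chainMode_map hj, sub_zero]
    have hxW : ∀ y, inner ℂ (x - W (A x)) (W y) = 0 := fun y => by
      have h1 := ContinuousLinearMap.adjoint_inner_left W.toContinuousLinearMap y x
      have h2 : inner ℂ (W (A x)) (W y) = inner ℂ (A x) y := W.inner_map_map _ _
      rw [inner_sub_left, h2, h1]
      exact sub_self _
    have h0 : x - W (A x) = 0 := by
      refine h.eq_zero_of_inner_res_eq_zero h.memLp (ae_K fun k hk => h.h_ne_zero hk) _
        fun z hz hz' => ?_
      obtain ⟨q, hq, hdec⟩ := h.good.exists_resolvent_decomposition n hz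
      have hf := h.specFun_residualVec n hz
      -- The polynomial part has complex coefficients, whereas orthogonality is known for real
      -- polynomials; it is transferred monomial by monomial.
      have hqf : ∀ q : ℂ[X], q.natDegree ≤ n → B.SpecFun (fun t : ℝ => q.eval (t : ℂ)) ∧
          inner ℂ (x - W (A x)) (B.specVec fun t : ℝ => q.eval (t : ℂ)) = 0 := by
        intro q hq
        have h1 : ∀ t : ℝ, q.eval (t : ℂ) = ∑ i ∈ Finset.range (n + 1),
            q.coeff i * ((((X : ℝ[X]) ^ i).eval t : ℝ) : ℂ) := fun t => by
          rw [eval_eq_sum_range' (Nat.lt_succ_of_le hq)]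
          simp
        simp_rw [h1]
        have h2 : ∀ m ≤ n + 1, B.SpecFun (fun t : ℝ => ∑ i ∈ Finset.range m,
            q.coeff i * ((((X : ℝ[X]) ^ i).eval t : ℝ) : ℂ)) ∧
            inner ℂ (x - W (A x)) (B.specVec fun t : ℝ => ∑ i ∈ Finset.range m,
            q.coeff i * ((((X : ℝ[X]) ^ i).eval t : ℝ) : ℂ)) = 0 := by
          intro m
          induction m with
          | zero =>
            intro _
            have h3 : B.SpecFun fun t => (((0 : ℝ[X]).eval t : ℝ) : ℂ) := h.specFun_eval 0
            have h4 := h.inner_polyVec_eq_zero hxU 0 (Nat.zero_le _) 0 (by simp)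
            simp only [polyVec, eval_zero, Complex.ofReal_zero] at h3 h4
            simpa using ⟨h3, h4⟩
          | succ m ih =>
            intro hm
            obtain ⟨i1, i2⟩ := ih (by omega)
            have h3 := h.specFun_eval (X ^ m)
            simp_rw [Finset.sum_range_succ]
            refine ⟨⟨i1.1.add (h3.1.const_mul _), i1.2.add (h3.2.const_mul _)⟩, ?_⟩
            rw [h.specVec_add i1 (h3.const_mul _), inner_add_right, i2,
              h.specVec_const_mul _ h3, inner_smul_right,
              show B.specVec (fun t => ((((X : ℝ[X]) ^ m).eval t : ℝ) : ℂ)) = B.polyVec (X ^ m) from rfl,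
              h.inner_polyVec_eq_zero hxU (m + 1) hm _ (by
                rw [degree_X_pow]; exact_mod_cast Nat.lt_succ_self m)]
            simp
        exact h2 (n + 1) le_rfl
      have hr : h.res hz (B.vec B.h) = OP.secondKind B.lam (OP.orthonormalPoly B.lam n) z •
          B.specVec (OP.residualVec B.lam n z) + B.specVec fun t : ℝ => q.eval (t : ℂ) := by
        rw [← h.specVec_const_mul _ hf, ← h.specVec_add (hf.const_mul _)
          (hqf q hq).1, ← h.polyVec_one, polyVec, h.res_specVec hz (h.specFun_eval 1)]
        congr 1
        funext t
        simp only [eval_one, Complex.ofReal_one]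
        exact hdec t
      rw [inner_eq_zero_symm, hr, inner_add_right, (hqf q hq).2, inner_smul_right,
        ← d.map_res z hz hz', hxW]
      simp
    exact ⟨A x, (sub_eq_zero.1 h0).symm⟩

/-- The point `i` lies outside the quadrants that define `W`. Its residual vector is in the range of
`W`, and the Gram relation determines the inner products of its preimage with a total family. -/
theorem map_res_I_vec (d : ResidualData h n hm a W) (hI : Complex.I.im ≠ 0) :
    W (h.res hI (B.vec hm)) = B.specVec (OP.residualVec B.lam n Complex.I) := by
  have h1 : B.specVec (OP.residualVec B.lam n Complex.I) ∈ W.toLinearMap.range := by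
    rw [d.range_eq, Submodule.mem_orthogonal]
    intro x hx
    induction hx using Submodule.span_induction with
    | mem x hx =>
      obtain ⟨i, hi, rfl⟩ := hx
      exact h.inner_chainMode_residualVec hi hI
    | zero => simp
    | add x y _ _ hx hy => rw [inner_add_left, hx, hy, add_zero]
    | smul c x _ hx => rw [inner_smul_left, hx, mul_zero]
  obtain ⟨y, hy⟩ := h1
  have hy' : W y = B.specVec (OP.residualVec B.lam n Complex.I) := hy
  rw [← hy']
  congr 1
  rw [← sub_eq_zero]
  refine h.eq_zero_of_inner_res_eq_zero d.memLp d.ne_zero _ fun z hz hz' => ?_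
  rw [inner_sub_right, ← h.gram_residualVec d.stieltjes hI hz (by simp) hz', ← hy',
    ← d.map_res z hz hz', W.inner_map_map, sub_self]

/-- The isometry intertwines the resolvents up to a rank one term. -/
theorem map_res_I (d : ResidualData h n hm a W) (hI : Complex.I.im ≠ 0) (y : B.H1) :
    W (h.res hI y) = h.res hI (W y -
      inner ℂ (B.vec hm) (h.res hI y) • B.chainMode n) := by
  set F : B.H1 →L[ℂ] B.H1 := W.toContinuousLinearMap ∘L h.res hI with hF
  set G : B.H1 →L[ℂ] B.H1 := h.res hI ∘L (W.toContinuousLinearMap -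
    ((innerSL ℂ (B.vec hm)) ∘L h.res hI).smulRight (B.chainMode n)) with hG
  have hFG : F = G := by
    refine d.ext_clm fun w hw hw' => ?_
    change W (h.res hI (h.res hw (B.vec hm))) = h.res hI (W (h.res hw (B.vec hm)) -
      inner ℂ (B.vec hm) (h.res hI (h.res hw (B.vec hm))) • B.chainMode n)
    have hne : Complex.I - w ≠ 0 := by
      intro h0
      rw [← sub_eq_zero.1 h0] at hw'
      simp at hw'
    have hfw := h.specFun_residualVec n hw
    have hfI := h.specFun_residualVec n hI
    have hP := h.specFun_eval (OP.orthonormalPoly B.lam n)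
    -- After multiplication by `i - w` the resolvent identity splits each double resolvent into
    -- single ones, on which `W` is known; an identity of rational functions of `t` remains.
    refine (smul_right_inj hne).1 ?_
    rw [← W.map_smul, h.res_res, ← (h.res hI).map_smul, smul_sub, smul_smul, ← inner_smul_right, h.res_res,
      map_sub, d.map_res_I_vec hI, d.map_res w hw hw', inner_sub_right]
    have hS : inner ℂ (B.vec hm) (h.res hw (B.vec hm)) - inner ℂ (B.vec hm) (h.res hI (B.vec hm)) =
        OP.residualStieltjes B.lam n w - OP.residualStieltjes B.lam n Complex.I := by
      rw [d.stieltjes w hw, d.stieltjes _ hI]; ring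
    rw [hS, h.chainMode_eq, polyVec, sub_eq_add_neg, sub_eq_add_neg, ← neg_smul,
      ← neg_one_smul ℂ (B.specVec (OP.residualVec B.lam n Complex.I)),
      ← h.specVec_const_mul _ hfw, ← h.specVec_const_mul _ hfI, ← h.specVec_const_mul _ hP,
      ← h.specVec_add hfw (hfI.const_mul _),
      ← h.specVec_add (hfw.const_mul _) (hP.const_mul _),
      h.res_specVec hI ((hfw.const_mul _).add (hP.const_mul _))]
    congr 1
    funext t
    have h1 := sub_ofReal_ne_zero hw t
    have h2 := sub_ofReal_ne_zero hI t
    simp only [OP.residualVec]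
    field_simp
    ring
  exact congrArg (fun F => F y) hFG

end ResidualData

end Bath.Regular

/-! ## Splitting off the chain sites -/

namespace Bath.Regular

variable {B : Bath}

/-- The Jacobi recurrence on the first `n + 1` sites: every hopping term stays inside the block
except the last one, to `U_{n+1}`. -/
theorem sum_smul_mulG_chainMode (h : B.Regular) (c : ℕ → ℂ) (n : ℕ) :
    ∑ j ∈ Finset.range (n + 1), c j • B.mulG ⟨B.chainMode j, h.chainMode_mem_domG j⟩ =
      ∑ j ∈ Finset.range n, ((√(OP.beta B.lam (j + 1)) : ℝ) : ℂ) •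
        (c (j + 1) • B.chainMode j + c j • B.chainMode (j + 1)) +
      ∑ j ∈ Finset.range (n + 1), (OP.alpha B.lam j : ℂ) • c j • B.chainMode j +
      c n • ((√(OP.beta B.lam (n + 1)) : ℝ) : ℂ) • B.chainMode (n + 1) := by
  induction n with
  | zero =>
    simp only [zero_add, Finset.sum_range_one, Finset.sum_range_zero, h.mulG_chainMode_zero]
    module
  | succ n ih =>
    rw [Finset.sum_range_succ, ih, h.mulG_chainMode_succ]
    conv_rhs => rw [Finset.sum_range_succ, Finset.sum_range_succ _ (n + 1)]
    module

namespace ResidualData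

variable {h : B.Regular} {n : ℕ} {hm : ℝ → ℝ} {a : ℝ} {W : B.H1 →ₗᵢ[ℂ] B.H1}

/-- Since `y = (i - g)⁻¹ (i y - g y)`, the intertwining relation exhibits `W y` as a resolvent
applied to a vector. -/
theorem map_mem_domG (d : ResidualData h n hm a W) (y : B.domG) : W y ∈ B.domG := by
  have hI : Complex.I.im ≠ 0 := by simp
  have h1 := d.map_res_I hI (Complex.I • (y : B.H1) - B.mulG y)
  rw [h.res_smul_sub_mulG] at h1
  rw [h1]
  exact h.res_mem_domG hI _

theorem mulG_map (d : ResidualData h n hm a W) (y : B.domG) :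
    B.mulG ⟨W y, d.map_mem_domG y⟩ =
      W (B.mulG y) + inner ℂ (B.vec hm) (y : B.H1) • B.chainMode n := by
  have hI : Complex.I.im ≠ 0 := by simp
  have h1 := d.map_res_I hI (Complex.I • (y : B.H1) - B.mulG y)
  rw [h.res_smul_sub_mulG] at h1
  have h2 : (⟨W y, d.map_mem_domG y⟩ : B.domG) = ⟨_, h.res_mem_domG hI
      (W (Complex.I • (y : B.H1) - B.mulG y) -
        inner ℂ (B.vec hm) (y : B.H1) • B.chainMode n)⟩ := Subtype.ext h1
  rw [h2, h.mulG_res, ← h1, map_sub, W.map_smul]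
  abel

/-- The adjoint of the intertwining relation: writing `u = (-i - g)⁻¹ x`, one finds `W* u = (-i -
g)⁻¹ (W* x + ⟨U_n, u⟩ h_m)`. -/
theorem adjoint_mem_domG (d : ResidualData h n hm a W) {u : B.H1} (hu : u ∈ B.domG) :
    W.toContinuousLinearMap.adjoint u ∈ B.domG := by
  have hI : Complex.I.im ≠ 0 := by simp
  have hI' : ((starRingEnd ℂ) Complex.I).im ≠ 0 := by simp
  set A := W.toContinuousLinearMap.adjoint with hA
  have hAi : ∀ x y : B.H1, inner ℂ (A x) y = inner ℂ x (W y) := fun x y =>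
    ContinuousLinearMap.adjoint_inner_left _ _ _
  have hres : ∀ x y : B.H1, inner ℂ x (h.res hI y) = inner ℂ (h.res hI' x) y := fun x y => by
    rw [← inner_conj_symm, h.inner_res hI hI', inner_conj_symm]
  set x := (starRingEnd ℂ) Complex.I • u - B.mulG ⟨u, hu⟩ with hx
  have hux : h.res hI' x = u := h.res_smul_sub_mulG hI' ⟨u, hu⟩
  have key : A u = h.res hI' (A x + inner ℂ (B.chainMode n) u • B.vec hm) := by
    refine ext_inner_right ℂ fun y => ?_
    have h1 := congrArg (inner ℂ x) (d.map_res_I hI y)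
    rw [← hAi, hres, hres, hux, inner_sub_right, inner_smul_right, hres, ← hAi] at h1
    rw [map_add, map_smul, inner_add_left, inner_smul_left, inner_conj_symm, h1]
    ring
  rw [key]
  exact h.res_mem_domG hI' _

theorem mem_domG_iff (d : ResidualData h n hm a W) (u : B.H1) :
    u ∈ B.domG ↔ W.toContinuousLinearMap.adjoint u ∈ B.domG := by
  refine ⟨d.adjoint_mem_domG, fun hu => ?_⟩
  rw [h.decomposition d.range_eq u]
  exact add_mem (sum_mem fun j _ => B.domG.smul_mem _ (h.chainMode_mem_domG j))
    (d.map_mem_domG ⟨_, hu⟩)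

/-- Two expressions for `g W (i - g)⁻¹ h_m` give `W h_m = √β_{n+1} U_{n+1} - a U_n`. The range of
`W` is orthogonal to `U_n`, so `a = 0`. -/
theorem map_vec (d : ResidualData h n hm a W) :
    W (B.vec hm) = ((√(OP.beta B.lam (n + 1)) : ℝ) : ℂ) • B.chainMode (n + 1) := by
  have hI : Complex.I.im ≠ 0 := by simp
  have hv := h.specFun_eval (OP.nextPoly B.lam n)
  have hP := h.specFun_eval (OP.orthonormalPoly B.lam n)
  set F := OP.residualStieltjes B.lam n Complex.I with hF
  have hnext : B.polyVec (OP.nextPoly B.lam n) =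
      ((√(OP.beta B.lam (n + 1)) : ℝ) : ℂ) • B.chainMode (n + 1) := by
    rw [OP.nextPoly, h.polyVec_C_mul, h.chainMode_eq]
  have hf : B.specVec (OP.residualVec B.lam n Complex.I) =
      h.res hI (B.polyVec (OP.nextPoly B.lam n) - F • B.chainMode n) := by
    rw [h.chainMode_eq, sub_eq_add_neg, ← neg_smul, polyVec, polyVec, ← h.specVec_const_mul _ hP,
      ← h.specVec_add hv (hP.const_mul _), h.res_specVec hI (hv.add (hP.const_mul _))]
    congr 1
    funext t
    rw [OP.residualVec]
    ring
  have h1 := d.mulG_map ⟨h.res hI (B.vec hm), h.res_mem_domG hI _⟩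
  have h2 : (⟨W (h.res hI (B.vec hm)), d.map_mem_domG ⟨_, h.res_mem_domG hI _⟩⟩ : B.domG) =
      ⟨_, h.res_mem_domG hI (B.polyVec (OP.nextPoly B.lam n) - F • B.chainMode n)⟩ :=
    Subtype.ext ((d.map_res_I_vec hI).trans hf)
  have h3 : W (h.res hI (B.vec hm)) =
      h.res hI (B.polyVec (OP.nextPoly B.lam n) - F • B.chainMode n) :=
    (d.map_res_I_vec hI).trans hf
  rw [h2, h.mulG_res, h.mulG_res, W.map_sub, W.map_smul, h3] at h1
  have h4 : W (B.vec hm) = B.polyVec (OP.nextPoly B.lam n) - (a : ℂ) • B.chainMode n := by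
    have hS := d.stieltjes _ hI
    rw [← hF] at hS
    rw [hS] at h1
    have h5 := sub_eq_zero.2 h1
    rw [← sub_eq_zero, ← h5]
    module
  have h6 := d.inner_chainMode_map (Nat.lt_succ_self n) (B.vec hm)
  rw [h4, hnext, inner_sub_right, inner_smul_right, inner_smul_right, h.inner_chainMode,
    h.inner_chainMode] at h6
  simp only [Nat.left_eq_add, one_ne_zero, if_false, if_true, mul_zero, mul_one, zero_sub,
    neg_eq_zero] at h6
  rw [h4, hnext, h6, zero_smul, sub_zero]

/-- With `u` split into its chain part and `W W* u`, the Jacobi recurrence acts on the first and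
`mulG_map` on the second. By `map_vec`, the hopping to `U_{n+1}` is the link to `W h_m`. -/
theorem mulG_eq_splitEnergy (d : ResidualData h n hm a W) :
    B.mulG = B.splitEnergy n W (fun u => (d.mem_domG_iff u).1) hm := by
  refine LinearMap.ext fun u => ?_
  set A := W.toContinuousLinearMap.adjoint with hA
  have hu : u = ∑ j ∈ Finset.range (n + 1), inner ℂ (B.chainMode j) (u : B.H1) •
      (⟨B.chainMode j, h.chainMode_mem_domG j⟩ : B.domG) +
      ⟨W (A u), d.map_mem_domG ⟨A u, d.adjoint_mem_domG u.2⟩⟩ := by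
    refine Subtype.ext ((h.decomposition d.range_eq (u : B.H1)).trans ?_)
    simp [hA]
  have h1 := d.mulG_map ⟨A u, d.adjoint_mem_domG u.2⟩
  have h2 : inner ℂ (B.vec hm) (A u) = inner ℂ (W (B.vec hm)) (u : B.H1) :=
    ContinuousLinearMap.adjoint_inner_right W.toContinuousLinearMap _ _
  have h3 : B.mulG u = ∑ j ∈ Finset.range (n + 1), inner ℂ (B.chainMode j) (u : B.H1) •
      B.mulG ⟨B.chainMode j, h.chainMode_mem_domG j⟩ +
      (W (B.mulG ⟨A u, d.adjoint_mem_domG u.2⟩) +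
        inner ℂ (W (B.vec hm)) (u : B.H1) • B.chainMode n) := by
    conv_lhs => rw [hu]
    rw [map_add, map_sum, h1, ← h2]
    simp only [map_smul]
  rw [h3, h.sum_smul_mulG_chainMode, ← d.map_vec]
  have h4 : B.transported W (fun u => (d.mem_domG_iff u).1) u =
      W (B.mulG ⟨A u, d.adjoint_mem_domG u.2⟩) := rfl
  simp only [splitEnergy, LinearMap.add_apply, LinearMap.sum_apply, LinearMap.smul_apply,
    LinearMap.comp_apply, Fock.rankOne_apply, Submodule.subtype_apply, h4]
  abel

end ResidualData

/-- The converse direction, for an arbitrary residual density: `W*` annihilates every term ending in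
a chain site, so only the transported energy and the link out of `U_n` survive. -/
theorem adjoint_mulG {n : ℕ} {W : B.H1 →ₗᵢ[ℂ] B.H1}
    (hW : ∀ u, u ∈ B.domG → W.toContinuousLinearMap.adjoint u ∈ B.domG)
    (hr : W.toLinearMap.range = (Submodule.span ℂ (B.chainMode '' {j | j < n + 1}))ᗮ) {hm : ℝ → ℝ}
    (heq : B.mulG = B.splitEnergy n W hW hm) (u : B.domG) :
    W.toContinuousLinearMap.adjoint (B.mulG u) =
      B.mulG ⟨W.toContinuousLinearMap.adjoint u, hW u u.2⟩ +
        inner ℂ (B.chainMode n) (u : B.H1) • B.vec hm := by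
  have h4 : B.transported W hW u =
      W (B.mulG ⟨W.toContinuousLinearMap.adjoint u, hW u u.2⟩) := rfl
  conv_lhs => rw [heq]
  simp only [splitEnergy, LinearMap.add_apply, LinearMap.sum_apply, LinearMap.smul_apply,
    LinearMap.comp_apply, Fock.rankOne_apply, Submodule.subtype_apply, h4, map_add, map_sum,
    map_smul, adjoint_apply]
  rw [Finset.sum_eq_zero, Finset.sum_eq_zero, adjoint_chainMode hr (Nat.lt_succ_self n)]
  · simp
  · intro j hj
    rw [adjoint_chainMode hr (Finset.mem_range.1 hj)]
    simp
  · intro j hj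
    have := Finset.mem_range.1 hj
    rw [adjoint_chainMode hr (by omega : j < n + 1),
      adjoint_chainMode hr (by omega : j + 1 < n + 1)]
    simp

end Bath.Regular

theorem mainTheorem5 {S : Type*} [NormedAddCommGroup S] [InnerProductSpace ℂ S] [CompleteSpace S]
    [Nontrivial S] (HS A : S →ₗ.[ℂ] S)
    (hdom : Dense ((HS.domain ⊓ A.domain : Submodule ℂ S) : Set S))
    (B : Bath) (hk : B.kMin < B.kMax)
    (hg_diff : DifferentiableOn ℝ B.g B.K) (hg_inj : Set.InjOn B.g B.K)
    (hg_nonneg : ∀ k ∈ B.K, 0 ≤ B.g k)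
    (hh : MemLp B.h 2 (volume.restrict B.K))
    (hmom : B.FiniteMoments) (hgap : B.Gapless) :
    (ContinuousOn B.J B.freq →
      ∀ n : ℕ, 1 ≤ n → ∃ Jn : ℝ → ℝ, B.IsResidualSpectralDensity HS A n Jn) ∧
    ∀ n : ℕ, 1 ≤ n → ∀ Jn : ℝ → ℝ, B.IsResidualSpectralDensity HS A n Jn →
      ∀ᵐ ω ∂(volume.restrict B.freq), ∃ φ : ℝ, OP.HasReducer B.lam ω φ ∧
        Jn ω = B.J ω /
          (((OP.orthonormalPoly B.lam (n - 1)).eval ω * φ / 2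
              - OP.secondaryPoly B.lam (n - 1) ω) ^ 2
            + B.J ω ^ 2 * (OP.orthonormalPoly B.lam (n - 1)).eval ω ^ 2) := by
  have h : B.Regular := ⟨hk, hg_diff, hg_inj, hh, hmom, hgap⟩
  -- A dense subspace of a nontrivial space contains a nonzero vector; it serves as the test vector
  -- in the system factor.
  have hs : ∃ s ∈ Bath.sysDom HS A, s ≠ 0 := by
    by_contra! h0
    obtain ⟨s, hs⟩ := exists_ne (0 : S)
    have h1 : (Bath.sysDom HS A : Set S) ⊆ {0} := fun x hx => h0 x hx
    have h2 := (hdom.mono h1).closure_eq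
    rw [isClosed_singleton.closure_eq] at h2
    exact hs (h2.ge (Set.mem_univ s))
  refine ⟨fun hJ n hn => ?_, fun n hn Jn hJn => ?_⟩
  · obtain ⟨n, rfl⟩ := Nat.exists_eq_add_of_le' hn
    obtain ⟨hm, a, W, d⟩ := h.exists_residualData hJ n
    exact ⟨({ B with h := hm } : Bath).J, hm, W, d.mem_domG_iff, d.memLp, d.range_eq,
      (h.hamiltonian_eq_iff HS A hs n W _ d.range_eq hm).2 d.mulG_eq_splitEnergy, fun _ _ => rfl⟩
  · obtain ⟨n, rfl⟩ := Nat.exists_eq_add_of_le' hn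
    obtain ⟨hm, W, hW, hmL, hr, hH, hJm⟩ := hJn
    have heq := (h.hamiltonian_eq_iff HS A hs n W _ hr hm).1 hH
    have hform := h.residual_formula (fun u => (hW u).1) hr hmL
      (Bath.Regular.adjoint_mulG (fun u => (hW u).1) hr heq)
    rw [ae_restrict_iff' Bath.isOpen_freq.measurableSet] at hform ⊢
    filter_upwards [hform] with ω hω hωf
    obtain ⟨φ, hφ, hφJ⟩ := hω hωf
    refine ⟨φ, hφ, ?_⟩
    rw [hJm ω hωf, hφJ]
    rfl
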